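/- **Corollary 5.7.** All actions of a countable group on a probability space are by measurable, measure preserving maps. An action $\Gamma\curvearrowright(X,\mu)$ is *free* if $\mu(\{x:\gamma x=x\})=0$ for all $\gamma\neq e$; its orbit equivalence relation is $\mathcal R_\Gamma=\{(x,\gamma x)\mid x\in X,\gamma\in\Gamma\}$. For an ergodic countable measure preserving equivalence relation $\mathcal R$ on a standard probability space $(X,\mu)$ and $t>0$, let $\mathcal R^t$ be the isomorphism class of the relation $(x,i)\sim(y,j)\Leftrightarrow x\,\mathcal R\,y$ restricted to a measurable set $Y\subset X\times\mathbb N$ with $(\mu\times c)(Y)=t$, where $c$ is the counting measure and $Y$ carries the probability measure $t^{-1}(\mu\times c)|_Y$ (the class does not depend on $Y$). Relations are isomorphic if there is a probability space isomorphism $\theta$ (modulo null sets) which, for almost every $x$, maps the class of $x$ bijectively onto the class of $\theta(x)$. Let $\mathcal S(\mathcal R)$ be the set of $t>0$ such that $\mathcal R^t$ is induced by (that is, is the class of the orbit equivalence relation of) a free ergodic measure preserving action of a countable group on a standard probability space. Let $\Gamma$ be a countable group with an infinite normal subgroup $\Gamma_0$ such that $\Gamma/\Gamma_0$ is finitely generated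 and the inclusion $\Gamma_0\subset\Gamma$ has relative property (T): every unitary representation of $\Gamma$ that weakly contains the trivial representation of $\Gamma$ has a nonzero $\Gamma_0$-invariant vector. Let $\Gamma\curvearrowright^{\alpha}(X,\mu)$ be a free ergodic measure preserving action on a standard probability space whose restriction to $\Gamma_0$ is also ergodic. Suppose that $\alpha$ is (isomorphic to) the inverse limit $\varprojlim\alpha_n$ of a sequence of measure preserving actions $\Gamma\curvearrowright^{\alpha_n}(X_n,\mu_n)$, $n\ge1$, on finite probability spaces in which every point has positive mass, along measure preserving $\Gamma$-equivariant surjections $X_{n+1}\to X_n$. Then $$\mathcal S(\mathcal R_\Gamma)=\{\,m/|X_n| \;:\; m,n\ge 1\,\}\subset\mathbb Q_+^{*}.$$ -/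

import Mathlib

open MeasureTheory

universe u v w

/-! ### Relative property (T) -/

/-- The inclusion `Γ₀ ⊂ Γ` has relative property (T): every unitary representation of `Γ` that weakly
contains the trivial representation of `Γ` (it has almost invariant unit vectors, for every finite set
of group elements and every `ε > 0`) contains the trivial representation of `Γ₀` (it has a nonzero
`Γ₀`-invariant vector). For countable `Γ` the notion does not depend on the universe `w` of the
Hilbert spaces, because it can be tested on separable ones. -/
def HasRelativePropertyT {Γ : Type u} [Group Γ] (Γ₀ : Subgroup Γ) : Prop :=
  ∀ (H : Type w) [NormedAddCommGroup H] [InnerProductSpace ℂ H] [CompleteSpace H]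
    (π : Γ →* (H ≃ₗᵢ[ℂ] H)),
    (∀ (F : Finset Γ) (ε : ℝ), 0 < ε → ∃ ξ : H, ‖ξ‖ = 1 ∧ ∀ γ ∈ F, ‖π γ ξ - ξ‖ < ε) →
    ∃ η : H, η ≠ 0 ∧ ∀ γ ∈ Γ₀, π γ η = η

/-! ### Measure preserving actions and equivalence relations -/

/-- Essential freeness: every `γ ≠ 1` fixes only a null set of points. -/
def IsEssentiallyFree (Γ : Type*) [Group Γ] {X : Type*} [MeasurableSpace X] [MulAction Γ X]
    (μ : Measure X) : Prop :=
  ∀ γ : Γ, γ ≠ 1 → μ {x : X | γ • x = x} = 0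

/-- `θ` is an isomorphism of measure spaces modulo null sets. -/
def IsMeasureIso {X Y : Type*} [MeasurableSpace X] [MeasurableSpace Y]
    (μ : Measure X) (ν : Measure Y) (θ : X → Y) : Prop :=
  MeasurePreserving θ μ ν ∧
    ∃ η : Y → X, MeasurePreserving η ν μ ∧ (∀ᵐ x ∂μ, η (θ x) = x) ∧ ∀ᵐ y ∂ν, θ (η y) = y

/-- The actions of `Γ` on `(X, μ)` and `(Y, ν)` are isomorphic. -/
def AreIsomorphicActions (Γ : Type*) [Group Γ] {X Y : Type*}
    [MeasurableSpace X] [MeasurableSpace Y] [MulAction Γ X] [MulAction Γ Y]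
    (μ : Measure X) (ν : Measure Y) : Prop :=
  ∃ θ : X → Y, IsMeasureIso μ ν θ ∧ ∀ γ : Γ, ∀ᵐ x ∂μ, θ (γ • x) = γ • θ x

/-- The equivalence relations `R` on `(X, μ)` and `S` on `(Y, ν)` are isomorphic (orbit equivalent):
some isomorphism of measure spaces `θ` restricts, for almost every `x`, to a bijection
from the `R`-class of `x` onto the `S`-class of `θ x`. -/
def AreOrbitEquivalent {X Y : Type*} [MeasurableSpace X] [MeasurableSpace Y]
    (μ : Measure X) (R : Setoid X) (ν : Measure Y) (S : Setoid Y) : Prop :=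
  ∃ θ : X → Y, IsMeasureIso μ ν θ ∧
    ∀ᵐ x ∂μ, Set.BijOn θ {x' | R x x'} {y | S (θ x) y}

/-- `S` on `(Y, ν)` is (up to isomorphism) the orbit equivalence relation of a free ergodic measure
preserving action of a countable group on a standard probability space. Every countable group and
every standard Borel space has an isomorphic copy in `Type`. -/
def IsInducedByFreeErgodicAction {Y : Type*} [MeasurableSpace Y]
    (ν : Measure Y) (S : Setoid Y) : Prop :=
  ∃ (Λ : Type) (_ : Group Λ) (_ : Countable Λ)
    (Z : Type) (_ : MeasurableSpace Z) (_ : StandardBorelSpace Z)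
    (ρ : Measure Z) (_ : IsProbabilityMeasure ρ)
    (_ : MulAction Λ Z) (_ : MeasurableConstSMul Λ Z),
    ErgodicSMul Λ Z ρ ∧ IsEssentiallyFree Λ ρ ∧
      AreOrbitEquivalent ν S ρ (MulAction.orbitRel Λ Z)

/-! ### Amplifications -/

/-- The restriction to `Y ⊆ X × ℕ` of the relation `(x, i) ∼ (y, j) ↔ R x y`. -/
def amplifiedRel {X : Type*} (R : Setoid X) (Y : Set (X × ℕ)) : Setoid Y :=
  (R.comap Prod.fst).comap (Subtype.val : Y → X × ℕ)

/-- The measure `t⁻¹ (μ × c)|_Y` on `Y ⊆ X × ℕ`, with `c` the counting measure on `ℕ`. -/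
noncomputable def amplifiedMeasure {X : Type*} [MeasurableSpace X] (μ : Measure X) (t : ℝ)
    (Y : Set (X × ℕ)) : Measure Y :=
  (ENNReal.ofReal t)⁻¹ • (μ.prod Measure.count).comap (Subtype.val : Y → X × ℕ)

/-- The set `𝒮(R)` of the `t > 0` such that the amplification `R^t` is induced by a free ergodic measure
preserving action of a countable group. Here `R^t` is the isomorphism class of the restriction of
`R × (ℕ × ℕ)` to a measurable set `Y ⊆ X × ℕ` of measure `t`; for ergodic `R` on a standard
probability space it does not depend on the choice of `Y`. -/
def amplificationSet {X : Type*} [MeasurableSpace X] (μ : Measure X) (R : Setoid X) : Set ℝ :=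
  {t | 0 < t ∧ ∃ Y : Set (X × ℕ), MeasurableSet Y ∧
    (μ.prod Measure.count) Y = ENNReal.ofReal t ∧
    IsInducedByFreeErgodicAction (amplifiedMeasure μ t Y) (amplifiedRel R Y)}

/-! ### Inverse limits of finite actions -/

/-- A sequence of measure preserving actions of `Γ` on finite probability spaces, all of whose points
have positive mass, each a quotient of the next one. As no point is null, the quotient maps are
equivariant everywhere. -/
structure FiniteActionTower (Γ : Type u) [Group Γ] where
  Level : ℕ → Type w
  [finite : ∀ n, Finite (Level n)]
  [measurableSpace : ∀ n, MeasurableSpace (Level n)]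
  [singleton : ∀ n, MeasurableSingletonClass (Level n)]
  [action : ∀ n, MulAction Γ (Level n)]
  measure : ∀ n, Measure (Level n)
  [prob : ∀ n, IsProbabilityMeasure (measure n)]
  [invariant : ∀ n, SMulInvariantMeasure Γ (Level n) (measure n)]
  pos : ∀ n (a : Level n), 0 < measure n {a}
  q : ∀ n, Level (n + 1) → Level n
  q_surjective : ∀ n, Function.Surjective (q n)
  q_measurePreserving : ∀ n, MeasurePreserving (q n) (measure (n + 1)) (measure n)
  q_smul : ∀ n (γ : Γ) (a : Level (n + 1)), q n (γ • a) = γ • q n a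

namespace FiniteActionTower

attribute [instance] finite measurableSpace singleton action prob invariant

variable {Γ : Type u} [Group Γ]

/-- The underlying set of the inverse limit. -/
def Limit (T : FiniteActionTower.{u, w} Γ) : Type w :=
  {x : ∀ n, T.Level n // ∀ n, T.q n (x (n + 1)) = x n}

/-- The projection of the inverse limit to the `n`-th level. -/
def r (T : FiniteActionTower.{u, w} Γ) (n : ℕ) (x : T.Limit) : T.Level n := x.1 n

/-- The σ-algebra generated by the projections (restricted from the product). -/
instance (T : FiniteActionTower.{u, w} Γ) : MeasurableSpace T.Limit :=
  inferInstanceAs (MeasurableSpace {x : ∀ n, T.Level n // ∀ n, T.q n (x (n + 1)) = x n})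

/-- The limit action, `γ • (xₙ)ₙ = (γ • xₙ)ₙ`. -/
instance (T : FiniteActionTower.{u, w} Γ) : MulAction Γ T.Limit where
  smul γ x := ⟨fun n => γ • x.1 n, fun n => by rw [T.q_smul, x.2 n]⟩
  one_smul x := Subtype.ext (funext fun n => one_smul Γ (x.1 n))
  mul_smul γ δ x := Subtype.ext (funext fun n => mul_smul γ δ (x.1 n))

/-- `ν` is the limit measure: the (unique) measure for which all projections preserve the measure. -/
def IsLimitMeasure (T : FiniteActionTower.{u, w} Γ) (ν : Measure T.Limit) : Prop :=
  ∀ n, MeasurePreserving (T.r n) ν (T.measure n)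

/-- The action of `Γ` on `(X, μ)` is (isomorphic to) the limit of the actions of the tower. -/
def HasLimit (T : FiniteActionTower.{u, w} Γ) {X : Type*} [MeasurableSpace X] [MulAction Γ X]
    (μ : Measure X) : Prop :=
  ∃ ν : Measure T.Limit, T.IsLimitMeasure ν ∧ AreIsomorphicActions Γ μ ν

end FiniteActionTower

/-!
# Amplifications of profinite actions that are induced by free actions

**The amplifications by `m / |X_n|` are induced by free actions.** The fibre `F` of `X` over a point
`a` of `X_n` has measure `1 / |X_n|`, and two points of `F` lie in the same orbit of `Γ` exactly if
they lie in the same orbit of the stabilizer of `a`. The group `stabilizer × ℤ/m` acts freely on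
`F × {0, …, m - 1}`; the action is ergodic because the stabilizer acts ergodically on `F`
(`ProfiniteSystem.ergodicSMul_cond`), and its orbit relation is the restriction of the relation of
`Γ` (`isInducedByFreeErgodicAction_prod`).

**No others are.** An isomorphism of an amplification by `t` with the orbit relation of a free action
of `Λ` on `(Z, ρ)` restricts to an injection of a set of positive measure of `X` into `Z` that
divides measures by `t` and preserves the relations
(`exists_partialOrbitEquivalence`). Moving every point of `X` into that set by an element of `Γ`
extends the map to almost all of `X`, and freeness of `Λ` gives a Zimmer cocycle `w : Γ × X → Λ`
(`PartialOrbitEquivalence.exists_extension`). The heart of the proof is a cocycle superrigidity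
theorem (`cocycle_superrigidity`): on the fibre over some point of some `X_n`, and for the
stabilizer of that point, `w` is cohomologous to a homomorphism.

* Let `Γ` act on `X × X × Λ` by the skew product with `w(γ, x) l w(γ, y)⁻¹`. As the σ-algebras of the
  levels generate that of `X`, the sets `{x, y in the same fibre over X_n} × {1}` are, after
  normalization, almost invariant under every `γ` as `n → ∞`. Relative property (T) gives an
  invariant set near one of them, hence `γ ∈ Γ₀` moves it little, *uniformly in `γ`*: for large `n`
  the map `w(γ, ·)` is, up to a small error, constant on some fibre for all `γ ∈ Γ₀` in the
  stabilizer (`exists_near_constant`).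
* The nearly constant values form a homomorphism (`exists_hom_near`). Two cocycles that are
  uniformly close are cohomologous, again by an invariant set in a skew product, which comes from
  the vector of minimal norm in the closed convex hull of an orbit
  (`exists_cohomologous_of_near`, `exists_fixed_of_forall_norm_sub_le`).
* After untwisting, the cocycle is a homomorphism on a subgroup normal in the stabilizer. For a
  further `g`, the set where `w(g, ·)` takes the value that has the majority in the fibre around the
  point is invariant under a group acting ergodically, so it is conull and `w(g, ·)` is constant on
  fibres of a finer level (`exists_factorsThrough_of_hom_on_normal`). As `Γ / Γ₀` is finitely
  generated, finitely many `g` suffice, and one level serves for all of them.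

The untwisted map `q` from a fibre to `Z` is then equivariant along a homomorphism `r`. The kernel
of `r` is finite, since it moves a set on which `q` is injective to disjoint sets of the same
measure. So `r` is injective on the stabilizer of a point of a finer level, and there `q` is
injective. The images of the fibre under
coset representatives of the range of `r` tile `Z` by ergodicity of `Λ`; there are `m` of them of
measure `1 / (t |X_n|)` each, so `t = m / |X_n|` (`PartialOrbitEquivalence.exists_scale_eq`).
-/

/-! ### Almost invariant vectors -/

section Hilbert

variable {G : Type*} [Group G] {H : Type*} [NormedAddCommGroup H] [InnerProductSpace ℂ H]

theorem rep_mul_apply (π : G →* (H ≃ₗᵢ[ℂ] H)) (g h : G) (v : H) : π (g * h) v = π g (π h v) := by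
  rw [map_mul]; rfl

/-- A vector which is moved by at most `c` by a whole group of isometries is within `c` of a fixed
vector, namely of the vector of minimal norm in the closed convex hull of its orbit. -/
theorem exists_fixed_of_forall_norm_sub_le [CompleteSpace H] (π : G →* (H ≃ₗᵢ[ℂ] H)) (ξ : H) (c : ℝ)
    (h : ∀ g, ‖π g ξ - ξ‖ ≤ c) : ∃ η : H, (∀ g, π g η = η) ∧ ‖ξ - η‖ ≤ c := by
  let _ : InnerProductSpace ℝ H := InnerProductSpace.complexToReal
  set K : Set H := closedConvexHull ℝ (Set.range fun g => π g ξ) with hK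
  have hsub : (Set.range fun g => π g ξ) ⊆ K := subset_closedConvexHull
  have hne : K.Nonempty := ⟨_, hsub ⟨1, rfl⟩⟩
  have hconv : Convex ℝ K := convex_closedConvexHull
  have hcl : IsClosed K := isClosed_closedConvexHull
  have hinv : ∀ g, ∀ x ∈ K, π g x ∈ K := by
    intro g
    have : K ⊆ (π g) ⁻¹' K := by
      apply closedConvexHull_min
      · rintro _ ⟨k, rfl⟩
        exact hsub ⟨g * k, rep_mul_apply π g k ξ⟩
      · exact hconv.linear_preimage ((π g : H →ₗ[ℂ] H).restrictScalars ℝ)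
      · exact hcl.preimage (π g).continuous
    exact this
  obtain ⟨v, hv, hmin⟩ := exists_norm_eq_iInf_of_complete_convex hne hcl.isComplete hconv 0
  have key : ∀ g, π g v = v := by
    intro g
    have hmin' : ‖(0 : H) - π g v‖ = ⨅ w : K, ‖0 - (w : H)‖ := by
      rw [← hmin]; simp
    have h1 := (norm_eq_iInf_iff_real_inner_le_zero hconv hv).1 hmin _ (hinv g v hv)
    have h2 := (norm_eq_iInf_iff_real_inner_le_zero hconv (hinv g v hv)).1 hmin' _ hv
    have h3 : inner ℝ (π g v - v) (π g v - v) ≤ 0 := by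
      have : inner ℝ (π g v - v) (π g v - v)
          = inner ℝ (0 - v) (π g v - v) + inner ℝ (0 - π g v) (v - π g v) := by
        simp only [inner_sub_left, inner_sub_right, inner_zero_left]; ring
      linarith
    have h4 : π g v - v = 0 := by
      rw [real_inner_self_eq_norm_sq] at h3
      exact norm_eq_zero.1 (pow_eq_zero_iff two_ne_zero |>.1 (le_antisymm h3 (sq_nonneg _)))
    exact sub_eq_zero.1 h4
  refine ⟨v, key, ?_⟩
  have hball : K ⊆ Metric.closedBall ξ c := by
    apply closedConvexHull_min
    · rintro _ ⟨g, rfl⟩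
      simpa [dist_eq_norm] using h g
    · exact convex_closedBall _ _
    · exact Metric.isClosed_closedBall
  have := hball hv
  rwa [Metric.mem_closedBall, dist_comm, dist_eq_norm] at this

end Hilbert

section RelT

variable {Γ : Type u} [Group Γ] {H : Type v} [NormedAddCommGroup H] [InnerProductSpace ℂ H]

/-- The closed subspace of the vectors fixed by a subgroup. -/
def fixedSubspace (π : Γ →* (H ≃ₗᵢ[ℂ] H)) (Γ₀ : Subgroup Γ) : Submodule ℂ H where
  carrier := {v | ∀ g ∈ Γ₀, π g v = v}
  add_mem' := fun ha hb g hg => by rw [map_add, ha g hg, hb g hg]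
  zero_mem' := fun g _ => map_zero _
  smul_mem' := fun c x hx g hg => by rw [map_smul, hx g hg]

theorem isClosed_fixedSubspace (π : Γ →* (H ≃ₗᵢ[ℂ] H)) (Γ₀ : Subgroup Γ) :
    IsClosed (fixedSubspace π Γ₀ : Set H) := by
  have : (fixedSubspace π Γ₀ : Set H) = ⋂ g ∈ Γ₀, {v | π g v = v} := by
    ext v; simp [fixedSubspace]
  rw [this]
  exact isClosed_biInter fun g _ => isClosed_eq (π g).continuous continuous_id

theorem map_mem_fixedSubspace (π : Γ →* (H ≃ₗᵢ[ℂ] H)) (Γ₀ : Subgroup Γ) [hn : Γ₀.Normal] (g : Γ)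
    {v : H} (hv : v ∈ fixedSubspace π Γ₀) : π g v ∈ fixedSubspace π Γ₀ := by
  intro k hk
  have h1 := hv _ (hn.conj_mem k hk g⁻¹)
  have h2 : π k (π g v) = π g (π (g⁻¹ * k * g⁻¹⁻¹) v) := by
    rw [← rep_mul_apply, ← rep_mul_apply]
    congr 2; group
  rw [h2, h1]

theorem map_mem_orthogonal_fixedSubspace (π : Γ →* (H ≃ₗᵢ[ℂ] H)) (Γ₀ : Subgroup Γ) [Γ₀.Normal]
    (g : Γ) {v : H} (hv : v ∈ (fixedSubspace π Γ₀)ᗮ) : π g v ∈ (fixedSubspace π Γ₀)ᗮ := by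
  rw [Submodule.mem_orthogonal] at hv ⊢
  intro u hu
  have h1 := hv _ (map_mem_fixedSubspace π Γ₀ g⁻¹ hu)
  have h2 : u = π g (π g⁻¹ u) := by
    rw [← rep_mul_apply]; simp
  rw [h2, LinearIsometryEquiv.inner_map_map, h1]

/-- The restriction of a unitary representation to an invariant subspace. -/
def restrictRep (π : Γ →* (H ≃ₗᵢ[ℂ] H)) (K : Submodule ℂ H) (hK : ∀ g, ∀ v ∈ K, π g v ∈ K) :
    Γ →* (K ≃ₗᵢ[ℂ] K) where
  toFun g :=
    { toFun := fun v => ⟨π g v, hK g v v.2⟩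
      invFun := fun v => ⟨π g⁻¹ v, hK g⁻¹ v v.2⟩
      map_add' := fun a b => Subtype.ext (by simp)
      map_smul' := fun a b => Subtype.ext (by simp)
      left_inv := fun v => Subtype.ext (by
        simp)
      right_inv := fun v => Subtype.ext (by
        simp)
      norm_map' := fun v => by
        change ‖π g v‖ = ‖(v : H)‖
        simp }
  map_one' := by ext v; simp
  map_mul' g h := by ext v; simp

@[simp] theorem coe_restrictRep (π : Γ →* (H ≃ₗᵢ[ℂ] H)) (K : Submodule ℂ H)
    (hK : ∀ g, ∀ v ∈ K, π g v ∈ K) (g : Γ) (v : K) : (restrictRep π K hK g v : H) = π g v := rfl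

/-- For a normal subgroup `Γ₀` with relative property (T), almost invariant unit vectors are close to
`Γ₀`-fixed vectors: otherwise their components orthogonal to the `Γ₀`-fixed vectors would be almost
invariant in a subrepresentation without `Γ₀`-fixed vectors. -/
theorem HasRelativePropertyT.exists_fixed_near [CompleteSpace H] {Γ₀ : Subgroup Γ} [Γ₀.Normal]
    (hT : HasRelativePropertyT.{u, v} Γ₀) (π : Γ →* (H ≃ₗᵢ[ℂ] H)) (ξ : ℕ → H)
    (hξ : ∀ g, Filter.Tendsto (fun n => ‖π g (ξ n) - ξ n‖) Filter.atTop (nhds 0))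
    {δ : ℝ} (hδ : 0 < δ) : ∃ n η, (∀ g ∈ Γ₀, π g η = η) ∧ ‖ξ n - η‖ ≤ δ := by
  by_contra hcon
  push Not at hcon
  set F := fixedSubspace π Γ₀ with hF
  have : CompleteSpace F := (isClosed_fixedSubspace π Γ₀).completeSpace_coe
  have hK : ∀ g, ∀ v ∈ Fᗮ, π g v ∈ Fᗮ := fun g v hv => map_mem_orthogonal_fixedSubspace π Γ₀ g hv
  obtain ⟨η, hη0, hη⟩ := hT Fᗮ (restrictRep π Fᗮ hK) (by
    intro S ε hε
    have hev : ∀ᶠ n in Filter.atTop, ∀ g ∈ S, ‖π g (ξ n) - ξ n‖ < ε * δ := by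
      rw [Filter.eventually_all_finset]
      intro g _
      exact (hξ g).eventually_lt_const (by positivity)
    obtain ⟨n, hn⟩ := hev.exists
    set a : F := F.orthogonalProjectionOnto (ξ n) with ha
    have hbm : ξ n - a ∈ Fᗮ := F.sub_starProjection_mem_orthogonal (ξ n)
    set b : Fᗮ := ⟨ξ n - a, hbm⟩ with hb
    have hbn : δ < ‖b‖ := hcon n a a.2
    have hb0 : 0 < ‖b‖ := hδ.trans hbn
    refine ⟨((‖b‖⁻¹ : ℝ) : ℂ) • b, ?_, ?_⟩
    · rw [norm_smul, Complex.norm_real, Real.norm_of_nonneg (by positivity)]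
      field_simp
    · intro g hg
      rw [map_smul, ← smul_sub, norm_smul, Complex.norm_real, Real.norm_of_nonneg (by positivity)]
      have hle : ‖restrictRep π Fᗮ hK g b - b‖ ≤ ‖π g (ξ n) - ξ n‖ := by
        have e1 : π g (ξ n) - ξ n
            = (π g a - a) + ((restrictRep π Fᗮ hK g b - b : Fᗮ) : H) := by
          simp only [hb, AddSubgroupClass.coe_sub, coe_restrictRep, map_sub]
          abel
        have hor : inner ℂ (π g a - a : H) ((restrictRep π Fᗮ hK g b - b : Fᗮ) : H) = 0 :=
          (Submodule.mem_orthogonal F _).1 (restrictRep π Fᗮ hK g b - b).2 _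
            (F.sub_mem (map_mem_fixedSubspace π Γ₀ g a.2) a.2)
        have e2 := norm_add_sq_eq_norm_sq_add_norm_sq_of_inner_eq_zero _ _ hor
        rw [← e1] at e2
        have e3 : ‖restrictRep π Fᗮ hK g b - b‖ = ‖((restrictRep π Fᗮ hK g b - b : Fᗮ) : H)‖ := rfl
        rw [e3]
        apply le_of_sq_le_sq _ (norm_nonneg _)
        nlinarith [norm_nonneg (π g a - a : H)]
      calc ‖b‖⁻¹ * ‖restrictRep π Fᗮ hK g b - b‖ ≤ ‖b‖⁻¹ * ‖π g (ξ n) - ξ n‖ := by gcongr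
        _ < ‖b‖⁻¹ * (ε * δ) := by gcongr; exact hn g hg
        _ ≤ ‖b‖⁻¹ * (ε * ‖b‖) := by gcongr
        _ = ε := by field_simp)
  have hmem : (η : H) ∈ F := fun g hg => by
    have := congrArg (Subtype.val) (hη g hg)
    simpa using this
  have := (Submodule.mem_orthogonal F _).1 η.2 _ hmem
  exact hη0 (Subtype.ext (inner_self_eq_zero.1 this))

end RelT

/-! ### Almost invariant sets -/

section Koopman

open scoped ENNReal symmDiff

variable {W : Type*} [MeasurableSpace W] {m : Measure W}

/-- The indicator function of a set of finite measure, as a vector of `L²`. -/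
noncomputable def indicatorVec (m : Measure W) {S : Set W} (hS : MeasurableSet S) (hm : m S ≠ ∞) :
    Lp ℂ 2 m := indicatorConstLp 2 hS hm 1

theorem enorm_indicatorVec_sub {S T : Set W} (hS : MeasurableSet S) (hm : m S ≠ ∞)
    (hT : MeasurableSet T) (hm' : m T ≠ ∞) :
    ‖indicatorVec m hS hm - indicatorVec m hT hm'‖ₑ ^ 2 = m (S ∆ T) := by
  rw [← edist_eq_enorm_sub, indicatorVec, indicatorVec, edist_indicatorConstLp_eq_enorm,
    Lp.enorm_def, eLpNorm_congr_ae indicatorConstLp_coeFn,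
    eLpNorm_indicator_const (hS.symmDiff hT) two_ne_zero ENNReal.ofNat_ne_top, enorm_one, one_mul,
    ← ENNReal.rpow_natCast, ← ENNReal.rpow_mul]
  simp

/-- The set where the modulus of a function is greater than `1/2`. -/
def largeSet (f : Lp ℂ 2 m) : Set W := {x | 1 / 2 < ‖f x‖}

theorem measurableSet_largeSet (f : Lp ℂ 2 m) : MeasurableSet (largeSet f) :=
  measurableSet_lt measurable_const (Lp.stronglyMeasurable f).norm.measurable

theorem measure_symmDiff_largeSet_le {S : Set W} (hS : MeasurableSet S) (hm : m S ≠ ∞)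
    (f : Lp ℂ 2 m) : m (S ∆ largeSet f) ≤ 4 * ‖indicatorVec m hS hm - f‖ₑ ^ 2 := by
  set F := indicatorVec m hS hm - f with hF
  have h1 : m (S ∆ largeSet f) ≤ m {x | (2⁻¹ : ℝ≥0∞) ≤ ‖F x‖ₑ} := by
    apply measure_mono_ae
    filter_upwards [Lp.coeFn_sub (indicatorVec m hS hm) f,
      (indicatorConstLp_coeFn : indicatorConstLp 2 hS hm (1 : ℂ) =ᵐ[m] _)] with x hx hx2 hmem
    change (2⁻¹ : ℝ≥0∞) ≤ ‖F x‖ₑ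
    have h2 : (1 / 2 : ℝ) ≤ ‖F x‖ := by
      rw [hx, Pi.sub_apply]
      change (x ∈ S \ largeSet f ∪ largeSet f \ S) at hmem
      rcases hmem with ⟨ha, hb⟩ | ⟨ha, hb⟩
      · have e : indicatorVec m hS hm x = 1 := by
          rw [indicatorVec, hx2, Set.indicator_of_mem ha]
        rw [e]
        have hb' : ‖f x‖ ≤ 1 / 2 := not_lt.1 hb
        have := norm_sub_norm_le (1 : ℂ) (f x)
        rw [norm_one] at this
        linarith
      · have e : indicatorVec m hS hm x = 0 := by
          rw [indicatorVec, hx2, Set.indicator_of_notMem hb]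
        rw [e, zero_sub, norm_neg]
        exact (show 1 / 2 < ‖f x‖ from ha).le
    rw [← ofReal_norm]
    calc (2⁻¹ : ℝ≥0∞) = ENNReal.ofReal (1 / 2) := by
          rw [one_div, ENNReal.ofReal_inv_of_pos two_pos]; simp
      _ ≤ _ := ENNReal.ofReal_le_ofReal h2
  refine h1.trans ?_
  have h3 := meas_ge_le_mul_pow_eLpNorm_enorm m (p := 2) two_ne_zero ENNReal.ofNat_ne_top
    (Lp.aestronglyMeasurable F) (ε := 2⁻¹) (by simp) (by simp)
  refine h3.trans_eq ?_
  rw [inv_inv, Lp.enorm_def, ENNReal.toReal_ofNat]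
  rw [ENNReal.rpow_ofNat, ENNReal.rpow_ofNat]
  norm_num

variable {G : Type*} [Group G] [MulAction G W] [MeasurableConstSMul G W] [SMulInvariantMeasure G W m]

/-- The unitary representation on `L²` of a measure preserving action, `(g f)(x) = f (g⁻¹ x)`. -/
noncomputable def koopman (G : Type*) [Group G] [MulAction G W] [MeasurableConstSMul G W]
    (m : Measure W) [SMulInvariantMeasure G W m] : G →* (Lp ℂ 2 m ≃ₗᵢ[ℂ] Lp ℂ 2 m) where
  toFun g :=
    { toFun := fun f => DomMulAct.mk g⁻¹ • f
      invFun := fun f => DomMulAct.mk g • f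
      map_add' := fun a b => smul_add _ a b
      map_smul' := fun a b => smul_comm _ a b
      left_inv := fun f => by
        change DomMulAct.mk g • DomMulAct.mk g⁻¹ • f = f
        rw [smul_smul, ← DomMulAct.mk_mul]; simp
      right_inv := fun f => by
        change DomMulAct.mk g⁻¹ • DomMulAct.mk g • f = f
        rw [smul_smul, ← DomMulAct.mk_mul]; simp
      norm_map' := fun f => DomMulAct.norm_smul_Lp _ f }
  map_one' := by
    ext1 f
    change DomMulAct.mk (1 : G)⁻¹ • f = f
    simp
  map_mul' g h := by
    ext1 f
    change DomMulAct.mk (g * h)⁻¹ • f = DomMulAct.mk g⁻¹ • DomMulAct.mk h⁻¹ • f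
    rw [smul_smul, ← DomMulAct.mk_mul, mul_inv_rev]

theorem koopman_apply (g : G) (f : Lp ℂ 2 m) : koopman G m g f = DomMulAct.mk g⁻¹ • f := rfl

theorem enorm_koopman_indicatorVec_sub (g : G) {S : Set W} (hS : MeasurableSet S) (hm : m S ≠ ∞) :
    ‖koopman G m g (indicatorVec m hS hm) - indicatorVec m hS hm‖ₑ ^ 2
      = m (((g⁻¹ • ·) ⁻¹' S) ∆ S) := by
  rw [koopman_apply, indicatorVec, DomMulAct.mk_smul_indicatorConstLp]
  exact enorm_indicatorVec_sub _ _ _ _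

theorem preimage_largeSet_of_fixed (g : G) (f : Lp ℂ 2 m) (hf : koopman G m g⁻¹ f = f) :
    ((g • ·) ⁻¹' largeSet f : Set W) =ᵐ[m] largeSet f := by
  have h := DomMulAct.smul_Lp_ae_eq (DomMulAct.mk g) f
  have h2 : DomMulAct.mk g • f = f := by
    have := hf
    rwa [koopman_apply, inv_inv] at this
  rw [h2] at h
  filter_upwards [h] with x hx
  have : ‖f x‖ = ‖f (g • x)‖ := by rw [hx]; rfl
  change (1 / 2 < ‖f (g • x)‖) = (1 / 2 < ‖f x‖)
  rw [this]

/-- A set of finite measure that is moved little by every element of a group is close to an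
invariant set. -/
theorem exists_invariant_set_near {S : Set W} (hS : MeasurableSet S) (hm : m S ≠ ∞)
    {c : ℝ≥0∞} (hc : c ≠ ∞) (h : ∀ g : G, m (((g • ·) ⁻¹' S) ∆ S) ≤ c) :
    ∃ S' : Set W, MeasurableSet S' ∧ (∀ g : G, ((g • ·) ⁻¹' S' : Set W) =ᵐ[m] S') ∧
      m (S ∆ S') ≤ 4 * c := by
  obtain ⟨η, hη, hle⟩ := exists_fixed_of_forall_norm_sub_le (koopman G m) (indicatorVec m hS hm)
    (Real.sqrt c.toReal) (fun g => by
      apply Real.le_sqrt_of_sq_le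
      rw [← toReal_enorm, ← ENNReal.toReal_pow, enorm_koopman_indicatorVec_sub]
      exact ENNReal.toReal_mono hc (h g⁻¹))
  refine ⟨largeSet η, measurableSet_largeSet η, fun g => preimage_largeSet_of_fixed g η (hη _),
    (measure_symmDiff_largeSet_le hS hm η).trans ?_⟩
  gcongr
  rw [← ofReal_norm, ← ENNReal.ofReal_pow (norm_nonneg _)]
  apply ENNReal.ofReal_le_of_le_toReal
  calc _ ≤ (Real.sqrt c.toReal) ^ 2 := by gcongr
    _ = _ := Real.sq_sqrt ENNReal.toReal_nonneg

end Koopman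

section RelTSets

open scoped ENNReal symmDiff
open Filter

/-- Relative property (T) for a measure preserving action of `Γ`: almost invariant sets are close to
`Γ₀`-invariant sets. -/
theorem HasRelativePropertyT.exists_invariant_set_near {Γ : Type u} [Group Γ] {Γ₀ : Subgroup Γ}
    [Γ₀.Normal] (hT : HasRelativePropertyT.{u, v} Γ₀) {W : Type v} [MeasurableSpace W]
    (m : Measure W) [MulAction Γ W] [MeasurableConstSMul Γ W] [SMulInvariantMeasure Γ W m]
    {S : ℕ → Set W} (hS : ∀ n, MeasurableSet (S n)) (hm : ∀ n, m (S n) ≠ ∞) (h0 : ∀ n, m (S n) ≠ 0)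
    (hlim : ∀ g : Γ, Tendsto (fun n => m (((g • ·) ⁻¹' S n) ∆ S n) / m (S n)) atTop (nhds 0))
    {δ : ℝ} (hδ : 0 < δ) :
    ∃ n, ∃ S' : Set W, MeasurableSet S' ∧ (∀ g ∈ Γ₀, ((g • ·) ⁻¹' S' : Set W) =ᵐ[m] S') ∧
      m (S n ∆ S') ≤ ENNReal.ofReal δ * m (S n) := by
  set r : ℕ → ℝ := fun n => Real.sqrt (m (S n)).toReal with hr
  have hpos : ∀ n, 0 < (m (S n)).toReal := fun n => ENNReal.toReal_pos (h0 n) (hm n)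
  have hr0 : ∀ n, 0 < r n := fun n => Real.sqrt_pos.2 (hpos n)
  have hrsq : ∀ n, r n ^ 2 = (m (S n)).toReal := fun n => Real.sq_sqrt (hpos n).le
  obtain ⟨n, η, hη, hle⟩ := hT.exists_fixed_near (koopman Γ m)
    (fun n => (((r n)⁻¹ : ℝ) : ℂ) • indicatorVec m (hS n) (hm n)) (by
      intro g
      have key : ∀ n, ‖koopman Γ m g ((((r n)⁻¹ : ℝ) : ℂ) • indicatorVec m (hS n) (hm n))
          - (((r n)⁻¹ : ℝ) : ℂ) • indicatorVec m (hS n) (hm n)‖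
          = Real.sqrt (m (((g⁻¹ • ·) ⁻¹' S n) ∆ S n) / m (S n)).toReal := by
        intro n
        rw [map_smul, ← smul_sub, norm_smul, Complex.norm_real,
          Real.norm_of_nonneg (inv_nonneg.2 (hr0 n).le), eq_comm,
          Real.sqrt_eq_iff_mul_self_eq ENNReal.toReal_nonneg
            (mul_nonneg (inv_nonneg.2 (hr0 n).le) (norm_nonneg _)),
          ENNReal.toReal_div, ← enorm_koopman_indicatorVec_sub g (hS n) (hm n),
          ENNReal.toReal_pow, toReal_enorm, ← hrsq]
        have := (hr0 n).ne'
        field_simp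
      simp_rw [key]
      have h2 := (ENNReal.tendsto_toReal ENNReal.zero_ne_top).comp (hlim g⁻¹)
      have h3 := (Real.continuous_sqrt.tendsto _).comp h2
      rw [ENNReal.toReal_zero, Real.sqrt_zero] at h3
      exact h3)
    (δ := Real.sqrt (δ / 4)) (by positivity)
  set ζ : Lp ℂ 2 m := ((r n : ℝ) : ℂ) • η with hζ
  have hζfix : ∀ g ∈ Γ₀, koopman Γ m g ζ = ζ := fun g hg => by rw [hζ, map_smul, hη g hg]
  refine ⟨n, largeSet ζ, measurableSet_largeSet ζ,
    fun g hg => preimage_largeSet_of_fixed g ζ (hζfix _ (Γ₀.inv_mem hg)),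
    (measure_symmDiff_largeSet_le (hS n) (hm n) ζ).trans ?_⟩
  have hdist : ‖indicatorVec m (hS n) (hm n) - ζ‖ ≤ r n * Real.sqrt (δ / 4) := by
    have e : indicatorVec m (hS n) (hm n) - ζ
        = ((r n : ℝ) : ℂ) • ((((r n)⁻¹ : ℝ) : ℂ) • indicatorVec m (hS n) (hm n) - η) := by
      rw [hζ, smul_sub, smul_smul, ← Complex.ofReal_mul, mul_inv_cancel₀ (hr0 n).ne']
      simp
    rw [e, norm_smul, Complex.norm_real, Real.norm_of_nonneg (hr0 n).le]
    exact mul_le_mul_of_nonneg_left hle (hr0 n).le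
  have hsq : ‖indicatorVec m (hS n) (hm n) - ζ‖ ^ 2 ≤ (m (S n)).toReal * (δ / 4) := by
    calc _ ≤ (r n * Real.sqrt (δ / 4)) ^ 2 := by gcongr
      _ = _ := by rw [mul_pow, hrsq, Real.sq_sqrt (by positivity)]
  calc 4 * ‖indicatorVec m (hS n) (hm n) - ζ‖ₑ ^ 2
      = ENNReal.ofReal (4 * ‖indicatorVec m (hS n) (hm n) - ζ‖ ^ 2) := by
        rw [ENNReal.ofReal_mul (by norm_num), ENNReal.ofReal_pow (norm_nonneg _), ofReal_norm]
        simp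
    _ ≤ ENNReal.ofReal (δ * (m (S n)).toReal) := by
        apply ENNReal.ofReal_le_ofReal
        linarith
    _ = ENNReal.ofReal δ * m (S n) := by
        rw [ENNReal.ofReal_mul hδ.le, ENNReal.ofReal_toReal (hm n)]

end RelTSets

/-! ### Profinite systems -/

section Ergodic

open Filter

/-- A measurable set of positive measure that is invariant modulo null sets under an ergodic action
is conull. -/
theorem ErgodicSMul.ae_mem_of_invariant {G X : Type*} [SMul G X] [MeasurableSpace X]
    {μ : Measure X} (h : ErgodicSMul G X μ) {A : Set X} (hA : MeasurableSet A)
    (hinv : ∀ g : G, ((g • ·) ⁻¹' A : Set X) =ᵐ[μ] A) (h0 : μ A ≠ 0) : ∀ᵐ x ∂μ, x ∈ A := by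
  rcases eventuallyConst_set.1 (h.aeconst_of_forall_preimage_smul_ae_eq hA hinv) with h1 | h1
  · exact h1
  · exact absurd (measure_eq_zero_iff_ae_notMem.2 h1) h0

end Ergodic

/-- A measure preserving action of `Γ` on `(X, μ)` together with an increasing sequence of
equivariant maps onto finite `Γ`-sets, given at every point of `X`, whose fibres generate the
measurable sets modulo null sets. The last condition is expressed by density, and a level may have
points whose fibre is null. -/
structure ProfiniteSystem (Γ : Type u) [Group Γ] {X : Type v} [MulAction Γ X] [MeasurableSpace X]
    (μ : Measure X) where
  Level : ℕ → Type w
  [finite : ∀ n, Finite (Level n)]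
  [action : ∀ n, MulAction Γ (Level n)]
  proj : ∀ n, X → Level n
  measurableSet_fiber : ∀ n a, MeasurableSet (proj n ⁻¹' {a})
  proj_smul : ∀ n (γ : Γ) x, proj n (γ • x) = γ • proj n x
  nested : ∀ n x y, proj (n + 1) x = proj (n + 1) y → proj n x = proj n y
  dense : ∀ A, MeasurableSet A → ∀ ε : ENNReal, 0 < ε →
    ∃ n, ∃ B : Set X, (∀ x y, proj n x = proj n y → x ∈ B → y ∈ B) ∧ μ (symmDiff A B) ≤ ε

namespace ProfiniteSystem

attribute [instance] finite action

open scoped ENNReal symmDiff ProbabilityTheory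
open Function

variable {Γ : Type u} [Group Γ] {X : Type v} [MulAction Γ X] [MeasurableSpace X]
  {μ : Measure X} (P : ProfiniteSystem.{u, v, w} Γ μ)

/-- The fibre over a point of a level. -/
def fib {n : ℕ} (a : P.Level n) : Set X := P.proj n ⁻¹' {a}

theorem mem_fib {n : ℕ} {a : P.Level n} {x : X} : x ∈ P.fib a ↔ P.proj n x = a := Iff.rfl

theorem measurableSet_fib {n : ℕ} (a : P.Level n) : MeasurableSet (P.fib a) :=
  P.measurableSet_fiber n a

theorem nested_le {n m : ℕ} (hnm : n ≤ m) {x y : X} (h : P.proj m x = P.proj m y) :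
    P.proj n x = P.proj n y := by
  induction m, hnm using Nat.le_induction with
  | base => exact h
  | succ k _ ih => exact ih (P.nested k x y h)

theorem factorsThrough_le {β : Type*} {n m : ℕ} (hnm : n ≤ m) {F : X → β}
    (hF : FactorsThrough F (P.proj n)) : FactorsThrough F (P.proj m) :=
  fun _ _ h => hF (P.nested_le hnm h)

theorem measurableSet_of_saturated {n : ℕ} {B : Set X}
    (hB : ∀ x y, P.proj n x = P.proj n y → x ∈ B → y ∈ B) : MeasurableSet B := by
  have : B = ⋃ a ∈ P.proj n '' B, P.fib a := by
    ext x
    simp only [Set.mem_iUnion, Set.mem_image, mem_fib]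
    constructor
    · exact fun hx => ⟨_, ⟨x, hx, rfl⟩, rfl⟩
    · rintro ⟨_, ⟨y, hy, rfl⟩, h⟩
      exact hB y x h.symm hy
  rw [this]
  exact Set.Finite.measurableSet_biUnion (Set.toFinite _) fun a _ => P.measurableSet_fib a

theorem measurable_of_factorsThrough {β : Type*} [MeasurableSpace β] {n : ℕ} {F : X → β}
    (hF : FactorsThrough F (P.proj n)) : Measurable F := fun s _ =>
  P.measurableSet_of_saturated (n := n) fun x y h hx => by
    rw [Set.mem_preimage] at hx ⊢
    rwa [← hF h]

theorem preimage_smul_fib {n : ℕ} (a : P.Level n) (γ : Γ) :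
    (γ • ·) ⁻¹' P.fib (γ • a) = P.fib a := by
  ext x
  rw [Set.mem_preimage, mem_fib, mem_fib, P.proj_smul, smul_left_cancel_iff]

theorem smul_mem_fib {n : ℕ} {a : P.Level n} {γ : Γ} (hγ : γ • a = a) {x : X} :
    γ • x ∈ P.fib a ↔ x ∈ P.fib a := by
  rw [mem_fib, mem_fib, P.proj_smul]
  constructor
  · intro h; rw [← hγ, smul_left_cancel_iff] at h; exact h
  · intro h; rw [h, hγ]

theorem ae_iff_cond [IsFiniteMeasure μ] {s : Set X} (hs : MeasurableSet s)
    {p : X → Prop} : (∀ᵐ x ∂μ[|s], p x) ↔ ∀ᵐ x ∂μ, x ∈ s → p x := by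
  rw [← ae_restrict_iff' hs, ProbabilityTheory.cond]
  rw [Measure.ae_ennreal_smul_measure_iff]
  simp

/-- The stabilizer of a point of a level contains the stabilizers of the points of finer levels
above it. -/
theorem stabilizer_le {n m : ℕ} (hnm : n ≤ m) (x : X) :
    MulAction.stabilizer Γ (P.proj m x) ≤ MulAction.stabilizer Γ (P.proj n x) := by
  intro γ hγ
  rw [MulAction.mem_stabilizer_iff] at hγ ⊢
  rw [← P.proj_smul] at hγ ⊢
  exact P.nested_le hnm hγ

section Measure

variable [SMulInvariantMeasure Γ X μ]

theorem measure_fib_smul {n : ℕ} (a : P.Level n) (γ : Γ) : μ (P.fib (γ • a)) = μ (P.fib a) := by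
  rw [← P.preimage_smul_fib a γ]
  exact (SMulInvariantMeasure.measure_preimage_smul γ (P.measurableSet_fib _)).symm

theorem smulInvariantMeasure_cond {n : ℕ} (a : P.Level n) {Δ : Subgroup Γ}
    (hΔ : Δ ≤ MulAction.stabilizer Γ a) : SMulInvariantMeasure Δ X (μ[|P.fib a]) where
  measure_preimage_smul := by
    intro γ s hs
    have hγ : (γ : Γ) • a = a := hΔ γ.2
    rw [ProbabilityTheory.cond_apply (P.measurableSet_fib a),
      ProbabilityTheory.cond_apply (P.measurableSet_fib a)]
    congr 1
    have : P.fib a ∩ (γ • ·) ⁻¹' s = ((γ : Γ) • ·) ⁻¹' (P.fib a ∩ s) := by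
      ext x
      simp only [Set.mem_inter_iff, Set.mem_preimage, P.smul_mem_fib hγ]
      rfl
    rw [this]
    exact SMulInvariantMeasure.measure_preimage_smul (γ : Γ) ((P.measurableSet_fib a).inter hs)

omit [SMulInvariantMeasure Γ X μ] in
theorem exists_smul_eq (Γ₀ : Subgroup Γ) (herg : ErgodicSMul Γ₀ X μ) {n : ℕ} {a b : P.Level n}
    (ha : μ (P.fib a) ≠ 0) (hb : μ (P.fib b) ≠ 0) : ∃ γ ∈ Γ₀, γ • a = b := by
  set S : Set X := {x | ∃ γ ∈ Γ₀, γ • a = P.proj n x} with hS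
  have hSm : MeasurableSet S := P.measurableSet_of_saturated (n := n) (by
    rintro x y h ⟨γ, hγ, e⟩
    exact ⟨γ, hγ, e.trans h⟩)
  have hsub : P.fib a ⊆ S := fun x hx => ⟨1, Γ₀.one_mem, by rw [one_smul]; exact hx.symm⟩
  have hae := herg.ae_mem_of_invariant hSm (fun g => by
    refine Filter.EventuallyEq.of_eq ?_
    ext x
    change (∃ γ ∈ Γ₀, γ • a = P.proj n ((g : Γ) • x)) ↔ ∃ γ ∈ Γ₀, γ • a = P.proj n x
    rw [P.proj_smul]
    constructor
    · rintro ⟨γ, hγ, e⟩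
      exact ⟨(g : Γ)⁻¹ * γ, Γ₀.mul_mem (Γ₀.inv_mem g.2) hγ, by rw [mul_smul, e, inv_smul_smul]⟩
    · rintro ⟨γ, hγ, e⟩
      exact ⟨(g : Γ) * γ, Γ₀.mul_mem g.2 hγ, by rw [mul_smul, e]⟩)
    (fun h => ha (measure_mono_null hsub h))
  have : ¬ ∀ᵐ x ∂μ, x ∉ P.fib b := fun h => hb (measure_eq_zero_iff_ae_notMem.2 h)
  obtain ⟨x, hx, γ, hγ, e⟩ :=
    ((Filter.not_eventually.1 this).and_eventually hae).exists
  exact ⟨γ, hγ, e.trans (not_not.1 hx)⟩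

/-- Ergodicity of `Γ₀` makes the fibres of positive measure equally large. -/
theorem exists_measure_fib_eq [IsProbabilityMeasure μ] (Γ₀ : Subgroup Γ)
    (herg : ErgodicSMul Γ₀ X μ) (n : ℕ) :
    ∃ u : ℝ≥0∞, u ≠ 0 ∧ u ≠ ∞ ∧ ∀ᵐ x ∂μ, μ (P.fib (P.proj n x)) = u := by
  have hae : ∀ᵐ x ∂μ, μ (P.fib (P.proj n x)) ≠ 0 := by
    have h1 : ∀ a : P.Level n, ∀ᵐ x ∂μ, μ (P.fib a) = 0 → P.proj n x ≠ a := by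
      intro a
      by_cases h : μ (P.fib a) = 0
      · filter_upwards [measure_eq_zero_iff_ae_notMem.1 h] with x hx _ using hx
      · exact Filter.Eventually.of_forall fun x h' => absurd h' h
    filter_upwards [ae_all_iff.2 h1] with x hx h0
    exact hx _ h0 rfl
  obtain ⟨x, hx⟩ := hae.exists
  refine ⟨μ (P.fib (P.proj n x)), hx, measure_ne_top _ _, ?_⟩
  filter_upwards [hae] with y hy
  obtain ⟨γ, -, e⟩ := P.exists_smul_eq Γ₀ herg hx hy
  rw [← e, P.measure_fib_smul]

/-- The return action on a fibre of positive measure is ergodic. -/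
theorem ergodicSMul_cond [Countable Γ] [MeasurableConstSMul Γ X] [IsFiniteMeasure μ]
    (Γ₀ : Subgroup Γ) (herg : ErgodicSMul Γ₀ X μ) {n : ℕ} (a : P.Level n)
    {Δ : Subgroup Γ} (hΔ : Δ = Γ₀ ⊓ MulAction.stabilizer Γ a) :
    ErgodicSMul Δ X (μ[|P.fib a]) where
  toSMulInvariantMeasure := P.smulInvariantMeasure_cond a (hΔ.le.trans inf_le_right)
  aeconst_of_forall_preimage_smul_ae_eq := by
    intro A hA hinv
    rw [Filter.eventuallyConst_set]
    by_cases h0 : (μ[|P.fib a]) A = 0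
    · exact Or.inr (measure_eq_zero_iff_ae_notMem.1 h0)
    left
    have hpos : μ (P.fib a ∩ A) ≠ 0 := by
      intro h
      apply h0
      rw [ProbabilityTheory.cond_apply (P.measurableSet_fib a), h, mul_zero]
    set B : Set X := ⋃ γ : Γ₀, (γ • ·) ⁻¹' (P.fib a ∩ A) with hB
    have hBm : MeasurableSet B := MeasurableSet.iUnion fun γ =>
      measurable_const_smul γ ((P.measurableSet_fib a).inter hA)
    have hsub : P.fib a ∩ A ⊆ B := fun x hx =>
      Set.mem_iUnion.2 ⟨1, by simpa using hx⟩
    have hae := herg.ae_mem_of_invariant hBm (fun g => by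
      refine Filter.EventuallyEq.of_eq ?_
      ext x
      change g • x ∈ B ↔ x ∈ B
      rw [hB, Set.mem_iUnion, Set.mem_iUnion]
      constructor
      · rintro ⟨γ, h⟩
        exact ⟨γ * g, by rwa [Set.mem_preimage, mul_smul]⟩
      · rintro ⟨γ, h⟩
        exact ⟨γ * g⁻¹, by rwa [Set.mem_preimage, mul_smul, inv_smul_smul]⟩)
      (fun h => hpos (measure_mono_null hsub h))
    rw [ae_iff_cond (P.measurableSet_fib a)]
    have hinv' : ∀ᵐ x ∂μ, x ∈ P.fib a → ∀ γ : Δ, γ • x ∈ A ↔ x ∈ A := by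
      rw [← ae_iff_cond (P.measurableSet_fib a), ae_all_iff]
      intro γ
      filter_upwards [hinv γ] with x hx using iff_of_eq hx
    filter_upwards [hae, hinv'] with x hx hx' hxa
    obtain ⟨γ, h1, h2⟩ := Set.mem_iUnion.1 hx
    have hst : (γ : Γ) ∈ Δ := by
      rw [hΔ]
      refine ⟨γ.2, MulAction.mem_stabilizer_iff.2 ?_⟩
      have : P.proj n ((γ : Γ) • x) = a := h1
      rw [P.proj_smul, P.mem_fib.1 hxa] at this
      exact this
    exact (hx' hxa ⟨γ, hst⟩).1 h2

end Measure

/-- Measurable maps to a countable set are approximated by maps factoring through a level. -/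
theorem exists_factorsThrough_near [IsProbabilityMeasure μ] {Λ : Type*} [Countable Λ] [Nonempty Λ]
    [MeasurableSpace Λ] [DiscreteMeasurableSpace Λ] {f : X → Λ} (hf : Measurable f)
    {ε : ℝ≥0∞} (hε : 0 < ε) :
    ∃ n, ∃ F : X → Λ, FactorsThrough F (P.proj n) ∧ μ {x | f x ≠ F x} ≤ ε := by
  classical
  have hfin : ∀ s : Finset Λ, ∀ ε : ℝ≥0∞, 0 < ε → ∃ n, ∃ F : X → Λ, FactorsThrough F (P.proj n) ∧
      μ {x | f x ∈ s ∧ f x ≠ F x} ≤ ε := by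
    intro s
    induction s using Finset.induction_on with
    | empty =>
      intro ε _
      exact ⟨0, fun _ => Classical.arbitrary Λ, fun _ _ _ => rfl, by simp⟩
    | insert a s _ ih =>
      intro ε hε
      obtain ⟨n, F, hF, hFε⟩ := ih (ε / 2) (ENNReal.half_pos hε.ne')
      obtain ⟨k, B, hB, hBε⟩ := P.dense (f ⁻¹' {a}) (hf (measurableSet_singleton a)) (ε / 2)
        (ENNReal.half_pos hε.ne')
      refine ⟨max n k, fun x => if x ∈ B then a else F x, ?_, ?_⟩
      · intro x y h
        have h1 := hF (P.nested_le (le_max_left n k) h)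
        have h2 : x ∈ B ↔ y ∈ B := ⟨hB _ _ (P.nested_le (le_max_right n k) h),
          hB _ _ (P.nested_le (le_max_right n k) h).symm⟩
        simp only [h1, h2]
      · calc μ {x | f x ∈ insert a s ∧ f x ≠ if x ∈ B then a else F x}
            ≤ μ ({x | f x ∈ s ∧ f x ≠ F x} ∪ (f ⁻¹' {a}) ∆ B) := by
              apply measure_mono
              rintro x ⟨h1, h2⟩
              by_cases hxB : x ∈ B
              · rw [if_pos hxB] at h2
                exact Or.inr (Or.inr ⟨hxB, h2⟩)
              · rw [if_neg hxB] at h2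
                rcases Finset.mem_insert.1 h1 with h3 | h3
                · exact Or.inr (Or.inl ⟨h3, hxB⟩)
                · exact Or.inl ⟨h3, h2⟩
          _ ≤ ε / 2 + ε / 2 := (measure_union_le _ _).trans (add_le_add hFε hBε)
          _ = ε := ENNReal.add_halves ε
  have hsum : ∑' a, μ (f ⁻¹' {a}) ≠ ∞ := by
    rw [← measure_iUnion (fun a b hab => by
      rw [Function.onFun, Set.disjoint_left]
      intro x hx hx'
      exact hab (hx.symm.trans hx')) (fun a => hf (measurableSet_singleton a))]
    exact measure_ne_top _ _
  have htail := ENNReal.tendsto_tsum_compl_atTop_zero hsum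
  obtain ⟨s, hs⟩ := (htail.eventually_le_const (ENNReal.half_pos hε.ne')).exists
  obtain ⟨n, F, hF, hFε⟩ := hfin s (ε / 2) (ENNReal.half_pos hε.ne')
  refine ⟨n, F, hF, ?_⟩
  calc μ {x | f x ≠ F x} ≤ μ ({x | f x ∈ s ∧ f x ≠ F x} ∪ ⋃ a : {a // a ∉ s}, f ⁻¹' {a.1}) := by
        apply measure_mono
        intro x hx
        by_cases h : f x ∈ s
        · exact Or.inl ⟨h, hx⟩
        · exact Or.inr (Set.mem_iUnion.2 ⟨⟨f x, h⟩, rfl⟩)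
    _ ≤ ε / 2 + ε / 2 := (measure_union_le _ _).trans
        (add_le_add hFε ((measure_iUnion_le _).trans hs))
    _ = ε := ENNReal.add_halves ε

end ProfiniteSystem

/-! ### Cocycles and skew products -/

section Cocycle

open scoped ENNReal symmDiff
open Function

/-- A measurable cocycle of an action of `Γ` on `B` with values in `Λ`; the cocycle identity holds
at every point. -/
structure MeasCocycle (Γ : Type*) [Group Γ] (B : Type*) [MeasurableSpace B] [MulAction Γ B]
    (Λ : Type*) [Group Λ] [MeasurableSpace Λ] where
  toFun : Γ → B → Λ
  measurable : ∀ g, Measurable (toFun g)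
  map_mul : ∀ g h b, toFun (g * h) b = toFun g (h • b) * toFun h b

namespace MeasCocycle

variable {Γ : Type*} [Group Γ] {B : Type v} [MeasurableSpace B] [MulAction Γ B]
  {Λ : Type} [Group Λ] [MeasurableSpace Λ]

instance : CoeFun (MeasCocycle Γ B Λ) (fun _ => Γ → B → Λ) := ⟨toFun⟩

theorem map_one (w : MeasCocycle Γ B Λ) (b : B) : w 1 b = 1 := by
  have := w.map_mul 1 1 b
  rw [one_smul, one_mul] at this
  exact left_eq_mul.1 this

theorem map_inv (w : MeasCocycle Γ B Λ) (g : Γ) (b : B) : w g⁻¹ b = (w g (g⁻¹ • b))⁻¹ := by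
  have := w.map_mul g g⁻¹ b
  rw [mul_inv_cancel, w.map_one] at this
  exact (inv_eq_of_mul_eq_one_right this.symm).symm

/-- The restriction of a cocycle to a subgroup. -/
def restrict (w : MeasCocycle Γ B Λ) (Δ : Subgroup Γ) : MeasCocycle Δ B Λ where
  toFun g := w (g : Γ)
  measurable g := w.measurable g
  map_mul g h b := w.map_mul g h b

/-- A homomorphism as a cocycle that does not depend on the point. -/
def ofHom (ρ : Γ →* Λ) : MeasCocycle Γ B Λ where
  toFun g _ := ρ g
  measurable _ := measurable_const
  map_mul g h _ := ρ.map_mul g h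

/-- The skew product of `B` with `Λ` in which `g` acts by `(b, l) ↦ (g b, w₁(g,b) l w₂(g,b)⁻¹)`. -/
@[nolint unusedArguments]
def SkewProduct (_w₁ _w₂ : MeasCocycle Γ B Λ) : Type v := B × Λ

variable (w₁ w₂ : MeasCocycle Γ B Λ)

instance : MeasurableSpace (SkewProduct w₁ w₂) := inferInstanceAs (MeasurableSpace (B × Λ))

instance : MulAction Γ (SkewProduct w₁ w₂) where
  smul g p := (g • p.1, w₁ g p.1 * p.2 * (w₂ g p.1)⁻¹)
  one_smul p := by
    change ((1 : Γ) • p.1, w₁ 1 p.1 * p.2 * (w₂ 1 p.1)⁻¹) = p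
    rw [map_one, map_one, one_smul, one_mul, inv_one, mul_one]
    rfl
  mul_smul g h p := by
    change ((g * h) • p.1, w₁ (g * h) p.1 * p.2 * (w₂ (g * h) p.1)⁻¹)
      = (g • h • p.1, w₁ g (h • p.1) * (w₁ h p.1 * p.2 * (w₂ h p.1)⁻¹) * (w₂ g (h • p.1))⁻¹)
    rw [w₁.map_mul, w₂.map_mul, mul_smul]
    simp only [mul_assoc, mul_inv_rev]

/-- The product of a measure on `B` with the counting measure. -/
noncomputable def skewMeasure (β : Measure B) : Measure (SkewProduct w₁ w₂) :=
  (β.prod Measure.count : Measure (B × Λ))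

variable [Countable Λ] [DiscreteMeasurableSpace Λ]

theorem measurable_skew (g : Γ) :
    Measurable (fun p : B × Λ => w₁ g p.1 * p.2 * (w₂ g p.1)⁻¹) :=
  (((w₁.measurable g).comp measurable_fst).mul measurable_snd).mul
    ((w₂.measurable g).comp measurable_fst).inv

instance [MeasurableConstSMul Γ B] : MeasurableConstSMul Γ (SkewProduct w₁ w₂) where
  measurable_const_smul g := by
    change Measurable (fun p : B × Λ => ((g • p.1, w₁ g p.1 * p.2 * (w₂ g p.1)⁻¹) : B × Λ))
    exact (measurable_fst.const_smul g).prodMk (measurable_skew w₁ w₂ g)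

omit [Group Λ] in
theorem map_count_bijective {e : Λ → Λ} (he : Bijective e) :
    Measure.map e (Measure.count : Measure Λ) = Measure.count := by
  ext s hs
  rw [Measure.map_apply Measurable.of_discrete hs]
  rw [← Measure.count_injective_image he.injective, Set.image_preimage_eq _ he.surjective]

instance (β : Measure B) [SFinite β] [MeasurableConstSMul Γ B] [SMulInvariantMeasure Γ B β] :
    SMulInvariantMeasure Γ (SkewProduct w₁ w₂) (skewMeasure w₁ w₂ β) where
  measure_preimage_smul g s hs := by
    have h := MeasurePreserving.skew_product (measurePreserving_smul g β)
      (μc := (Measure.count : Measure Λ)) (μd := (Measure.count : Measure Λ))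
      (g := fun b l => w₁ g b * l * (w₂ g b)⁻¹) (measurable_skew w₁ w₂ g)
      (Filter.Eventually.of_forall fun b => map_count_bijective (by
        refine ⟨fun x y h => ?_, fun y => ⟨(w₁ g b)⁻¹ * y * w₂ g b, by group⟩⟩
        simpa using h))
    exact h.measure_preimage hs.nullMeasurableSet

theorem skewMeasure_eq_tsum (β : Measure B) [SFinite β] {s : Set (B × Λ)} (hs : MeasurableSet s) :
    skewMeasure w₁ w₂ β s = ∑' l, β {b | (b, l) ∈ s} := by
  change (β.prod Measure.count : Measure (B × Λ)) s = _
  rw [Measure.prod_apply_symm hs, lintegral_count]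
  rfl

theorem skewMeasure_prod_one (β : Measure B) [SFinite β] (A : Set B) :
    skewMeasure w₁ w₂ β (A ×ˢ {1} : Set (B × Λ)) = β A := by
  change (β.prod Measure.count : Measure (B × Λ)) _ = _
  rw [Measure.prod_prod, Measure.count_singleton, mul_one]

omit [DiscreteMeasurableSpace Λ] in
theorem ae_skewMeasure (β : Measure B) [SFinite β] {p : B × Λ → Prop}
    (h : ∀ᵐ q ∂(skewMeasure w₁ w₂ β), p q) : ∀ᵐ b ∂β, ∀ l, p (b, l) := by
  have h' : ∀ᵐ q ∂(β.prod Measure.count : Measure (B × Λ)), p q := h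
  filter_upwards [Measure.ae_ae_of_ae_prod h'] with b hb
  exact Measure.ae_count_iff.1 hb

/-- Two cocycles of an ergodic action that are uniformly close in measure are cohomologous. -/
theorem exists_cohomologous_of_near [MeasurableConstSMul Γ B] (β : Measure B)
    [IsProbabilityMeasure β] (herg : ErgodicSMul Γ B β)
    (h : ∀ g, β {b | w₁ g b ≠ w₂ g b} ≤ 32⁻¹) :
    ∃ ψ : B → Λ, Measurable ψ ∧ ∀ g, ∀ᵐ b ∂β, ψ (g • b) = w₁ g b * ψ b * (w₂ g b)⁻¹ := by
  classical
  set m := skewMeasure w₁ w₂ β with hm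
  set S : Set (SkewProduct w₁ w₂) := (Set.univ ×ˢ {1} : Set (B × Λ)) with hS
  have hSm : MeasurableSet S := MeasurableSet.univ.prod (measurableSet_singleton 1)
  have hS1 : m S = 1 := by rw [hm, hS, skewMeasure_prod_one, measure_univ]
  have hmove : ∀ g : Γ, m (((g • ·) ⁻¹' S) ∆ S) ≤ 16⁻¹ := by
    intro g
    set T : Set (SkewProduct w₁ w₂) := (g • ·) ⁻¹' S with hT
    have hTm : MeasurableSet T := measurable_const_smul g hSm
    have hTS : m T = m S := SMulInvariantMeasure.measure_preimage_smul g hSm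
    have hsub : S \ T ⊆ ({b | w₁ g b ≠ w₂ g b} ×ˢ {1} : Set (B × Λ)) := by
      rintro ⟨b, l⟩ ⟨h1, h2⟩
      have hl : l = 1 := h1.2
      refine ⟨fun e => h2 ?_, h1.2⟩
      change (g • b, w₁ g b * l * (w₂ g b)⁻¹) ∈ (Set.univ ×ˢ {1} : Set (B × Λ))
      refine ⟨trivial, ?_⟩
      change w₁ g b * l * (w₂ g b)⁻¹ = 1
      rw [hl, show w₁ g b = w₂ g b from e]; simp
    have h1 : m (S \ T) ≤ 32⁻¹ := by
      refine (measure_mono hsub).trans ?_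
      rw [hm, skewMeasure_prod_one]
      exact h g
    have h2 : m (T \ S) = m (S \ T) := by
      apply measure_sdiff_symm hTm.nullMeasurableSet hSm.nullMeasurableSet hTS
      exact ne_top_of_le_ne_top (by rw [hS1]; simp) (measure_mono Set.inter_subset_right)
    calc m (T ∆ S) ≤ m (T \ S) + m (S \ T) := measure_union_le _ _
      _ ≤ 32⁻¹ + 32⁻¹ := by rw [h2]; exact add_le_add h1 h1
      _ = 16⁻¹ := by
        rw [← two_mul, show (32 : ℝ≥0∞) = 2 * 16 by norm_num,
          ENNReal.mul_inv (by simp) (by simp), ← mul_assoc, ENNReal.mul_inv_cancel (by simp)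
          (by simp), one_mul]
  obtain ⟨S', hS'm, hinv, hnear⟩ := exists_invariant_set_near (G := Γ) hSm (by rw [hS1]; simp)
    (by simp) hmove
  have hSec : ∀ l, MeasurableSet {b | ((b, l) : B × Λ) ∈ S'} := fun l =>
    (measurable_id.prodMk measurable_const : Measurable fun b : B => (b, l)) hS'm
  -- Over the points of `E` the invariant set `S'` is the graph of a function `ψ`.
  set E : Set B := {b | ∃! l, ((b, l) : B × Λ) ∈ S'} with hE
  have hEm : MeasurableSet E := by
    have : E = ⋃ l, ({b | ((b, l) : B × Λ) ∈ S'} ∩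
        ⋂ l' : {l' // l' ≠ l}, {b | ((b, l'.1) : B × Λ) ∈ S'}ᶜ) := by
      ext b
      simp only [Set.mem_iUnion, Set.mem_inter_iff, Set.mem_iInter]
      constructor
      · rintro ⟨l, h1, h2⟩
        exact ⟨l, h1, fun l' h3 => l'.2 (h2 _ h3)⟩
      · rintro ⟨l, h1, h2⟩
        exact ⟨l, h1, fun l' h3 => by_contra fun h4 => h2 ⟨l', h4⟩ h3⟩
    rw [this]
    exact MeasurableSet.iUnion fun l => (hSec l).inter (MeasurableSet.iInter fun l' =>
      (hSec l').compl)
  have hkey : ∀ g, ∀ᵐ b ∂β, ∀ l, ((g • b, w₁ g b * l * (w₂ g b)⁻¹) : B × Λ) ∈ S' ↔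
      ((b, l) : B × Λ) ∈ S' := by
    intro g
    refine ae_skewMeasure w₁ w₂ β (p := fun q =>
      ((g • q.1, w₁ g q.1 * q.2 * (w₂ g q.1)⁻¹) : B × Λ) ∈ S' ↔ q ∈ S') ?_
    filter_upwards [hinv g] with q hq using iff_of_eq hq
  have hEinv : ∀ g : Γ, ((g • ·) ⁻¹' E : Set B) =ᵐ[β] E := by
    intro g
    filter_upwards [hkey g] with b hb
    refine propext ?_
    change (∃! l, ((g • b, l) : B × Λ) ∈ S') ↔ ∃! l, ((b, l) : B × Λ) ∈ S'
    constructor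
    · rintro ⟨l, h1, h2⟩
      refine ⟨(w₁ g b)⁻¹ * l * w₂ g b, (hb _).1 ?_, fun l' h3 => ?_⟩
      · convert! h1 using 2; group
      · rw [← h2 _ ((hb l').2 h3)]; group
    · rintro ⟨l, h1, h2⟩
      refine ⟨w₁ g b * l * (w₂ g b)⁻¹, (hb _).2 h1, fun l' h3 => ?_⟩
      rw [← h2 ((w₁ g b)⁻¹ * l' * w₂ g b) ((hb _).1 (by convert! h3 using 2; group))]; group
  -- Outside `E` the set `S'` differs from `S`, so `E` has measure at least `1 - 4 / 16`.
  have hE0 : β E ≠ 0 := by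
    intro h0
    have h1 : β Eᶜ ≤ 4 * 16⁻¹ := by
      refine le_trans ?_ hnear
      rw [hm, skewMeasure_eq_tsum w₁ w₂ β (hSm.symmDiff hS'm)]
      refine le_trans (measure_mono ?_) (measure_iUnion_le _)
      intro b hb
      by_contra hcon
      apply hb
      have h2 : ∀ l, ((b, l) : B × Λ) ∈ S' ↔ l = 1 := by
        intro l
        have h3 : ((b, l) : B × Λ) ∉ S ∆ S' := fun h4 => hcon (Set.mem_iUnion.2 ⟨l, h4⟩)
        have h4 : ((b, l) : B × Λ) ∈ S ↔ l = 1 := ⟨fun h => h.2, fun h => ⟨trivial, h⟩⟩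
        have h5 : ¬ ((((b, l) : B × Λ) ∈ S ∧ ((b, l) : B × Λ) ∉ S') ∨
            (((b, l) : B × Λ) ∈ S' ∧ ((b, l) : B × Λ) ∉ S)) := h3
        rw [h4] at h5
        tauto
      exact ⟨1, (h2 1).2 rfl, fun l hl => (h2 l).1 hl⟩
    have h2 : β Eᶜ = 1 := by
      rw [prob_compl_eq_one_sub hEm, h0, tsub_zero]
    rw [h2] at h1
    have h3 := ENNReal.toReal_mono (by finiteness) h1
    norm_num at h3
  have hEae := herg.ae_mem_of_invariant hEm hEinv hE0
  refine ⟨fun b => if hb : b ∈ E then hb.choose else 1, ?_, ?_⟩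
  · refine measurable_to_countable' fun l => ?_
    have : (fun b => if hb : b ∈ E then hb.choose else (1 : Λ)) ⁻¹' {l}
        = (E ∩ {b | ((b, l) : B × Λ) ∈ S'}) ∪ (Eᶜ ∩ {_b | l = 1}) := by
      ext b
      rw [Set.mem_preimage]
      by_cases hb : b ∈ E
      · rw [dif_pos hb]
        constructor
        · intro h1
          exact Or.inl ⟨hb, by
            have := hb.choose_spec.1
            rwa [show hb.choose = l from h1] at this⟩
        · rintro (⟨_, h1⟩ | ⟨h1, _⟩)
          · exact (hb.choose_spec.2 l h1).symm
          · exact absurd hb h1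
      · rw [dif_neg hb]
        constructor
        · intro h1
          exact Or.inr ⟨hb, (show (1 : Λ) = l from h1).symm⟩
        · rintro (⟨h1, _⟩ | ⟨_, h1⟩)
          · exact absurd h1 hb
          · exact (show l = 1 from h1).symm
    rw [this]
    exact (hEm.inter (hSec l)).union (hEm.compl.inter (MeasurableSet.const _))
  · intro g
    filter_upwards [hEae, (measurePreserving_smul g β).quasiMeasurePreserving.ae hEae, hkey g]
      with b h1 h2 h3
    have h4 : g • b ∈ E := h2
    rw [dif_pos h1, dif_pos h4]
    exact (h4.choose_spec.2 _ ((h3 _).2 h1.choose_spec.1)).symm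

end MeasCocycle

end Cocycle

/-! ### Uniform near-constancy on the fibres of a level -/

namespace ProfiniteSystem

open scoped ENNReal symmDiff ProbabilityTheory
open Function Filter

variable {Γ : Type u} [Group Γ] {X : Type v} [MulAction Γ X] [MeasurableSpace X]
  {μ : Measure X} (P : ProfiniteSystem.{u, v, w} Γ μ)

/-- The pairs of points in the same fibre of a level. -/
def diag (n : ℕ) : Set (X × X) := {q | P.proj n q.1 = P.proj n q.2}

theorem measurableSet_diag (n : ℕ) : MeasurableSet (P.diag n) := by
  have : P.diag n = ⋃ a : P.Level n, P.fib a ×ˢ P.fib a := by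
    ext q
    rw [Set.mem_iUnion]
    constructor
    · intro h
      exact ⟨P.proj n q.1, rfl, h.symm⟩
    · rintro ⟨a, h1, h2⟩
      exact h1.trans h2.symm
  rw [this]
  exact MeasurableSet.iUnion fun a => (P.measurableSet_fib a).prod (P.measurableSet_fib a)

theorem measure_sum_fib (n : ℕ) [Fintype (P.Level n)] (ν : Measure X) (A : Set X) :
    ν A = ∑ a : P.Level n, ν (P.fib a ∩ A) := by
  have h2 := measure_biUnion_finset (μ := ν.restrict A) (s := Finset.univ)
    (f := fun a : P.Level n => P.fib a) (fun a _ b _ hab => by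
      rw [Function.onFun, Set.disjoint_left]
      intro x hx hx'
      exact hab (hx.symm.trans hx')) (fun a _ => P.measurableSet_fib a)
  simp only [Measure.restrict_apply (P.measurableSet_fib _)] at h2
  rw [← h2]
  have h3 : (⋃ a ∈ (Finset.univ : Finset (P.Level n)), P.fib a) = Set.univ := by
    ext x; simp [mem_fib]
  rw [h3, Measure.restrict_apply_univ]

section

variable [SFinite μ] {n : ℕ} {u : ℝ≥0∞} (hu : ∀ᵐ x ∂μ, μ (P.fib (P.proj n x)) = u)

include hu in
theorem prod_diag_inter_fst {A : Set X} (hA : MeasurableSet A) :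
    (μ.prod μ) (P.diag n ∩ Prod.fst ⁻¹' A) = u * μ A := by
  rw [Measure.prod_apply ((P.measurableSet_diag n).inter (measurable_fst hA)),
    ← setLIntegral_const, ← lintegral_indicator hA]
  apply lintegral_congr_ae
  filter_upwards [hu] with x hx
  by_cases hxA : x ∈ A
  · rw [Set.indicator_of_mem hxA, ← hx]
    congr 1
    ext y
    exact ⟨fun h => h.1.symm, fun h => ⟨Eq.symm h, hxA⟩⟩
  · rw [Set.indicator_of_notMem hxA]
    convert! measure_empty (μ := μ) using 2
    ext y
    exact ⟨fun h => hxA h.2, fun h => h.elim⟩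

include hu in
theorem prod_diag_inter_snd {A : Set X} (hA : MeasurableSet A) :
    (μ.prod μ) (P.diag n ∩ Prod.snd ⁻¹' A) = u * μ A := by
  rw [← P.prod_diag_inter_fst hu hA, ← Measure.prod_swap, Measure.map_apply measurable_swap
    ((P.measurableSet_diag n).inter (measurable_snd hA)), Measure.prod_swap]
  congr 1
  ext q
  exact ⟨fun h => ⟨h.1.symm, h.2⟩, fun h => ⟨h.1.symm, h.2⟩⟩

end

end ProfiniteSystem

namespace MeasCocycle

variable {Γ : Type u} [Group Γ] {X : Type v} [MulAction Γ X] [MeasurableSpace X]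
  {Λ : Type} [Group Λ] [MeasurableSpace Λ]

/-- The pullback of a cocycle along an equivariant map. -/
def pullback (w : MeasCocycle Γ X Λ) {Y : Type*} [MeasurableSpace Y] [MulAction Γ Y] (f : Y → X)
    (hf : Measurable f) (hf' : ∀ (γ : Γ) y, f (γ • y) = γ • f y) : MeasCocycle Γ Y Λ where
  toFun g y := w g (f y)
  measurable g := (w.measurable g).comp hf
  map_mul g h y := by rw [w.map_mul, hf']

end MeasCocycle

namespace ProfiniteSystem

open scoped ENNReal symmDiff ProbabilityTheory
open Function Filter MeasCocycle

variable {Γ : Type u} [Group Γ] {X : Type v} [MulAction Γ X] [MeasurableSpace X]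
  {μ : Measure X} (P : ProfiniteSystem.{u, v, w} Γ μ)
  [MeasurableConstSMul Γ X] [SMulInvariantMeasure Γ X μ]
  [IsProbabilityMeasure μ]
  {Λ : Type} [Group Λ] [Countable Λ] [MeasurableSpace Λ] [DiscreteMeasurableSpace Λ]

omit [MeasurableConstSMul Γ X] in
theorem eventually_prod_diag_ne_le (Γ₀ : Subgroup Γ)
    (herg₀ : ErgodicSMul Γ₀ X μ) {f : X → Λ} (hf : Measurable f) {ε : ℝ≥0∞} (hε : 0 < ε) :
    ∀ᶠ n in atTop, (μ.prod μ) (P.diag n ∩ {q | f q.1 ≠ f q.2})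
      ≤ ε * (μ.prod μ) (P.diag n) := by
  obtain ⟨n₀, F, hF, hFε⟩ := P.exists_factorsThrough_near hf (ENNReal.half_pos hε.ne')
  filter_upwards [eventually_ge_atTop n₀] with n hn
  obtain ⟨u, -, -, hu⟩ := P.exists_measure_fib_eq Γ₀ herg₀ n
  have hA : MeasurableSet {x | f x ≠ F x} :=
    (measurableSet_eq_fun hf (P.measurable_of_factorsThrough hF)).compl
  have hD : (μ.prod μ) (P.diag n) = u := by
    have := P.prod_diag_inter_fst hu MeasurableSet.univ
    rwa [Set.preimage_univ, Set.inter_univ, measure_univ, mul_one] at this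
  calc (μ.prod μ) (P.diag n ∩ {q | f q.1 ≠ f q.2})
      ≤ (μ.prod μ) ((P.diag n ∩ Prod.fst ⁻¹' {x | f x ≠ F x}) ∪
          (P.diag n ∩ Prod.snd ⁻¹' {x | f x ≠ F x})) := by
        apply measure_mono
        rintro q ⟨h1, h2⟩
        by_cases h3 : f q.1 = F q.1
        · by_cases h4 : f q.2 = F q.2
          · exact absurd (h3.trans ((hF (P.nested_le hn h1)).trans h4.symm)) h2
          · exact Or.inr ⟨h1, h4⟩
        · exact Or.inl ⟨h1, h3⟩
    _ ≤ u * (ε / 2) + u * (ε / 2) := by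
        refine (measure_union_le _ _).trans ?_
        rw [P.prod_diag_inter_fst hu hA, P.prod_diag_inter_snd hu hA]
        gcongr
    _ = ε * (μ.prod μ) (P.diag n) := by
        rw [← mul_add, ENNReal.add_halves, hD, mul_comm]

/-- Relative property (T), applied to `Γ` acting on `X × X × Λ` and the sets `{(x, y, 1)}` with `x`
and `y` in the same fibre: on the fibre over some point `a`, every element of `Γ₀` fixing `a` has a
nearly constant cocycle, with the same error for all elements. -/
theorem exists_near_constant {Γ₀ : Subgroup Γ} [Γ₀.Normal]
    (hT : HasRelativePropertyT.{u, v} Γ₀) (herg₀ : ErgodicSMul Γ₀ X μ)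
    (w : MeasCocycle Γ X Λ) {δ : ℝ} (hδ : 0 < δ) :
    ∃ n, ∃ a : P.Level n, μ (P.fib a) ≠ 0 ∧ ∀ γ ∈ Γ₀, γ • a = a →
      ∃ l, (μ[|P.fib a]) {x | w γ x ≠ l} ≤ ENNReal.ofReal δ := by
  classical
  have : MeasurableConstSMul Γ (X × X) :=
    ⟨fun c => (measurable_fst.const_smul c).prodMk (measurable_snd.const_smul c)⟩
  have : SMulInvariantMeasure Γ (X × X) (μ.prod μ) :=
    ⟨fun c s hs => ((measurePreserving_smul c μ).prod (measurePreserving_smul c μ)).measure_preimage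
      hs.nullMeasurableSet⟩
  set w₁ : MeasCocycle Γ (X × X) Λ := w.pullback Prod.fst measurable_fst fun _ _ => rfl with hw₁
  set w₂ : MeasCocycle Γ (X × X) Λ := w.pullback Prod.snd measurable_snd fun _ _ => rfl with hw₂
  set m := skewMeasure w₁ w₂ (μ.prod μ) with hm
  set S : ℕ → Set (SkewProduct w₁ w₂) := fun n => (P.diag n ×ˢ {1} : Set ((X × X) × Λ)) with hS
  have hSm : ∀ n, MeasurableSet (S n) := fun n =>
    (P.measurableSet_diag n).prod (measurableSet_singleton 1)
  have hmS : ∀ n, m (S n) = (μ.prod μ) (P.diag n) := fun n => skewMeasure_prod_one w₁ w₂ _ _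
  have hStop : ∀ n, m (S n) ≠ ∞ := fun n => by rw [hmS]; exact measure_ne_top _ _
  have hS0 : ∀ n, m (S n) ≠ 0 := fun n => by
    obtain ⟨u, hu0, -, hu⟩ := P.exists_measure_fib_eq Γ₀ herg₀ n
    have := P.prod_diag_inter_fst hu MeasurableSet.univ
    rw [Set.preimage_univ, Set.inter_univ, measure_univ, mul_one] at this
    rwa [hmS, this]
  have hTm : ∀ (γ : Γ) n, MeasurableSet ((γ • ·) ⁻¹' S n) := fun γ n =>
    measurable_const_smul γ (hSm n)
  have hTS : ∀ (γ : Γ) n, m ((γ • ·) ⁻¹' S n) = m (S n) := fun γ n =>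
    SMulInvariantMeasure.measure_preimage_smul γ (hSm n)
  have hlim : ∀ γ : Γ, Tendsto (fun n => m (((γ • ·) ⁻¹' S n) ∆ S n) / m (S n)) atTop (nhds 0) := by
    intro γ
    rw [ENNReal.tendsto_nhds_zero]
    intro ε hε
    filter_upwards [P.eventually_prod_diag_ne_le Γ₀ herg₀ (w.measurable γ)
      (ENNReal.half_pos hε.ne')] with n hn
    have hsub : S n \ ((γ • ·) ⁻¹' S n) ⊆
        ((P.diag n ∩ {q | w γ q.1 ≠ w γ q.2}) ×ˢ {1} : Set ((X × X) × Λ)) := by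
      rintro ⟨q, l⟩ ⟨h1, h2⟩
      have hl : l = 1 := h1.2
      refine ⟨⟨h1.1, fun e => h2 ?_⟩, h1.2⟩
      change (γ • q, w γ q.1 * l * (w γ q.2)⁻¹) ∈ (P.diag n ×ˢ {1} : Set ((X × X) × Λ))
      refine ⟨?_, ?_⟩
      · change P.proj n (γ • q.1) = P.proj n (γ • q.2)
        rw [P.proj_smul, P.proj_smul, show P.proj n q.1 = P.proj n q.2 from h1.1]
      · change w γ q.1 * l * (w γ q.2)⁻¹ = 1
        rw [hl, show w γ q.1 = w γ q.2 from e]; simp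
    have h1 : m (S n \ ((γ • ·) ⁻¹' S n)) ≤ ε / 2 * m (S n) := by
      refine (measure_mono hsub).trans ?_
      rw [hm, skewMeasure_prod_one, ← hm, hmS]
      exact hn
    have h2 : m (((γ • ·) ⁻¹' S n) \ S n) = m (S n \ ((γ • ·) ⁻¹' S n)) :=
      measure_sdiff_symm (hTm γ n).nullMeasurableSet (hSm n).nullMeasurableSet (hTS γ n)
        (ne_top_of_le_ne_top (hStop n) (measure_mono Set.inter_subset_right))
    refine ENNReal.div_le_of_le_mul ?_
    calc m (((γ • ·) ⁻¹' S n) ∆ S n) ≤ ε / 2 * m (S n) + ε / 2 * m (S n) := by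
          refine (measure_union_le _ _).trans ?_
          rw [h2]
          exact add_le_add h1 h1
      _ = ε * m (S n) := by rw [← add_mul, ENNReal.add_halves]
  obtain ⟨n, S', hS'm, hinv, hnear⟩ :=
    hT.exists_invariant_set_near m hSm hStop hS0 hlim (half_pos hδ)
  have : Fintype (P.Level n) := Fintype.ofFinite _
  -- The part of the skew product over `fib a × fib a`.
  set W : P.Level n → Set (SkewProduct w₁ w₂) := fun a =>
    ((P.fib a ×ˢ P.fib a) ×ˢ Set.univ : Set ((X × X) × Λ)) with hW
  have hWm : ∀ a, MeasurableSet (W a) := fun a =>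
    ((P.measurableSet_fib a).prod (P.measurableSet_fib a)).prod MeasurableSet.univ
  have hWd : Pairwise (Disjoint on W) := fun a b hab => by
    rw [Function.onFun, Set.disjoint_left]
    rintro p h1 h2
    have e1 : P.proj n p.1.1 = a := h1.1.1
    have e2 : P.proj n p.1.1 = b := h2.1.1
    exact hab (e1.symm.trans e2)
  have hSW : ∀ a, m (S n ∩ W a) = μ (P.fib a) * μ (P.fib a) := fun a => by
    rw [← Measure.prod_prod, ← skewMeasure_prod_one w₁ w₂ (μ.prod μ)]
    congr 1
    ext p
    constructor
    · exact fun h => ⟨h.2.1, h.1.2⟩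
    · rintro ⟨⟨h1, h2⟩, h3⟩
      exact ⟨⟨Eq.trans h1 (Eq.symm h2), h3⟩, ⟨h1, h2⟩, trivial⟩
  have hsumW : ∀ E : Set (SkewProduct w₁ w₂), MeasurableSet E → ∀ s : Finset (P.Level n),
      ∑ a ∈ s, m (E ∩ W a) ≤ m E := by
    intro E hE s
    rw [← measure_biUnion_finset (fun a _ b _ hab => (hWd hab).mono Set.inter_subset_right
      Set.inter_subset_right) (fun a _ => hE.inter (hWm a))]
    exact measure_mono (Set.iUnion₂_subset fun a _ => Set.inter_subset_left)
  obtain ⟨a, ha0, ha⟩ : ∃ a, μ (P.fib a) ≠ 0 ∧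
      m ((S n ∆ S') ∩ W a) ≤ ENNReal.ofReal (δ / 2) * m (S n ∩ W a) := by
    by_contra! hcon
    set s : Finset (P.Level n) := Finset.univ.filter fun a => μ (P.fib a) ≠ 0 with hs
    have hsum : m (S n) = ∑ a ∈ s, m (S n ∩ W a) := by
      have hz : ∀ a ∈ (Finset.univ : Finset (P.Level n)), m (S n ∩ W a) ≠ 0 → μ (P.fib a) ≠ 0 :=
        fun a _ h h0 => h (by rw [hSW, h0, zero_mul])
      rw [hs, Finset.sum_filter_of_ne hz]
      rw [← measure_biUnion_finset (fun a _ b _ hab => (hWd hab).mono Set.inter_subset_right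
        Set.inter_subset_right) (fun a _ => (hSm n).inter (hWm a))]
      congr 1
      ext p
      simp only [Finset.mem_univ, Set.iUnion_true, Set.mem_iUnion]
      exact ⟨fun h => ⟨P.proj n p.1.1, h, ⟨rfl, (show P.proj n p.1.1 = _ from h.1).symm⟩, trivial⟩,
        fun ⟨_, h, _⟩ => h⟩
    have hne : s.Nonempty := by
      rw [Finset.nonempty_iff_ne_empty]
      rintro h
      rw [h, Finset.sum_empty] at hsum
      exact hS0 n hsum
    have hlt := ENNReal.sum_lt_sum_of_nonempty hne
      (fun a ha => hcon a (Finset.mem_filter.1 ha).2)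
    rw [← Finset.mul_sum, ← hsum] at hlt
    exact absurd (hnear.trans_lt hlt) (not_lt.2 (hsumW _ ((hSm n).symmDiff hS'm) s))
  refine ⟨n, a, ha0, fun γ hγ hγa => ?_⟩
  set A : Set (X × X) := (P.fib a ×ˢ P.fib a) ∩ {q | w γ q.1 ≠ w γ q.2} with hA
  have hAm : MeasurableSet A := ((P.measurableSet_fib a).prod (P.measurableSet_fib a)).inter
    (measurableSet_eq_fun ((w.measurable γ).comp measurable_fst)
      ((w.measurable γ).comp measurable_snd)).compl
  have hAle : (μ.prod μ) A ≤ ENNReal.ofReal δ * (μ (P.fib a) * μ (P.fib a)) := by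
    rw [← skewMeasure_prod_one w₁ w₂ (μ.prod μ), ← hm]
    set E := (S n ∆ S') ∩ W a with hE
    have hEm : MeasurableSet E := ((hSm n).symmDiff hS'm).inter (hWm a)
    calc m (A ×ˢ {1} : Set ((X × X) × Λ)) ≤ m (E ∪ (γ • ·) ⁻¹' E) := by
          apply measure_mono_ae
          filter_upwards [hinv γ hγ] with p hp
          rintro ⟨⟨⟨h1, h2⟩, h3⟩, h4⟩
          have hp' : γ • p ∈ S' ↔ p ∈ S' := iff_of_eq hp
          have hpS : p ∈ S n := ⟨Eq.trans h1 (Eq.symm h2), h4⟩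
          by_cases h5 : p ∈ S'
          · refine Or.inr ⟨Or.inr ⟨hp'.2 h5, fun h6 => h3 ?_⟩, ⟨?_, ?_⟩, trivial⟩
            · have h7 : w γ p.1.1 * p.2 * (w γ p.1.2)⁻¹ = 1 := h6.2
              rw [show p.2 = 1 from h4, mul_one, mul_inv_eq_one] at h7
              exact h7
            · exact (P.smul_mem_fib hγa).2 h1
            · exact (P.smul_mem_fib hγa).2 h2
          · exact Or.inl ⟨Or.inl ⟨hpS, h5⟩, ⟨h1, h2⟩, trivial⟩
      _ ≤ m E + m E := by
          refine (measure_union_le _ _).trans ?_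
          rw [SMulInvariantMeasure.measure_preimage_smul γ hEm]
      _ ≤ ENNReal.ofReal (δ / 2) * m (S n ∩ W a) + ENNReal.ofReal (δ / 2) * m (S n ∩ W a) :=
          add_le_add ha ha
      _ = ENNReal.ofReal δ * (μ (P.fib a) * μ (P.fib a)) := by
          rw [← add_mul, ← ENNReal.ofReal_add (by positivity) (by positivity), add_halves, hSW]
  have hfin : μ (P.fib a) ≠ ∞ := measure_ne_top _ _
  obtain ⟨x, hx, hle⟩ := exists_le_setLAverage (μ := μ) ha0 hfin
    (f := fun x => μ (Prod.mk x ⁻¹' A)) (measurable_measure_prodMk_left hAm).aemeasurable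
  refine ⟨w γ x, ?_⟩
  have hint : ∫⁻ x in P.fib a, μ (Prod.mk x ⁻¹' A) ∂μ ≤
      ENNReal.ofReal δ * (μ (P.fib a) * μ (P.fib a)) := by
    refine le_trans (setLIntegral_le_lintegral _ _) ?_
    rw [← Measure.prod_apply hAm]
    exact hAle
  rw [setLAverage_eq] at hle
  rw [ProbabilityTheory.cond_apply (P.measurableSet_fib a)]
  have hset : P.fib a ∩ {y | w γ y ≠ w γ x} = Prod.mk x ⁻¹' A := by
    ext y
    exact ⟨fun h => ⟨⟨hx, h.1⟩, h.2.symm⟩, fun h => ⟨h.1.2, Ne.symm h.2⟩⟩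
  rw [hset]
  calc (μ (P.fib a))⁻¹ * μ (Prod.mk x ⁻¹' A)
      ≤ (μ (P.fib a))⁻¹ * ((ENNReal.ofReal δ * (μ (P.fib a) * μ (P.fib a))) / μ (P.fib a)) := by
        gcongr
        exact hle.trans (ENNReal.div_le_div_right hint _)
    _ = ENNReal.ofReal δ := by
        rw [← mul_assoc, ENNReal.mul_div_cancel_right ha0 hfin, mul_comm, mul_assoc,
          ENNReal.mul_inv_cancel ha0 hfin, mul_one]

end ProfiniteSystem

/-! ### Cocycle superrigidity -/

namespace MeasCocycle

variable {Γ : Type u} [Group Γ] {X : Type v} [MulAction Γ X] [MeasurableSpace X]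
  {Λ : Type} [Group Λ] [Countable Λ] [MeasurableSpace Λ] [DiscreteMeasurableSpace Λ]

/-- The cocycle `(g, x) ↦ ψ(g x)⁻¹ w(g,x) ψ(x)` cohomologous to `w`. -/
def conj [MeasurableConstSMul Γ X] (w : MeasCocycle Γ X Λ) (ψ : X → Λ) (hψ : Measurable ψ) :
    MeasCocycle Γ X Λ where
  toFun g x := (ψ (g • x))⁻¹ * w g x * ψ x
  measurable g := (((hψ.comp (measurable_const_smul g)).inv).mul (w.measurable g)).mul hψ
  map_mul g h x := by rw [w.map_mul, mul_smul]; group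

theorem conj_apply [MeasurableConstSMul Γ X] (w : MeasCocycle Γ X Λ) (ψ : X → Λ)
    (hψ : Measurable ψ) (g : Γ) (x : X) : w.conj ψ hψ g x = (ψ (g • x))⁻¹ * w g x * ψ x := rfl

/-- A cocycle that is uniformly close to constants, element by element, is uniformly close to a
homomorphism. -/
theorem exists_hom_near {G : Type*} [Group G] [MulAction G X] [MeasurableConstSMul G X]
    (ν : Measure X) [IsProbabilityMeasure ν] [SMulInvariantMeasure G X ν] (w : MeasCocycle G X Λ)
    (h : ∀ g, ∃ l, ν {x | w g x ≠ l} ≤ 32⁻¹) :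
    ∃ ρ : G →* Λ, ∀ g, ν {x | w g x ≠ ρ g} ≤ 32⁻¹ := by
  choose r hr using h
  refine ⟨MonoidHom.mk' r fun g k => ?_, hr⟩
  by_contra hne
  -- Otherwise three sets of measure at most `1 / 32` would cover the space.
  have hcov : (Set.univ : Set X) ⊆ {x | w (g * k) x ≠ r (g * k)} ∪
      ((k • ·) ⁻¹' {x | w g x ≠ r g} ∪ {x | w k x ≠ r k}) := by
    intro x _
    by_contra hx
    simp only [Set.mem_union, not_or] at hx
    obtain ⟨h1, h2, h3⟩ := hx
    have e1 : w (g * k) x = r (g * k) := not_not.1 h1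
    have e2 : w g (k • x) = r g := not_not.1 h2
    have e3 : w k x = r k := not_not.1 h3
    exact hne (by rw [← e1, w.map_mul, e2, e3])
  have hm : MeasurableSet {x | w g x ≠ r g} :=
    (w.measurable g (measurableSet_singleton (r g))).compl
  have h1 : (1 : ENNReal) ≤ 32⁻¹ + (32⁻¹ + 32⁻¹) := by
    rw [← measure_univ (μ := ν)]
    refine (measure_mono hcov).trans ((measure_union_le _ _).trans (add_le_add (hr _)
      ((measure_union_le _ _).trans (add_le_add ?_ (hr _)))))
    rw [SMulInvariantMeasure.measure_preimage_smul k hm]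
    exact hr g
  have h2 := ENNReal.toReal_mono (by finiteness) h1
  rw [ENNReal.toReal_add (by finiteness) (by finiteness),
    ENNReal.toReal_add (by finiteness) (by finiteness)] at h2
  norm_num at h2

end MeasCocycle

namespace ProfiniteSystem

open scoped ENNReal symmDiff ProbabilityTheory
open Function Filter MeasCocycle

variable {Γ : Type u} [Group Γ] [Countable Γ] {X : Type v} [MulAction Γ X] [MeasurableSpace X]
  {μ : Measure X} (P : ProfiniteSystem.{u, v, w} Γ μ)
  [MeasurableConstSMul Γ X] [SMulInvariantMeasure Γ X μ]
  [IsProbabilityMeasure μ]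
  {Λ : Type} [Group Λ] [Countable Λ] [MeasurableSpace Λ] [DiscreteMeasurableSpace Λ]

/-- On some fibre, the restriction of a cocycle to the elements of `Γ₀` fixing its base point is
cohomologous to a homomorphism. -/
theorem exists_conj_eq_hom_on_normal {Γ₀ : Subgroup Γ} [Γ₀.Normal]
    (hT : HasRelativePropertyT.{u, v} Γ₀) (herg₀ : ErgodicSMul Γ₀ X μ) (w : MeasCocycle Γ X Λ) :
    ∃ n, ∃ a : P.Level n, μ (P.fib a) ≠ 0 ∧ ∃ (ψ : X → Λ) (hψ : Measurable ψ)
      (ρ : (Γ₀ ⊓ MulAction.stabilizer Γ a : Subgroup Γ) →* Λ),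
      ∀ g : (Γ₀ ⊓ MulAction.stabilizer Γ a : Subgroup Γ),
        ∀ᵐ x ∂μ[|P.fib a], w.conj ψ hψ (g : Γ) x = ρ g := by
  obtain ⟨n, a, ha0, ha⟩ := P.exists_near_constant hT herg₀ w (δ := 1 / 32) (by norm_num)
  have hδ : ENNReal.ofReal (1 / 32) = 32⁻¹ := by
    rw [one_div, ENNReal.ofReal_inv_of_pos (by norm_num)]; simp
  rw [hδ] at ha
  set Δ : Subgroup Γ := Γ₀ ⊓ MulAction.stabilizer Γ a with hΔ
  have herg := P.ergodicSMul_cond Γ₀ herg₀ a hΔ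
  have := ProbabilityTheory.cond_isProbabilityMeasure (μ := μ) ha0
  obtain ⟨ρ, hρ⟩ := exists_hom_near (μ[|P.fib a]) (w.restrict Δ)
    (fun g => ha g g.2.1 (MulAction.mem_stabilizer_iff.1 g.2.2))
  obtain ⟨ψ, hψ, h⟩ := exists_cohomologous_of_near (w.restrict Δ) (ofHom ρ) (μ[|P.fib a]) herg hρ
  refine ⟨n, a, ha0, ψ, hψ, ρ, fun g => ?_⟩
  filter_upwards [h g] with x hx
  have hx' : ψ ((g : Γ) • x) = w (g : Γ) x * ψ x * (ρ g)⁻¹ := hx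
  rw [conj_apply, hx']
  group

/-- If a cocycle is a homomorphism `ρ` on the elements of `Γ₀` fixing `a`, then for every `g` fixing
`a` the function `w g` is equivariant, hence by ergodicity equal to its majority value on each fibre
of some finer level. -/
theorem exists_factorsThrough_of_hom_on_normal {Γ₀ : Subgroup Γ} [hn : Γ₀.Normal]
    (herg₀ : ErgodicSMul Γ₀ X μ) (w : MeasCocycle Γ X Λ) {n : ℕ} {a : P.Level n}
    (ha0 : μ (P.fib a) ≠ 0)
    (ρ : (Γ₀ ⊓ MulAction.stabilizer Γ a : Subgroup Γ) →* Λ)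
    (hρ : ∀ g : (Γ₀ ⊓ MulAction.stabilizer Γ a : Subgroup Γ),
      ∀ᵐ x ∂μ[|P.fib a], w (g : Γ) x = ρ g) {g : Γ} (hg : g ∈ MulAction.stabilizer Γ a) :
    ∃ m, ∃ F : X → Λ, FactorsThrough F (P.proj m) ∧ ∀ᵐ x ∂μ[|P.fib a], w g x = F x := by
  classical
  set ν := μ[|P.fib a] with hν
  have hνp : IsProbabilityMeasure ν := ProbabilityTheory.cond_isProbabilityMeasure ha0
  have herg := P.ergodicSMul_cond Γ₀ herg₀ a rfl
  have hinvs := P.smulInvariantMeasure_cond a (le_refl (MulAction.stabilizer Γ a))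
  set f : X → Λ := w g with hf
  have hfm : Measurable f := w.measurable g
  obtain ⟨m, F, hF, hFε⟩ := P.exists_factorsThrough_near hfm (ε := μ (P.fib a) * 4⁻¹)
    (ENNReal.mul_pos ha0 (by simp))
  have hνF : ν {x | f x ≠ F x} ≤ 4⁻¹ := by
    rw [hν, ProbabilityTheory.cond_apply (P.measurableSet_fib a)]
    calc (μ (P.fib a))⁻¹ * μ (P.fib a ∩ {x | f x ≠ F x})
        ≤ (μ (P.fib a))⁻¹ * (μ (P.fib a) * 4⁻¹) := by
          gcongr
          exact (measure_mono Set.inter_subset_right).trans hFε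
      _ = 4⁻¹ := by
          rw [← mul_assoc, ENNReal.inv_mul_cancel ha0 (measure_ne_top _ _), one_mul]
  -- `maj b l`: on the fibre over `b`, the value `l` is taken with probability more than one half.
  set maj : P.Level m → Λ → Prop := fun b l => ν (P.fib b) < 2 * ν (P.fib b ∩ f ⁻¹' {l}) with hmaj
  have hfl : ∀ l, MeasurableSet (f ⁻¹' {l}) := fun l => hfm (measurableSet_singleton l)
  have hmaj_unique : ∀ b l l', maj b l → maj b l' → l = l' := by
    intro b l l' h1 h2
    by_contra hne
    have hdis : Disjoint (P.fib b ∩ f ⁻¹' {l}) (P.fib b ∩ f ⁻¹' {l'}) := by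
      rw [Set.disjoint_left]
      intro x hx hx'
      exact hne ((show f x = l from hx.2).symm.trans hx'.2)
    have h3 : ν (P.fib b ∩ f ⁻¹' {l}) + ν (P.fib b ∩ f ⁻¹' {l'}) ≤ ν (P.fib b) := by
      rw [← measure_union hdis ((P.measurableSet_fib b).inter (hfl l'))]
      exact measure_mono (Set.union_subset Set.inter_subset_left Set.inter_subset_left)
    have h4 : 2 * ν (P.fib b) < 2 * ν (P.fib b) := by
      calc 2 * ν (P.fib b) = ν (P.fib b) + ν (P.fib b) := two_mul _
        _ < 2 * ν (P.fib b ∩ f ⁻¹' {l}) + 2 * ν (P.fib b ∩ f ⁻¹' {l'}) := ENNReal.add_lt_add h1 h2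
        _ = 2 * (ν (P.fib b ∩ f ⁻¹' {l}) + ν (P.fib b ∩ f ⁻¹' {l'})) := (mul_add _ _ _).symm
        _ ≤ 2 * ν (P.fib b) := by gcongr
    exact lt_irrefl _ h4
  -- The points where `f` takes the majority value of their fibre; `M` is invariant, and it is not
  -- null because `f` is close to the fibrewise constant function `F`.
  set M : Set X := {x | maj (P.proj m x) (f x)} with hM
  have hMm : MeasurableSet M := by
    have : M = ⋃ b : P.Level m, ⋃ l : Λ, ⋃ _ : maj b l, P.fib b ∩ f ⁻¹' {l} := by
      ext x
      simp only [Set.mem_iUnion]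
      constructor
      · exact fun hx => ⟨_, _, hx, rfl, rfl⟩
      · rintro ⟨b, l, hx, h1, h2⟩
        change maj (P.proj m x) (f x)
        rw [P.mem_fib.1 h1, show f x = l from h2]
        exact hx
    rw [this]
    exact MeasurableSet.iUnion fun b => MeasurableSet.iUnion fun l => MeasurableSet.iUnion fun _ =>
      (P.measurableSet_fib b).inter (hfl l)
  have hMinv : ∀ γ : (Γ₀ ⊓ MulAction.stabilizer Γ a : Subgroup Γ),
      ((γ • ·) ⁻¹' M : Set X) =ᵐ[ν] M := by
    intro γ
    have hconj : g * γ * g⁻¹ ∈ Γ₀ ⊓ MulAction.stabilizer Γ a := ⟨hn.conj_mem _ γ.2.1 g,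
      (MulAction.stabilizer Γ a).mul_mem
        ((MulAction.stabilizer Γ a).mul_mem hg γ.2.2) ((MulAction.stabilizer Γ a).inv_mem hg)⟩
    set c := ρ ⟨g * γ * g⁻¹, hconj⟩ with hc
    set d := ρ γ with hd
    have hq := (measurePreserving_smul (⟨g, hg⟩ : MulAction.stabilizer Γ a)
      ν).quasiMeasurePreserving.ae (hρ ⟨g * γ * g⁻¹, hconj⟩)
    -- Expand `w (g * γ)` along `g * γ` and along `(g * γ * g⁻¹) * g`.
    have hequi : ∀ᵐ x ∂ν, f ((γ : Γ) • x) = c * f x * d⁻¹ := by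
      filter_upwards [hρ γ, hq] with x h1 h2
      have h2' : w (g * γ * g⁻¹) (g • x) = c := h2
      have e1 := w.map_mul g γ x
      have e2 := w.map_mul (g * γ * g⁻¹) g x
      rw [inv_mul_cancel_right, e1, h2', h1] at e2
      rw [hf, ← e2, hd, mul_inv_cancel_right]
    have hmove : ∀ b l, maj ((γ : Γ) • b) (c * l * d⁻¹) ↔ maj b l := by
      intro b l
      have h1 : ν (P.fib ((γ : Γ) • b)) = ν (P.fib b) := by
        rw [← P.preimage_smul_fib b γ]
        exact (herg.measure_preimage_smul γ (P.measurableSet_fib _)).symm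
      have h2 : ν (P.fib ((γ : Γ) • b) ∩ f ⁻¹' {c * l * d⁻¹}) = ν (P.fib b ∩ f ⁻¹' {l}) := by
        rw [← herg.measure_preimage_smul γ ((P.measurableSet_fib _).inter (hfl _))]
        apply measure_congr
        filter_upwards [hequi] with x hx
        refine propext ?_
        change ((γ : Γ) • x ∈ P.fib ((γ : Γ) • b) ∧ f ((γ : Γ) • x) = c * l * d⁻¹) ↔
          (x ∈ P.fib b ∧ f x = l)
        rw [hx, P.mem_fib, P.mem_fib, P.proj_smul, smul_left_cancel_iff, mul_left_inj,
          mul_right_inj]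
      simp only [hmaj, h1, h2]
    filter_upwards [hequi] with x hx
    refine propext ?_
    change maj (P.proj m ((γ : Γ) • x)) (f ((γ : Γ) • x)) ↔ maj (P.proj m x) (f x)
    rw [hx, P.proj_smul, hmove]
  have hM0 : ν M ≠ 0 := by
    intro h0
    have : Fintype (P.Level m) := Fintype.ofFinite _
    have hEm : MeasurableSet {x | f x ≠ F x} :=
      (measurableSet_eq_fun hfm (P.measurable_of_factorsThrough hF)).compl
    have hb : ∀ b : P.Level m, 2 * ν (P.fib b ∩ {x | f x ≠ F x}ᶜ) ≤ ν (P.fib b) := by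
      intro b
      by_cases hz : ν (P.fib b ∩ {x | f x ≠ F x}ᶜ) = 0
      · rw [hz, mul_zero]; exact zero_le
      obtain ⟨x, ⟨hx1, hx2⟩, hxM⟩ : ∃ x ∈ P.fib b ∩ {x | f x ≠ F x}ᶜ, x ∉ M := by
        by_contra! hcon
        exact hz (measure_mono_null hcon h0)
      have hsub : P.fib b ∩ {x | f x ≠ F x}ᶜ ⊆ P.fib b ∩ f ⁻¹' {f x} := by
        rintro y ⟨hy1, hy2⟩
        refine ⟨hy1, ?_⟩
        have e1 : f y = F y := not_not.1 hy2
        have e2 : f x = F x := not_not.1 hx2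
        change f y = f x
        rw [e1, e2]
        exact hF (Eq.trans hy1 (Eq.symm hx1))
      have hxM' : ¬ maj b (f x) := by
        rw [← P.mem_fib.1 hx1]; exact hxM
      calc _ ≤ 2 * ν (P.fib b ∩ f ⁻¹' {f x}) := by gcongr
        _ ≤ ν (P.fib b) := not_lt.1 hxM'
    have h1 : 2 * ν {x | f x ≠ F x}ᶜ ≤ 1 := by
      rw [P.measure_sum_fib m ν, Finset.mul_sum]
      refine (Finset.sum_le_sum fun b _ => hb b).trans_eq ?_
      rw [← measure_univ (μ := ν), P.measure_sum_fib m ν Set.univ]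
      simp
    have h2 : (1 : ℝ≥0∞) ≤ 4⁻¹ + ν {x | f x ≠ F x}ᶜ := by
      rw [← measure_univ (μ := ν), ← measure_add_measure_compl hEm]
      gcongr
    have h3 : (2 : ℝ≥0∞) ≤ 2 * 4⁻¹ + 1 := by
      calc (2 : ℝ≥0∞) = 2 * 1 := (mul_one _).symm
        _ ≤ 2 * (4⁻¹ + ν {x | f x ≠ F x}ᶜ) := by gcongr
        _ = 2 * 4⁻¹ + 2 * ν {x | f x ≠ F x}ᶜ := mul_add _ _ _
        _ ≤ 2 * 4⁻¹ + 1 := by gcongr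
    have h4 := ENNReal.toReal_mono (by finiteness) h3
    rw [ENNReal.toReal_add (by finiteness) (by finiteness)] at h4
    norm_num at h4
  have hMae := herg.ae_mem_of_invariant hMm hMinv hM0
  refine ⟨m, fun x => if h : ∃ l, maj (P.proj m x) l then h.choose else 1, ?_, ?_⟩
  · intro x y hxy
    simp only [hxy]
  · filter_upwards [hMae] with x hx
    have h : ∃ l, maj (P.proj m x) l := ⟨_, hx⟩
    rw [dif_pos h]
    exact hmaj_unique _ _ _ hx h.choose_spec

/-- **Cocycle superrigidity**: on some fibre, a cocycle of the whole group `Γ` restricted to the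
stabilizer of the base point is cohomologous to a homomorphism. -/
theorem cocycle_superrigidity {Γ₀ : Subgroup Γ} [hn : Γ₀.Normal]
    (hT : HasRelativePropertyT.{u, v} Γ₀) (hfg : Group.FG (Γ ⧸ Γ₀))
    (herg₀ : ErgodicSMul Γ₀ X μ) (w : MeasCocycle Γ X Λ) :
    ∃ n, ∃ a : P.Level n, μ (P.fib a) ≠ 0 ∧ ∃ (ψ : X → Λ) (hψ : Measurable ψ)
      (ρ : MulAction.stabilizer Γ a →* Λ),
      ∀ g : MulAction.stabilizer Γ a, ∀ᵐ x ∂μ, x ∈ P.fib a → w.conj ψ hψ (g : Γ) x = ρ g := by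
  obtain ⟨n, a, ha0, ψ, hψ, ρ, hρ⟩ := P.exists_conj_eq_hom_on_normal hT herg₀ w
  set w' := w.conj ψ hψ with hw'
  set ν := μ[|P.fib a] with hν
  have hinvs := P.smulInvariantMeasure_cond a (le_refl (MulAction.stabilizer Γ a))
  have hquasi : ∀ g ∈ MulAction.stabilizer Γ a, ∀ {p : X → Prop}, (∀ᵐ x ∂ν, p x) →
      ∀ᵐ x ∂ν, p (g • x) := fun g hg p hp =>
    (measurePreserving_smul (⟨g, hg⟩ : MulAction.stabilizer Γ a) ν).quasiMeasurePreserving.ae hp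
  -- The elements `g` fixing `a` for which `w' g` is a function of the `m`-th level.
  let K : ℕ → Subgroup Γ := fun m =>
    { carrier := {g | g ∈ MulAction.stabilizer Γ a ∧ ∃ F : X → Λ, FactorsThrough F (P.proj m) ∧
        ∀ᵐ x ∂ν, w' g x = F x}
      one_mem' := ⟨Subgroup.one_mem _, fun _ => 1, fun _ _ _ => rfl,
        Eventually.of_forall fun x => w'.map_one x⟩
      mul_mem' := by
        rintro g h ⟨hg, F, hF, hgF⟩ ⟨hh, F', hF', hhF⟩
        refine ⟨Subgroup.mul_mem _ hg hh, fun x => F (h • x) * F' x, fun x y hxy => ?_, ?_⟩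
        · have : F (h • x) = F (h • y) := hF (by rw [P.proj_smul, P.proj_smul, hxy])
          simp only [this, hF' hxy]
        · filter_upwards [hquasi h hh hgF, hhF] with x h1 h2
          rw [w'.map_mul, h1, h2]
      inv_mem' := by
        rintro g ⟨hg, F, hF, hgF⟩
        refine ⟨Subgroup.inv_mem _ hg, fun x => (F (g⁻¹ • x))⁻¹, fun x y hxy => ?_, ?_⟩
        · have : F (g⁻¹ • x) = F (g⁻¹ • y) := hF (by rw [P.proj_smul, P.proj_smul, hxy])
          simp only [this]
        · filter_upwards [hquasi g⁻¹ (Subgroup.inv_mem _ hg) hgF] with x h1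
          rw [w'.map_inv, h1] }
  have hKmono : ∀ {m k}, m ≤ k → K m ≤ K k := by
    rintro m k hmk g ⟨hg, F, hF, hgF⟩
    exact ⟨hg, F, P.factorsThrough_le hmk hF, hgF⟩
  have hKstab : ∀ g ∈ MulAction.stabilizer Γ a, ∃ m, g ∈ K m := by
    intro g hg
    obtain ⟨m, F, hF, hgF⟩ := P.exists_factorsThrough_of_hom_on_normal herg₀ w' ha0 ρ hρ hg
    exact ⟨m, hg, F, hF, hgF⟩
  have hKnormal : ∀ m, Γ₀ ⊓ MulAction.stabilizer Γ a ≤ K m := fun m g hg =>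
    ⟨hg.2, fun _ => ρ ⟨g, hg⟩, fun _ _ _ => rfl, hρ ⟨g, hg⟩⟩
  -- Every coset of `Γ₀` meets the stabilizer of `a`.
  have hlift : ∀ s : Γ ⧸ Γ₀, ∃ g ∈ MulAction.stabilizer Γ a, (g : Γ ⧸ Γ₀) = s := by
    intro s
    obtain ⟨γ, rfl⟩ := QuotientGroup.mk_surjective s
    obtain ⟨k, hk, hka⟩ := P.exists_smul_eq Γ₀ herg₀ (a := γ • a) (b := a)
      (by rwa [P.measure_fib_smul]) ha0
    refine ⟨k * γ, by rw [MulAction.mem_stabilizer_iff, mul_smul, hka], ?_⟩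
    rw [QuotientGroup.mk_mul, (QuotientGroup.eq_one_iff k).2 hk, one_mul]
  obtain ⟨S, hS⟩ := hfg.out
  choose lift hlift1 hlift2 using hlift
  choose lev hlev using fun s => hKstab (lift s) (hlift1 s)
  set m := max n (S.sup lev) with hm
  have hall : MulAction.stabilizer Γ a ≤ K m := by
    intro g hg
    have htop : (⊤ : Subgroup (Γ ⧸ Γ₀)) ≤ (K m).map (QuotientGroup.mk' Γ₀) := by
      rw [← hS, Subgroup.closure_le]
      intro s hs
      exact ⟨lift s, hKmono ((Finset.le_sup hs).trans (le_max_right _ _)) (hlev s), hlift2 s⟩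
    obtain ⟨k, hk, hkg⟩ := htop (Subgroup.mem_top (g : Γ ⧸ Γ₀))
    have h1 : k⁻¹ * g ∈ Γ₀ := QuotientGroup.eq.1 hkg
    have h2 : k⁻¹ * g ∈ K m := hKnormal m ⟨h1, Subgroup.mul_mem _ (Subgroup.inv_mem _ hk.1) hg⟩
    have := (K m).mul_mem hk h2
    rwa [mul_inv_cancel_left] at this
  obtain ⟨u, hu0, -, hu⟩ := P.exists_measure_fib_eq Γ₀ herg₀ m
  obtain ⟨x₀, hx₀a, hx₀⟩ : ∃ x₀ ∈ P.fib a, μ (P.fib (P.proj m x₀)) = u := by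
    by_contra! hcon
    apply ha0
    rw [measure_eq_zero_iff_ae_notMem]
    filter_upwards [hu] with x hx hxa using hcon x hxa hx
  set b := P.proj m x₀ with hb
  have hnm : n ≤ m := le_max_left _ _
  have hba : P.fib b ⊆ P.fib a := fun x hx => Eq.trans (P.nested_le hnm hx) hx₀a
  have hstab : MulAction.stabilizer Γ b ≤ MulAction.stabilizer Γ a := by
    have := P.stabilizer_le hnm x₀
    rwa [P.mem_fib.1 hx₀a] at this
  have hval : ∀ g : MulAction.stabilizer Γ b, ∃ l, ∀ᵐ x ∂μ, x ∈ P.fib b → w' (g : Γ) x = l := by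
    intro g
    obtain ⟨-, F, hF, hgF⟩ := hall (hstab g.2)
    refine ⟨F x₀, ?_⟩
    rw [hν, ae_iff_cond (P.measurableSet_fib a)] at hgF
    filter_upwards [hgF] with x hx hxb
    rw [hx (hba hxb)]
    exact hF hxb
  choose r hr using hval
  have hb0 : μ (P.fib b) ≠ 0 := by rw [hx₀]; exact hu0
  refine ⟨m, b, hb0, ψ, hψ, MonoidHom.mk' r fun g k => ?_, hr⟩
  have hex : ∀ᵐ x ∂μ, x ∈ P.fib b → r (g * k) = r g * r k := by
    have hk := (measurePreserving_smul (k : Γ) μ).quasiMeasurePreserving.ae (hr g)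
    filter_upwards [hr (g * k), hk, hr k] with x h1 h2 h3 hx
    rw [← h1 hx, ← h3 hx, ← h2 ((P.smul_mem_fib (MulAction.mem_stabilizer_iff.1 k.2)).2 hx)]
    exact w'.map_mul _ _ _
  by_contra hne
  apply hb0
  rw [measure_eq_zero_iff_ae_notMem]
  filter_upwards [hex] with x hx hxb using hne (hx hxb)

end ProfiniteSystem

/-! ### The profinite system of a tower -/

section Conull

open Filter

/-- A property that holds almost everywhere holds at all points of an invariant conull set. -/
theorem exists_invariant_conull {Γ : Type*} [Group Γ] [Countable Γ] {X : Type*} [MeasurableSpace X]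
    [MulAction Γ X] [MeasurableConstSMul Γ X] {μ : Measure X} [SMulInvariantMeasure Γ X μ]
    {p : X → Prop} (hp : ∀ᵐ x ∂μ, p x) :
    ∃ X₁ : Set X, MeasurableSet X₁ ∧ (∀ (γ : Γ) x, γ • x ∈ X₁ ↔ x ∈ X₁) ∧ (∀ᵐ x ∂μ, x ∈ X₁) ∧
      ∀ x ∈ X₁, p x := by
  obtain ⟨N, hN, hNm, hN0⟩ := exists_measurable_superset_of_null (ae_iff.1 hp)
  refine ⟨⋂ γ : Γ, (γ • ·) ⁻¹' Nᶜ, MeasurableSet.iInter fun γ =>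
    measurable_const_smul γ hNm.compl, ?_, ?_, ?_⟩
  · intro γ x
    simp only [Set.mem_iInter, Set.mem_preimage]
    constructor
    · intro h k
      have := h (k * γ⁻¹)
      rwa [mul_smul, inv_smul_smul] at this
    · intro h k
      have := h (k * γ)
      rwa [mul_smul] at this
  · have h1 : ∀ᵐ x ∂μ, x ∈ Nᶜ := measure_eq_zero_iff_ae_notMem.1 hN0
    have h2 := ae_all_iff.2 fun γ : Γ => (measurePreserving_smul γ μ).quasiMeasurePreserving.ae h1
    filter_upwards [h2] with x hx
    exact Set.mem_iInter.2 hx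
  · intro x hx
    by_contra h
    have := Set.mem_iInter.1 hx 1
    rw [Set.mem_preimage, one_smul] at this
    exact this (hN h)

end Conull

namespace FiniteActionTower

open scoped ENNReal symmDiff
open Function Filter

variable {Γ : Type u} [Group Γ] (T : FiniteActionTower.{u, w} Γ)

theorem measurable_r (n : ℕ) : Measurable (T.r n) :=
  (measurable_pi_apply n).comp measurable_subtype_coe

theorem r_smul (n : ℕ) (γ : Γ) (x : T.Limit) : T.r n (γ • x) = γ • T.r n x := rfl

theorem r_nested (n : ℕ) (x y : T.Limit) (h : T.r (n + 1) x = T.r (n + 1) y) : T.r n x = T.r n y := by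
  have h1 := x.2 n
  have h2 := y.2 n
  change T.q n (T.r (n + 1) x) = T.r n x at h1
  change T.q n (T.r (n + 1) y) = T.r n y at h2
  rw [← h1, ← h2, h]

theorem r_nested_le {n m : ℕ} (hnm : n ≤ m) {x y : T.Limit} (h : T.r m x = T.r m y) :
    T.r n x = T.r n y := by
  induction m, hnm using Nat.le_induction with
  | base => exact h
  | succ k _ ih => exact ih (T.r_nested k x y h)

/-- The sets that are determined by a level are dense in the measure algebra of the limit. -/
theorem exists_saturated_near (ν : Measure T.Limit) [IsFiniteMeasure ν] {A : Set T.Limit}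
    (hA : MeasurableSet A) {ε : ℝ≥0∞} (hε : 0 < ε) :
    ∃ n, ∃ B : Set T.Limit, (∀ x y, T.r n x = T.r n y → x ∈ B → y ∈ B) ∧ ν (A ∆ B) ≤ ε := by
  set C : Set (Set T.Limit) :=
    {B | ∃ n, ∀ x y, T.r n x = T.r n y → x ∈ B → y ∈ B} with hC
  have hCm : ∀ B ∈ C, MeasurableSet B := by
    rintro B ⟨n, hB⟩
    have : B = T.r n ⁻¹' (T.r n '' B) := by
      ext x
      constructor
      · exact fun hx => ⟨x, hx, rfl⟩
      · rintro ⟨y, hy, e⟩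
        exact hB y x e hy
    rw [this]
    exact T.measurable_r n (Set.toFinite _).measurableSet
  have hgen : (inferInstance : MeasurableSpace T.Limit) = MeasurableSpace.generateFrom C := by
    apply le_antisymm
    · have h1 : Measurable[MeasurableSpace.generateFrom C] (fun x : T.Limit => x.1) := by
        refine @measurable_pi_lambda _ _ _ (MeasurableSpace.generateFrom C) _ _ fun n s _ => ?_
        refine MeasurableSpace.measurableSet_generateFrom ⟨n, fun x y h hx => ?_⟩
        have hx' : T.r n x ∈ s := hx
        rw [h] at hx'
        exact hx'
      exact measurable_iff_comap_le.1 h1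
    · exact MeasurableSpace.generateFrom_le hCm
  have hring : IsSetRing C :=
    { empty_mem := ⟨0, fun _ _ _ h => h⟩
      union_mem := by
        rintro s t ⟨n, hs⟩ ⟨m, ht⟩
        refine ⟨max n m, fun x y h => ?_⟩
        rintro (hx | hx)
        · exact Or.inl (hs x y (T.r_nested_le (le_max_left n m) h) hx)
        · exact Or.inr (ht x y (T.r_nested_le (le_max_right n m) h) hx)
      sdiff_mem := by
        rintro s t ⟨n, hs⟩ ⟨m, ht⟩
        refine ⟨max n m, fun x y h hx => ?_⟩
        exact ⟨hs x y (T.r_nested_le (le_max_left n m) h) hx.1, fun hy =>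
          hx.2 (ht y x (T.r_nested_le (le_max_right n m) h).symm hy)⟩ }
  obtain ⟨B, ⟨n, hB⟩, hBε⟩ := exists_measure_symmDiff_lt_of_generateFrom_isSetRing (μ := ν) hring
    ⟨{Set.univ}, Set.countable_singleton _, by
      rw [Set.singleton_subset_iff]
      exact ⟨0, fun _ _ _ _ => trivial⟩, by simp⟩ hgen hA hε
  exact ⟨n, B, hB, by rw [symmDiff_comm]; exact hBε.le⟩

section System

variable {T} {X : Type v} [MeasurableSpace X] [MulAction Γ X] {μ : Measure X}
  {ν : Measure T.Limit} [IsFiniteMeasure ν] {θ : X → T.Limit} {η : T.Limit → X} {X₀ : Set X}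

open Classical in
/-- The profinite system on `X` given by a map `θ` to the limit of the tower. On the complement of
the conull set `X₀` where `θ` is equivariant, the projections take the additional value `none`, so
that they are equivariant everywhere. -/
noncomputable def system (hθ : MeasurePreserving θ μ ν) (hη : MeasurePreserving η ν μ)
    (hηθ : ∀ᵐ x ∂μ, η (θ x) = x) (hX₀ : MeasurableSet X₀)
    (hinv : ∀ (γ : Γ) x, γ • x ∈ X₀ ↔ x ∈ X₀) (hae : ∀ᵐ x ∂μ, x ∈ X₀)
    (hequi : ∀ x ∈ X₀, ∀ γ : Γ, θ (γ • x) = γ • θ x) : ProfiniteSystem.{u, v, w} Γ μ where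
  Level n := Option (T.Level n)
  proj n x := if x ∈ X₀ then some (T.r n (θ x)) else none
  measurableSet_fiber n a := by
    cases a with
    | none =>
      convert! hX₀.compl using 1
      ext x
      by_cases hx : x ∈ X₀ <;> simp [hx]
    | some a =>
      convert! hX₀.inter (hθ.measurable (T.measurable_r n (measurableSet_singleton a))) using 1
      ext x
      by_cases hx : x ∈ X₀ <;> simp [hx]
  proj_smul n γ x := by
    by_cases hx : x ∈ X₀
    · rw [if_pos hx, if_pos ((hinv γ x).2 hx), hequi x hx, T.r_smul, Option.smul_some]
    · rw [if_neg hx, if_neg (fun h => hx ((hinv γ x).1 h)), Option.smul_none]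
  nested n x y h := by
    by_cases hx : x ∈ X₀ <;> by_cases hy : y ∈ X₀
    · rw [if_pos hx, if_pos hy] at h ⊢
      rw [T.r_nested n _ _ (Option.some_injective _ h)]
    · rw [if_pos hx, if_neg hy] at h
      exact absurd h (by simp)
    · rw [if_neg hx, if_pos hy] at h
      exact absurd h (by simp)
    · rw [if_neg hx, if_neg hy]
  dense A hA ε hε := by
    obtain ⟨n, B, hB, hBε⟩ := T.exists_saturated_near ν (hη.measurable hA) hε
    have hBm : MeasurableSet B := by
      have : B = T.r n ⁻¹' (T.r n '' B) := by
        ext x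
        exact ⟨fun hx => ⟨x, hx, rfl⟩, fun ⟨y, hy, e⟩ => hB y x e hy⟩
      rw [this]
      exact T.measurable_r n (Set.toFinite _).measurableSet
    refine ⟨n, X₀ ∩ θ ⁻¹' B, fun x y h => ?_, ?_⟩
    · rintro ⟨hx, hxB⟩
      rw [if_pos hx] at h
      by_cases hy : y ∈ X₀
      · rw [if_pos hy] at h
        exact ⟨hy, hB _ _ (Option.some_injective _ h) hxB⟩
      · rw [if_neg hy] at h
        exact absurd h (by simp)
    · rw [← hθ.measure_preimage ((hη.measurable hA).symmDiff hBm).nullMeasurableSet] at hBε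
      refine le_trans (measure_mono_ae ?_) hBε
      filter_upwards [hηθ, hae] with x h1 h2
      have e1 : η (θ x) ∈ A ↔ x ∈ A := by rw [h1]
      rintro (⟨h3, h4⟩ | ⟨h3, h4⟩)
      · exact Or.inl ⟨e1.2 h3, fun h => h4 ⟨h2, h⟩⟩
      · exact Or.inr ⟨h3.2, fun h => h4 (e1.1 h)⟩

end System

/-- A limit action has a profinite system and an invariant conull set, inside any given conull set,
which is separated by the system and contains its fibres of positive measure; for an ergodic action
the fibres of positive measure over the `n`-th level have measure `1 / |X_n|`. -/
theorem HasLimit.exists_system [Countable Γ] {T : FiniteActionTower.{u, w} Γ} {X : Type v}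
    [MeasurableSpace X] [MulAction Γ X] [MeasurableConstSMul Γ X] {μ : Measure X}
    [IsProbabilityMeasure μ] [SMulInvariantMeasure Γ X μ] (hlim : T.HasLimit μ)
    (Γ₀ : Subgroup Γ) (herg : ErgodicSMul Γ₀ X μ) {p : X → Prop} (hp : ∀ᵐ x ∂μ, p x) :
    ∃ (P : ProfiniteSystem.{u, v, w} Γ μ) (X₀ : Set X), MeasurableSet X₀ ∧
      (∀ (γ : Γ) x, γ • x ∈ X₀ ↔ x ∈ X₀) ∧ (∀ᵐ x ∂μ, x ∈ X₀) ∧ (∀ x ∈ X₀, p x) ∧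
      (∀ x ∈ X₀, ∀ y ∈ X₀, (∀ n, P.proj n x = P.proj n y) → x = y) ∧
      (∀ n, ∃ a : P.Level n, μ (P.fib a) ≠ 0) ∧
      ∀ n (a : P.Level n), μ (P.fib a) ≠ 0 →
        P.fib a ⊆ X₀ ∧ μ (P.fib a) = (Nat.card (T.Level n) : ℝ≥0∞)⁻¹ := by
  classical
  obtain ⟨ν, hν, θ, ⟨hθ, η, hη, hηθ, -⟩, hequi⟩ := hlim
  have : IsProbabilityMeasure ν :=
    ⟨by rw [← hθ.measure_preimage MeasurableSet.univ.nullMeasurableSet, Set.preimage_univ,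
      measure_univ]⟩
  obtain ⟨X₀, hX₀m, hX₀inv, hX₀ae, hX₀⟩ := exists_invariant_conull (Γ := Γ)
    (hp.and (hηθ.and (ae_all_iff.2 hequi)))
  set P := system hθ hη hηθ hX₀m hX₀inv hX₀ae (fun x hx => (hX₀ x hx).2.2) with hP
  have hproj : ∀ n, ∀ x ∈ X₀, P.proj n x = some (T.r n (θ x)) := fun n x hx => if_pos hx
  have hproj' : ∀ n, ∀ x ∉ X₀, P.proj n x = none := fun n x hx => if_neg hx
  have hsome : ∀ n (a : T.Level n), μ (P.fib (n := n) (some a)) = T.measure n {a} := by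
    intro n a
    rw [← (hν n).measure_preimage (measurableSet_singleton a).nullMeasurableSet,
      ← hθ.measure_preimage (T.measurable_r n (measurableSet_singleton a)).nullMeasurableSet]
    apply measure_congr
    filter_upwards [hX₀ae] with x hx
    refine propext ?_
    change P.proj n x = some a ↔ T.r n (θ x) = a
    rw [hproj n x hx]
    exact ⟨fun h => Option.some_injective _ h, fun h => congrArg some h⟩
  have hnone : ∀ n, μ (P.fib (n := n) none) = 0 := by
    intro n
    rw [measure_eq_zero_iff_ae_notMem]
    filter_upwards [hX₀ae] with x hx h
    have h' : P.proj n x = none := h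
    rw [hproj n x hx] at h'
    exact absurd h' (by simp)
  refine ⟨P, X₀, hX₀m, hX₀inv, hX₀ae, fun x hx => (hX₀ x hx).1, ?_, ?_, ?_⟩
  · intro x hx y hy h
    have e : θ x = θ y := Subtype.ext (funext fun n => by
      have := h n
      rw [hproj n x hx, hproj n y hy] at this
      exact Option.some_injective _ this)
    rw [← (hX₀ x hx).2.1, ← (hX₀ y hy).2.1, e]
  · intro n
    obtain ⟨a⟩ : Nonempty (T.Level n) := nonempty_of_isProbabilityMeasure (T.measure n)
    exact ⟨some a, by rw [hsome]; exact (T.pos n a).ne'⟩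
  · intro n a ha
    cases a with
    | none => exact absurd (hnone n) ha
    | some a =>
      refine ⟨fun x hx => ?_, ?_⟩
      · by_contra h
        have h' : P.proj n x = some a := hx
        rw [hproj' n x h] at h'
        exact absurd h' (by simp)
      obtain ⟨u, -, -, hu⟩ := P.exists_measure_fib_eq Γ₀ herg n
      have hall : ∀ c : T.Level n, T.measure n {c} = u := by
        intro c
        by_contra hne
        have h0 : μ (P.fib (n := n) (some c)) ≠ 0 := by rw [hsome]; exact (T.pos n c).ne'
        apply h0
        rw [measure_eq_zero_iff_ae_notMem]
        filter_upwards [hu] with x hx hxc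
        rw [P.mem_fib.1 hxc, hsome] at hx
        exact hne hx
      have : Fintype (T.Level n) := Fintype.ofFinite _
      have hsum : ∑ c : T.Level n, T.measure n {c} = 1 := by
        rw [← measure_univ (μ := T.measure n), sum_measure_singleton, Finset.coe_univ]
      simp only [hall, Finset.sum_const, Finset.card_univ, nsmul_eq_mul] at hsum
      rw [hsome, hall, Nat.card_eq_fintype_card]
      exact ENNReal.eq_inv_of_mul_eq_one_left (by rw [mul_comm]; exact hsum)

end FiniteActionTower

/-! ### Stable orbit equivalences and their Zimmer cocycles -/

section Choice

open Classical in
/-- A measurable choice of an index from a countable family of measurable sets. -/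
theorem exists_measurable_choice {X I : Type*} [MeasurableSpace X] [Countable I] [Nonempty I]
    (A : I → Set X) (hA : ∀ i, MeasurableSet (A i)) :
    ∃ s : X → I, (∀ i, MeasurableSet {x | s x = i}) ∧ ∀ x, (∃ i, x ∈ A i) → x ∈ A (s x) := by
  obtain ⟨e, he⟩ := exists_surjective_nat I
  have hp : ∀ x, ∃ k, x ∈ A (e k) ∨ x ∉ ⋃ i, A i := by
    intro x
    by_cases h : ∃ i, x ∈ A i
    · obtain ⟨i, hi⟩ := h
      obtain ⟨k, rfl⟩ := he i
      exact ⟨k, Or.inl hi⟩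
    · exact ⟨0, Or.inr fun h' => h (Set.mem_iUnion.1 h')⟩
  have hm : Measurable fun x => Nat.find (hp x) := measurable_find hp fun k =>
    (hA (e k)).union (MeasurableSet.iUnion hA).compl
  refine ⟨fun x => e (Nat.find (hp x)), fun i => ?_, fun x hx => ?_⟩
  · exact hm (MeasurableSet.of_discrete (s := e ⁻¹' {i}))
  · exact (Nat.find_spec (hp x)).resolve_right fun h => h (Set.mem_iUnion.2 hx)

end Choice

section Tiling

open scoped ENNReal

/-- If the translates of a set by a countable group are equal or disjoint, according to a subgroup
`D`, then the action being ergodic they partition the space modulo a null set, into finitely many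
sets of equal measure. -/
theorem exists_nat_mul_measure_eq_one {Λ : Type*} [Group Λ] [Countable Λ] {Z : Type*}
    [MeasurableSpace Z] [MulAction Λ Z] [MeasurableConstSMul Λ Z] (ρ : Measure Z)
    [IsProbabilityMeasure ρ] (herg : ErgodicSMul Λ Z ρ) {V : Set Z} (hV : MeasurableSet V)
    (h0 : ρ V ≠ 0) (D : Subgroup Λ) (hD : ∀ l ∈ D, ∀ z ∈ V, l • z ∈ V)
    (hD' : ∀ l : Λ, ∀ z ∈ V, l • z ∈ V → l ∈ D) : ∃ m : ℕ, 1 ≤ m ∧ (m : ℝ≥0∞) * ρ V = 1 := by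
  have : Countable (Λ ⧸ D) := Quotient.countable
  set W : Λ ⧸ D → Set Z := fun c => (c.out⁻¹ • ·) ⁻¹' V with hW
  have hWm : ∀ c, MeasurableSet (W c) := fun c => measurable_const_smul _ hV
  have hWd : Pairwise (Function.onFun Disjoint W) := by
    intro c d hcd
    rw [Function.onFun, Set.disjoint_left]
    intro z hz hz'
    apply hcd
    have h1 : c.out⁻¹ * d.out ∈ D := by
      refine hD' _ (d.out⁻¹ • z) hz' ?_
      rw [smul_smul, mul_assoc, mul_inv_cancel, mul_one]
      exact hz
    rw [← QuotientGroup.out_eq' c, ← QuotientGroup.out_eq' d]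
    exact QuotientGroup.eq.2 h1
  have hU : ∀ z, z ∈ ⋃ c, W c ↔ ∃ l : Λ, l • z ∈ V := by
    intro z
    rw [Set.mem_iUnion]
    constructor
    · rintro ⟨c, hc⟩
      exact ⟨_, hc⟩
    · rintro ⟨l, hl⟩
      refine ⟨((l⁻¹ : Λ) : Λ ⧸ D), ?_⟩
      have h1 : ((l⁻¹ : Λ) : Λ ⧸ D).out⁻¹ * l⁻¹ ∈ D :=
        QuotientGroup.eq.1 (QuotientGroup.out_eq' _)
      have h2 := hD _ h1 _ hl
      rwa [smul_smul, inv_mul_cancel_right] at h2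
  have hae := herg.ae_mem_of_invariant (MeasurableSet.iUnion hWm) (fun g => by
    refine Filter.EventuallyEq.of_eq ?_
    ext z
    change g • z ∈ ⋃ c, W c ↔ z ∈ ⋃ c, W c
    rw [hU, hU]
    constructor
    · rintro ⟨l, hl⟩
      exact ⟨l * g, by rwa [mul_smul]⟩
    · rintro ⟨l, hl⟩
      exact ⟨l * g⁻¹, by rwa [mul_smul, inv_smul_smul]⟩)
    (fun h => h0 (measure_mono_null (fun z hz => (hU z).2 ⟨1, by rwa [one_smul]⟩) h))
  have h1 : ρ (⋃ c, W c) = 1 := prob_compl_eq_zero_iff (MeasurableSet.iUnion hWm) |>.1 hae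
  rw [measure_iUnion hWd hWm] at h1
  have h2 : ∀ c, ρ (W c) = ρ V := fun c => herg.measure_preimage_smul _ hV
  simp only [h2, ENNReal.tsum_const] at h1
  have hfin : Finite (Λ ⧸ D) := by
    by_contra hinf
    rw [not_finite_iff_infinite] at hinf
    rw [ENat.card_eq_top_of_infinite, ENat.toENNReal_top, ENNReal.top_mul h0] at h1
    exact ENNReal.top_ne_one h1
  have : Nonempty (Λ ⧸ D) := ⟨((1 : Λ) : Λ ⧸ D)⟩
  refine ⟨Nat.card (Λ ⧸ D), Nat.one_le_iff_ne_zero.2 Nat.card_pos.ne', ?_⟩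
  rw [ENat.card_eq_coe_natCard] at h1
  simpa using h1

end Tiling

/-- A measurable map that identifies the orbit equivalence relation of `Γ` on a subset `dom` of
positive measure of `X` with that of a free action of `Λ` on the image of `dom`, and scales the
measure by `c`. Outside `dom` the values of the map are arbitrary. -/
structure PartialOrbitEquivalence (Γ : Type*) [Group Γ] {X : Type*} [MeasurableSpace X]
    [MulAction Γ X] (μ : Measure X) (Λ : Type*) [Group Λ] {Z : Type*} [MeasurableSpace Z]
    [MulAction Λ Z] (ρ : Measure Z) (c : ENNReal) where
  dom : Set X
  measurableSet_dom : MeasurableSet dom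
  measure_dom_ne_zero : μ dom ≠ 0
  map : X → Z
  measurable_map : Measurable map
  injOn : Set.InjOn map dom
  free : ∀ x ∈ dom, ∀ l : Λ, l • map x = map x → l = 1
  orbit_iff : ∀ x ∈ dom, ∀ y ∈ dom, (∃ l : Λ, l • map x = map y) ↔ ∃ γ : Γ, γ • x = y
  measure_eq : ∀ A ⊆ dom, MeasurableSet A → μ A = c * ρ (map '' A)

namespace PartialOrbitEquivalence

open scoped ENNReal
open Filter

variable {Γ : Type u} [Group Γ] [Countable Γ] {X : Type v} [MeasurableSpace X] [MulAction Γ X]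
  [MeasurableConstSMul Γ X] {μ : Measure X} [IsProbabilityMeasure μ] [SMulInvariantMeasure Γ X μ]
  {Λ : Type} [Group Λ] [Countable Λ] [MeasurableSpace Λ] [DiscreteMeasurableSpace Λ] {Z : Type}
  [MeasurableSpace Z] [MulAction Λ Z] [MeasurableConstSMul Λ Z] {ρ : Measure Z} {c : ℝ≥0∞}

omit [IsProbabilityMeasure μ] [SMulInvariantMeasure Γ X μ] [DiscreteMeasurableSpace Λ] in
/-- A partial orbit equivalence extends to the map `x ↦ K.map (s x • x)` on a conull set `X₁`, where
`s x` moves `x` into the domain. The map sends orbits of `Γ` into orbits of the free action of `Λ`,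
and `w` is its Zimmer cocycle. -/
theorem exists_extension (K : PartialOrbitEquivalence Γ μ Λ ρ c) [StandardBorelSpace Z]
    (Γ₀ : Subgroup Γ) (herg : ErgodicSMul Γ₀ X μ) :
    ∃ (X₁ : Set X) (s : X → Γ) (w : MeasCocycle Γ X Λ), MeasurableSet X₁ ∧
      (∀ (γ : Γ) x, γ • x ∈ X₁ ↔ x ∈ X₁) ∧ (∀ᵐ x ∂μ, x ∈ X₁) ∧
      (∀ γ, MeasurableSet {x | s x = γ}) ∧ (∀ x ∈ X₁, s x • x ∈ K.dom) ∧
      ∀ x ∈ X₁, ∀ γ, w γ x • K.map (s x • x) = K.map (s (γ • x) • γ • x) := by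
  classical
  obtain ⟨s, hsm, hs⟩ := exists_measurable_choice (fun γ : Γ => (γ • ·) ⁻¹' K.dom)
    (fun γ => measurable_const_smul γ K.measurableSet_dom)
  set X₁ : Set X := ⋃ γ : Γ, (γ • ·) ⁻¹' K.dom with hX₁
  have hX₁m : MeasurableSet X₁ := MeasurableSet.iUnion fun γ =>
    measurable_const_smul γ K.measurableSet_dom
  have hinv : ∀ (γ : Γ) x, γ • x ∈ X₁ ↔ x ∈ X₁ := by
    intro γ x
    rw [hX₁, Set.mem_iUnion, Set.mem_iUnion]
    constructor
    · rintro ⟨k, hk⟩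
      exact ⟨k * γ, by rwa [Set.mem_preimage, mul_smul]⟩
    · rintro ⟨k, hk⟩
      exact ⟨k * γ⁻¹, by rwa [Set.mem_preimage, mul_smul, inv_smul_smul]⟩
  have hae : ∀ᵐ x ∂μ, x ∈ X₁ := herg.ae_mem_of_invariant hX₁m
    (fun g => Filter.EventuallyEq.of_eq (by ext x; exact hinv g x))
    (fun h => K.measure_dom_ne_zero (measure_mono_null
      (fun x hx => Set.mem_iUnion.2 ⟨1, by rwa [Set.mem_preimage, one_smul]⟩) h))
  have hsX : ∀ x ∈ X₁, s x • x ∈ K.dom := fun x hx => hs x (Set.mem_iUnion.1 hx)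
  set q : X → Z := fun x => K.map (s x • x) with hq
  have hqm : Measurable q := by
    intro B hB
    have : q ⁻¹' B = ⋃ γ : Γ, {x | s x = γ} ∩ (γ • ·) ⁻¹' (K.map ⁻¹' B) := by
      ext x
      simp only [Set.mem_iUnion]
      constructor
      · exact fun hx => ⟨s x, rfl, hx⟩
      · rintro ⟨γ, h1, h2⟩
        have h1' : s x = γ := h1
        change K.map (s x • x) ∈ B
        rw [h1']
        exact h2
    rw [this]
    exact MeasurableSet.iUnion fun γ => (hsm γ).inter
      (measurable_const_smul γ (K.measurable_map hB))
  have hex : ∀ x ∈ X₁, ∀ γ : Γ, ∃ l : Λ, l • q x = q (γ • x) := by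
    intro x hx γ
    refine (K.orbit_iff _ (hsX x hx) _ (hsX _ ((hinv γ x).2 hx))).2
      ⟨s (γ • x) * γ * (s x)⁻¹, ?_⟩
    rw [mul_smul, inv_smul_smul, mul_smul]
  have huniq : ∀ x ∈ X₁, ∀ l l' : Λ, l • q x = l' • q x → l = l' := by
    intro x hx l l' h
    have : (l'⁻¹ * l) • q x = q x := by rw [mul_smul, h, inv_smul_smul]
    exact (inv_mul_eq_one.1 (K.free _ (hsX x hx) _ this)).symm
  set W : Γ → X → Λ := fun γ x => if h : x ∈ X₁ then (hex x h γ).choose else 1 with hW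
  have hWspec : ∀ x ∈ X₁, ∀ γ, W γ x • q x = q (γ • x) := by
    intro x hx γ
    simp only [hW, dif_pos hx]
    exact (hex x hx γ).choose_spec
  have hW1 : ∀ x ∉ X₁, ∀ γ, W γ x = 1 := by
    intro x hx γ
    simp only [hW, dif_neg hx]
  refine ⟨X₁, s, ⟨W, fun γ => ?_, fun g h x => ?_⟩, hX₁m, hinv, hae, hsm, hsX, hWspec⟩
  · refine measurable_to_countable' fun l => ?_
    have : W γ ⁻¹' {l} = (X₁ ∩ {x | l • q x = q (γ • x)}) ∪ (X₁ᶜ ∩ {_x | l = 1}) := by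
      ext x
      by_cases hx : x ∈ X₁
      · constructor
        · intro h
          refine Or.inl ⟨hx, ?_⟩
          change l • q x = q (γ • x)
          rw [← hWspec x hx γ, show W γ x = l from h]
        · rintro (⟨_, h⟩ | ⟨h, _⟩)
          · exact huniq x hx _ _ ((hWspec x hx γ).trans (Eq.symm h))
          · exact absurd hx h
      · constructor
        · intro h
          exact Or.inr ⟨hx, (show W γ x = l from h).symm.trans (hW1 x hx γ)⟩
        · rintro (⟨h, _⟩ | ⟨_, h⟩)
          · exact absurd h hx
          · exact (hW1 x hx γ).trans (Eq.symm h)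
    rw [this]
    exact (hX₁m.inter (measurableSet_eq_fun (hqm.const_smul l)
      (hqm.comp (measurable_const_smul γ)))).union (hX₁m.compl.inter (MeasurableSet.const _))
  · by_cases hx : x ∈ X₁
    · apply huniq x hx
      rw [hWspec x hx, mul_smul, mul_smul, hWspec x hx, hWspec _ ((hinv h x).2 hx)]
    · rw [hW1 x hx, hW1 x hx, hW1 _ (fun h' => hx ((hinv h x).1 h')), one_mul]

end PartialOrbitEquivalence

/-! ### The possible scaling constants -/

namespace PartialOrbitEquivalence

open scoped ENNReal
open Filter

variable {Γ : Type u} [Group Γ] [Countable Γ] {X : Type v} [MeasurableSpace X] [MulAction Γ X]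
  [MeasurableConstSMul Γ X] {μ : Measure X} [IsProbabilityMeasure μ] [SMulInvariantMeasure Γ X μ]
  {Λ : Type} [Group Λ] [Countable Λ] [MeasurableSpace Λ] [DiscreteMeasurableSpace Λ] {Z : Type}
  [MeasurableSpace Z] [MulAction Λ Z] [MeasurableConstSMul Λ Z] {ρ : Measure Z} {c : ℝ≥0∞}

/-- After untwisting the Zimmer cocycle on a fibre by means of cocycle superrigidity, a partial orbit
equivalence becomes the map `x ↦ (ψ x)⁻¹ • K.map (s x • x)`, which on a conull part of the fibre is
equivariant along a homomorphism `r`, and is still piecewise a translate of the given map. -/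
theorem exists_equivariant (K : PartialOrbitEquivalence Γ μ Λ ρ c) [StandardBorelSpace Z]
    (P : ProfiniteSystem.{u, v, w} Γ μ) {Γ₀ : Subgroup Γ} [Γ₀.Normal]
    (hT : HasRelativePropertyT.{u, v} Γ₀) (hfg : Group.FG (Γ ⧸ Γ₀))
    (herg₀ : ErgodicSMul Γ₀ X μ) :
    ∃ (n : ℕ) (a : P.Level n) (r : MulAction.stabilizer Γ a →* Λ) (X₂ : Set X) (s : X → Γ)
      (ψ : X → Λ), μ (P.fib a) ≠ 0 ∧ MeasurableSet X₂ ∧ (∀ (γ : Γ) x, γ • x ∈ X₂ ↔ x ∈ X₂) ∧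
      (∀ᵐ x ∂μ, x ∈ X₂) ∧ (∀ γ, MeasurableSet {x | s x = γ}) ∧ Measurable ψ ∧
      (∀ x ∈ X₂, s x • x ∈ K.dom) ∧
      ∀ x ∈ X₂, x ∈ P.fib a → ∀ g : MulAction.stabilizer Γ a,
        (ψ ((g : Γ) • x))⁻¹ • K.map (s ((g : Γ) • x) • (g : Γ) • x)
          = r g • (ψ x)⁻¹ • K.map (s x • x) := by
  obtain ⟨X₁, s, w, hX₁m, hX₁inv, hX₁ae, hsm, hs, hw⟩ := K.exists_extension Γ₀ herg₀
  obtain ⟨n, a, ha0, ψ, hψ, r, hr⟩ := P.cocycle_superrigidity hT hfg herg₀ w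
  obtain ⟨X₂, hX₂m, hX₂inv, hX₂ae, hX₂⟩ := exists_invariant_conull (Γ := Γ)
    (hX₁ae.and (ae_all_iff.2 hr))
  refine ⟨n, a, r, X₂, s, ψ, ha0, hX₂m, hX₂inv, hX₂ae, hsm, hψ,
    fun x hx => hs x (hX₂ x hx).1, fun x hx hxa g => ?_⟩
  rw [← hw x (hX₂ x hx).1, ← (hX₂ x hx).2 g hxa, MeasCocycle.conj_apply, smul_smul, smul_smul]
  congr 1
  group

/-- A partial orbit equivalence of a profinite action as in cocycle superrigidity with a free
ergodic action scales the measure by an integral multiple of the measure of a fibre. -/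
theorem exists_scale_eq (K : PartialOrbitEquivalence Γ μ Λ ρ c) [StandardBorelSpace X]
    [StandardBorelSpace Z] [IsProbabilityMeasure ρ] (hergZ : ErgodicSMul Λ Z ρ)
    (P : ProfiniteSystem.{u, v, w} Γ μ) {Γ₀ : Subgroup Γ} [Γ₀.Normal]
    (hT : HasRelativePropertyT.{u, v} Γ₀) (hfg : Group.FG (Γ ⧸ Γ₀))
    (herg₀ : ErgodicSMul Γ₀ X μ) {X₀ : Set X} (hX₀ae : ∀ᵐ x ∂μ, x ∈ X₀)
    (hX₀inv : ∀ (γ : Γ) x, γ • x ∈ X₀ ↔ x ∈ X₀)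
    (hfree : ∀ x ∈ X₀, ∀ γ : Γ, γ • x = x → γ = 1)
    (hsep : ∀ x ∈ X₀, ∀ y ∈ X₀, (∀ n, P.proj n x = P.proj n y) → x = y) :
    ∃ (n : ℕ) (a : P.Level n) (m : ℕ), μ (P.fib a) ≠ 0 ∧ 1 ≤ m ∧ c = m * μ (P.fib a) := by
  classical
  obtain ⟨n, a, r, X₂, s, ψ, ha0, hX₂m, hX₂inv, hX₂ae, hsm, hψ, hs, hequi⟩ :=
    K.exists_equivariant P hT hfg herg₀
  obtain ⟨X₃, hX₃m, hX₃inv, hX₃ae, hX₃⟩ := exists_invariant_conull (Γ := Γ)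
    (hX₂ae.and hX₀ae)
  set q : X → Z := fun x => (ψ x)⁻¹ • K.map (s x • x) with hq
  have hqequi : ∀ x ∈ X₃, x ∈ P.fib a → ∀ g : MulAction.stabilizer Γ a,
      q ((g : Γ) • x) = r g • q x := fun x hx hxa g => hequi x (hX₃ x hx).1 hxa g
  have hqfree : ∀ x ∈ X₃, ∀ l : Λ, l • q x = q x → l = 1 := by
    intro x hx l h
    have h1 : (ψ x * l * (ψ x)⁻¹) • K.map (s x • x) = K.map (s x • x) := by
      rw [mul_smul, mul_smul]
      exact smul_eq_iff_eq_inv_smul _ |>.2 h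
    have h2 := K.free _ (hs x (hX₃ x hx).1) _ h1
    rwa [conj_eq_one_iff] at h2
  have hqorb : ∀ x ∈ X₃, ∀ y ∈ X₃, ∀ l : Λ, l • q x = q y → ∃ γ : Γ, γ • x = y := by
    intro x hx y hy l h
    have h1 : (ψ y * l * (ψ x)⁻¹) • K.map (s x • x) = K.map (s y • y) := by
      rw [mul_smul, mul_smul]
      exact smul_eq_iff_eq_inv_smul _ |>.2 h
    obtain ⟨γ, hγ⟩ := (K.orbit_iff _ (hs x (hX₃ x hx).1) _ (hs y (hX₃ y hy).1)).1 ⟨_, h1⟩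
    refine ⟨(s y)⁻¹ * γ * s x, ?_⟩
    rw [mul_smul, mul_smul, hγ, inv_smul_smul]
  -- The pieces on which `q` is a translate of the given map.
  set piece : Γ × Λ → Set X := fun i => {x | s x = i.1} ∩ ψ ⁻¹' {i.2} with hpiece
  have hpm : ∀ i, MeasurableSet (piece i) := fun i =>
    (hsm i.1).inter (hψ (measurableSet_singleton i.2))
  have hpd : Pairwise (Function.onFun Disjoint piece) := by
    intro i j hij
    rw [Function.onFun, Set.disjoint_left]
    rintro x ⟨h1, h2⟩ ⟨h3, h4⟩
    exact hij (Prod.ext ((show s x = i.1 from h1).symm.trans h3)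
      ((show ψ x = i.2 from h2).symm.trans h4))
  have hpq : ∀ i, ∀ x ∈ piece i, q x = i.2⁻¹ • K.map (i.1 • x) := by
    rintro i x ⟨h1, h2⟩
    rw [← show s x = i.1 from h1, ← show ψ x = i.2 from h2]
  have hpdom : ∀ i, ∀ x ∈ piece i, x ∈ X₃ → i.1 • x ∈ K.dom := by
    rintro i x ⟨h1, h2⟩ hx
    rw [← show s x = i.1 from h1]
    exact hs x (hX₃ x hx).1
  have hqm : Measurable q := by
    intro B hB
    have : q ⁻¹' B = ⋃ i, piece i ∩ (fun x => i.2⁻¹ • K.map (i.1 • x)) ⁻¹' B := by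
      ext x
      rw [Set.mem_iUnion]
      constructor
      · exact fun hx => ⟨(s x, ψ x), ⟨rfl, rfl⟩, hx⟩
      · rintro ⟨i, h1, h2⟩
        rw [Set.mem_preimage, hpq i x h1]
        exact h2
    rw [this]
    exact MeasurableSet.iUnion fun i => (hpm i).inter
      (((K.measurable_map.comp (measurable_const_smul i.1)).const_smul i.2⁻¹) hB)
  have hpinj : ∀ i, ∀ x ∈ piece i, ∀ y ∈ piece i, x ∈ X₃ → y ∈ X₃ → q x = q y → x = y := by
    intro i x hxi y hyi hx hy h
    rw [hpq i x hxi, hpq i y hyi, smul_left_cancel_iff] at h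
    exact smul_left_cancel i.1 (K.injOn (hpdom i x hxi hx) (hpdom i y hyi hy) h)
  -- The kernel of `r` is finite, since it moves a piece to disjoint sets of the same measure.
  have hker : Finite r.ker := by
    obtain ⟨i, hi⟩ : ∃ i, μ ((X₃ ∩ P.fib a) ∩ piece i) ≠ 0 := by
      by_contra! hcon
      apply ha0
      have h1 := measure_iUnion_null hcon
      rw [measure_eq_zero_iff_ae_notMem] at h1 ⊢
      filter_upwards [h1, hX₃ae] with x h2 h3 h4
      exact h2 (Set.mem_iUnion.2 ⟨(s x, ψ x), ⟨h3, h4⟩, rfl, rfl⟩)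
    set Q := (X₃ ∩ P.fib a) ∩ piece i with hQ
    have hQm : MeasurableSet Q := (hX₃m.inter (P.measurableSet_fib a)).inter (hpm i)
    have hfin := Measure.finite_const_le_meas_of_disjoint_iUnion (ι := r.ker) μ
      (pos_iff_ne_zero.2 hi) (As := fun k => (((k : MulAction.stabilizer Γ a) : Γ) • ·) ⁻¹' Q)
      (fun k => measurable_const_smul _ hQm) (by
        intro k k' hkk
        rw [Function.onFun, Set.disjoint_left]
        intro x hx hx'
        apply hkk
        have hxX : x ∈ X₃ := (hX₃inv _ x).1 hx.1.1
        have hxa : x ∈ P.fib a :=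
          (P.smul_mem_fib (MulAction.mem_stabilizer_iff.1 k.1.2)).1 hx.1.2
        have e : ∀ k : r.ker, q (((k : MulAction.stabilizer Γ a) : Γ) • x) = q x := by
          intro k
          rw [hqequi x hxX hxa, MonoidHom.mem_ker.1 k.2, one_smul]
        have h1 := hpinj i _ hx.2 _ hx'.2 hx.1.1 hx'.1.1 ((e k).trans (e k').symm)
        have h2 := hfree x (hX₃ x hxX).2 ((k'.1 : Γ)⁻¹ * k.1) (by
          rw [mul_smul]
          rw [show ((k : MulAction.stabilizer Γ a) : Γ) • x = ((k'.1 : Γ)) • x from h1,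
            inv_smul_smul])
        exact Subtype.ext (Subtype.ext (inv_mul_eq_one.1 h2).symm)) (measure_ne_top _ _)
    have huniv : {k : r.ker | μ Q ≤ μ ((((k : MulAction.stabilizer Γ a) : Γ) • ·) ⁻¹' Q)}
        = Set.univ := Set.eq_univ_of_forall fun k =>
      (SMulInvariantMeasure.measure_preimage_smul _ hQm).ge
    rw [huniv] at hfin
    exact Set.finite_univ_iff.1 hfin
  -- Passing to a finer level makes `r` injective.
  have hpos : ∀ᵐ x ∂μ, ∀ k, μ (P.fib (P.proj k x)) ≠ 0 := by
    rw [ae_all_iff]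
    intro k
    obtain ⟨u, hu0, -, hu⟩ := P.exists_measure_fib_eq Γ₀ herg₀ k
    filter_upwards [hu] with x hx
    rwa [hx]
  obtain ⟨x₀, hx₀a, hx₀, hx₀pos⟩ : ∃ x₀ ∈ P.fib a, x₀ ∈ X₃ ∧
      ∀ k, μ (P.fib (P.proj k x₀)) ≠ 0 := by
    by_contra! hcon
    apply ha0
    rw [measure_eq_zero_iff_ae_notMem]
    filter_upwards [hpos, hX₃ae] with x h1 h2 h3
    obtain ⟨k, hk⟩ := hcon x h3 h2
    exact h1 k hk
  have hsepk : ∀ k : r.ker, ∃ j, k ≠ 1 →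
      P.proj j (((k : MulAction.stabilizer Γ a) : Γ) • x₀) ≠ P.proj j x₀ := by
    intro k
    by_cases hk : k = 1
    · exact ⟨0, fun h => absurd hk h⟩
    by_contra! hcon
    have h1 := hsep _ ((hX₀inv k.1 x₀).2 (hX₃ x₀ hx₀).2) x₀ (hX₃ x₀ hx₀).2
      (fun j => (hcon j).2)
    exact hk (Subtype.ext (Subtype.ext (hfree x₀ (hX₃ x₀ hx₀).2 _ h1)))
  choose j hj using hsepk
  have : Fintype r.ker := Fintype.ofFinite _
  set n' := max n (Finset.univ.sup j) with hn'
  set b := P.proj n' x₀ with hb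
  have hba : P.fib b ⊆ P.fib a := fun x hx =>
    Eq.trans (P.nested_le (le_max_left _ _) hx) hx₀a
  have hstab : MulAction.stabilizer Γ b ≤ MulAction.stabilizer Γ a := by
    have := P.stabilizer_le (le_max_left n (Finset.univ.sup j)) x₀
    rwa [P.mem_fib.1 hx₀a] at this
  have hrinj : ∀ g (hg : g ∈ MulAction.stabilizer Γ b), r ⟨g, hstab hg⟩ = 1 → g = 1 := by
    intro g hg h
    by_contra hne
    have h1 := hj ⟨⟨g, hstab hg⟩, h⟩ (fun e => hne (congrArg (fun k : r.ker => (k.1 : Γ)) e))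
    apply h1
    apply P.nested_le ((Finset.le_sup (Finset.mem_univ _)).trans (le_max_right n _))
    rw [P.proj_smul]
    exact MulAction.mem_stabilizer_iff.1 hg
  -- On `V` the map `q` is injective, and its image meets each of its translates by `Λ` in itself or
  -- in the empty set.
  set V := X₃ ∩ P.fib b with hV
  have hVm : MeasurableSet V := hX₃m.inter (P.measurableSet_fib b)
  have hVorb : ∀ x ∈ V, ∀ y ∈ V, ∀ l : Λ, l • q x = q y →
      ∃ (g : Γ) (hg : g ∈ MulAction.stabilizer Γ b), g • x = y ∧ l = r ⟨g, hstab hg⟩ := by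
    rintro x ⟨hx, hxb⟩ y ⟨hy, hyb⟩ l h
    obtain ⟨g, hg⟩ := hqorb x hx y hy l h
    have hgs : g ∈ MulAction.stabilizer Γ b := by
      rw [MulAction.mem_stabilizer_iff]
      have := P.proj_smul n' g x
      rw [hg, P.mem_fib.1 hxb, P.mem_fib.1 hyb] at this
      exact this.symm
    refine ⟨g, hgs, hg, ?_⟩
    have h1 := hqequi x hx (hba hxb) ⟨g, hstab hgs⟩
    have h2 : q y = r ⟨g, hstab hgs⟩ • q x := by rw [← h1, ← hg]
    rw [h2] at h
    have h3 := hqfree x hx ((r ⟨g, hstab hgs⟩)⁻¹ * l) (by rw [mul_smul, h, inv_smul_smul])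
    exact (inv_mul_eq_one.1 h3).symm
  have hqinj : Set.InjOn q V := by
    intro x hx y hy h
    obtain ⟨g, hg, e, h1⟩ := hVorb x hx y hy 1 (by rw [one_smul, h])
    rw [← e, hrinj g hg h1.symm, one_smul]
  have hqV : MeasurableSet (q '' V) := hVm.image_of_measurable_injOn hqm hqinj
  have hscale : μ V = c * ρ (q '' V) := by
    have h1 : V = ⋃ i, V ∩ piece i := by
      ext x
      rw [Set.mem_iUnion]
      exact ⟨fun hx => ⟨(s x, ψ x), hx, rfl, rfl⟩, fun ⟨_, hx, _⟩ => hx⟩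
    have hVi : ∀ i, MeasurableSet (V ∩ piece i) := fun i => hVm.inter (hpm i)
    have hdisj : Pairwise (Function.onFun Disjoint fun i => V ∩ piece i) := fun i j hij =>
      (hpd hij).mono Set.inter_subset_right Set.inter_subset_right
    have h2 : q '' V = ⋃ i, q '' (V ∩ piece i) := by
      rw [← Set.image_iUnion, ← h1]
    have h3 : ∀ i, μ (V ∩ piece i) = c * ρ (q '' (V ∩ piece i)) := by
      intro i
      set A := (i.1⁻¹ • ·) ⁻¹' (V ∩ piece i) with hA
      have hAm : MeasurableSet A := measurable_const_smul _ (hVi i)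
      have hAdom : A ⊆ K.dom := by
        intro y hy
        have := hpdom i _ hy.2 hy.1.1
        simpa using this
      have e1 : μ (V ∩ piece i) = μ A :=
        (SMulInvariantMeasure.measure_preimage_smul i.1⁻¹ (hVi i)).symm
      have e2 : K.map '' A = (i.2⁻¹ • ·) ⁻¹' (q '' (V ∩ piece i)) := by
        ext z
        constructor
        · rintro ⟨y, hy, rfl⟩
          refine ⟨i.1⁻¹ • y, hy, ?_⟩
          rw [hpq i _ hy.2, smul_inv_smul]
        · rintro ⟨x, hx, e⟩
          refine ⟨i.1 • x, by simpa [hA] using hx, ?_⟩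
          rw [hpq i x hx.2] at e
          exact smul_left_cancel _ e
      have hmeas : MeasurableSet (q '' (V ∩ piece i)) :=
        (hVi i).image_of_measurable_injOn hqm (hqinj.mono Set.inter_subset_left)
      rw [e1, K.measure_eq A hAdom hAm, e2, hergZ.measure_preimage_smul _ hmeas]
    rw [h2, measure_iUnion _ fun i => (hVi i).image_of_measurable_injOn hqm
      (hqinj.mono Set.inter_subset_left), ← ENNReal.tsum_mul_left]
    · rw [h1, measure_iUnion hdisj hVi]
      refine tsum_congr fun i => ?_
      rw [← h1, h3 i]
    · intro i k hik
      rw [Function.onFun, Set.disjoint_left]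
      rintro _ ⟨x, hx, rfl⟩ ⟨y, hy, e⟩
      have := hqinj hy.1 hx.1 e
      rw [this] at hy
      exact Set.disjoint_left.1 (hpd hik) hx.2 hy.2
  have hVfib : μ V = μ (P.fib b) := by
    apply measure_congr
    filter_upwards [hX₃ae] with x hx
    exact propext ⟨fun h => h.2, fun h => ⟨hx, h⟩⟩
  have hb0 : μ (P.fib b) ≠ 0 := hx₀pos n'
  have hρ0 : ρ (q '' V) ≠ 0 := by
    intro h
    rw [h, mul_zero] at hscale
    exact hb0 (hVfib.symm.trans hscale)
  obtain ⟨m, hm1, hm⟩ := exists_nat_mul_measure_eq_one ρ hergZ hqV hρ0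
    (r.comp (Subgroup.inclusion hstab)).range (by
      rintro _ ⟨g, rfl⟩ _ ⟨x, hx, rfl⟩
      refine ⟨(g : Γ) • x, ⟨(hX₃inv _ x).2 hx.1,
        (P.smul_mem_fib (MulAction.mem_stabilizer_iff.1 g.2)).2 hx.2⟩, ?_⟩
      exact hqequi x hx.1 (hba hx.2) ⟨g, hstab g.2⟩) (by
      rintro l _ ⟨x, hx, rfl⟩ ⟨y, hy, e⟩
      obtain ⟨g, hg, -, h⟩ := hVorb x hx y hy l e.symm
      exact ⟨⟨g, hg⟩, h.symm⟩)
  refine ⟨n', b, m, hb0, hm1, ?_⟩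
  rw [← hVfib, hscale, mul_left_comm, hm, mul_one]

end PartialOrbitEquivalence

/-! ### Amplifications induced by free actions -/

section Amplification

open scoped ENNReal
open Filter

theorem IsEssentiallyFree.ae_forall {Γ : Type*} [Group Γ] [Countable Γ] {X : Type*}
    [MeasurableSpace X] [MulAction Γ X] {μ : Measure X} (h : IsEssentiallyFree Γ μ) :
    ∀ᵐ x ∂μ, ∀ γ : Γ, γ • x = x → γ = 1 := by
  rw [ae_all_iff]
  intro γ
  by_cases hγ : γ = 1
  · exact Eventually.of_forall fun _ _ => hγ
  · filter_upwards [measure_eq_zero_iff_ae_notMem.1 (h γ hγ)] with x hx hx'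
    exact absurd hx' hx

variable {X : Type v} [MeasurableSpace X] {μ : Measure X}

theorem amplifiedMeasure_apply {t : ℝ} {Y : Set (X × ℕ)} (hY : MeasurableSet Y)
    (E : Set Y) : amplifiedMeasure μ t Y E
      = (ENNReal.ofReal t)⁻¹ * (μ.prod Measure.count) (Subtype.val '' E) := by
  rw [amplifiedMeasure, Measure.smul_apply, (MeasurableEmbedding.subtype_coe hY).comap_apply,
    smul_eq_mul]

theorem ae_of_ae_amplifiedMeasure [SFinite μ] {t : ℝ} {Y : Set (X × ℕ)} (hY : MeasurableSet Y)
    {p : Y → Prop} (hp : ∀ᵐ y ∂amplifiedMeasure μ t Y, p y) :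
    ∀ᵐ x ∂μ, ∀ (i : ℕ) (h : (x, i) ∈ Y), p ⟨(x, i), h⟩ := by
  have h0 : (μ.prod Measure.count) (Subtype.val '' {y : Y | ¬ p y}) = 0 := by
    have := ae_iff.1 hp
    rw [amplifiedMeasure_apply hY, mul_eq_zero] at this
    exact this.resolve_left (by simp)
  have h1 := Measure.ae_ae_of_ae_prod (measure_eq_zero_iff_ae_notMem.1 h0)
  filter_upwards [h1] with x hx i h
  by_contra hcon
  exact Measure.ae_count_iff.1 hx i ⟨⟨(x, i), h⟩, hcon, rfl⟩

/-- If an amplification of the orbit equivalence relation of `Γ` by `t` is induced by a free action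
of `Λ`, then a slice of it of positive measure gives a partial orbit equivalence with scaling
constant `t`. -/
theorem exists_partialOrbitEquivalence {Γ : Type u} [Group Γ] [Countable Γ] [StandardBorelSpace X]
    [MulAction Γ X] [MeasurableConstSMul Γ X] [SFinite μ] [SMulInvariantMeasure Γ X μ] {t : ℝ}
    (ht : 0 < t) {Y : Set (X × ℕ)} (hY : MeasurableSet Y)
    (hYt : (μ.prod Measure.count) Y = ENNReal.ofReal t)
    {Λ : Type} [Group Λ] [Countable Λ] {Z : Type} [MeasurableSpace Z] [StandardBorelSpace Z]
    {ρ : Measure Z} [IsProbabilityMeasure ρ] [MulAction Λ Z] (hfree : IsEssentiallyFree Λ ρ)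
    (hOE : AreOrbitEquivalent (amplifiedMeasure μ t Y) (amplifiedRel (MulAction.orbitRel Γ X) Y)
      ρ (MulAction.orbitRel Λ Z)) :
    Nonempty (PartialOrbitEquivalence Γ μ Λ ρ (ENNReal.ofReal t)) := by
  classical
  obtain ⟨θ, ⟨hθ, η, hη, hηθ, -⟩, hbij⟩ := hOE
  have : StandardBorelSpace Y := hY.standardBorel
  have hgood := ae_of_ae_amplifiedMeasure hY
    (hηθ.and (hbij.and (hθ.quasiMeasurePreserving.ae hfree.ae_forall)))
  obtain ⟨X₁, hX₁m, hX₁inv, hX₁ae, hX₁⟩ := exists_invariant_conull (Γ := Γ) hgood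
  obtain ⟨i, hi⟩ : ∃ i : ℕ, μ {x | (x, i) ∈ Y} ≠ 0 := by
    by_contra! hcon
    rw [Measure.prod_apply_symm hY, lintegral_count] at hYt
    have h0 : ∀ i : ℕ, μ ((fun x => (x, i)) ⁻¹' Y) = 0 := hcon
    simp only [h0, tsum_zero] at hYt
    exact (ENNReal.ofReal_pos.2 ht).ne hYt
  have hslice : MeasurableSet {x | (x, i) ∈ Y} :=
    (measurable_id.prodMk measurable_const : Measurable fun x : X => (x, i)) hY
  obtain ⟨z₀⟩ : Nonempty Z := nonempty_of_isProbabilityMeasure ρ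
  set f : X → Z := fun x => if h : x ∈ {x | (x, i) ∈ Y} then θ ⟨(x, i), h⟩ else z₀ with hf
  have hfY : ∀ x (h : (x, i) ∈ Y), f x = θ ⟨(x, i), h⟩ := fun x h => dif_pos h
  have hfm : Measurable f := by
    refine Measurable.dite (s := {x | (x, i) ∈ Y})
      (f := fun x : {x | (x, i) ∈ Y} => θ ⟨(x.1, i), x.2⟩) ?_ measurable_const hslice
    exact hθ.measurable.comp
      ((measurable_subtype_coe.prodMk measurable_const).subtype_mk)
  have hinj : ∀ y y' : Y, y.1.1 ∈ X₁ → y'.1.1 ∈ X₁ → θ y = θ y' → y = y' := by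
    intro y y' h h' e
    have e1 : η (θ y) = y := (hX₁ _ h y.1.2 y.2).1
    have e2 : η (θ y') = y' := (hX₁ _ h' y'.1.2 y'.2).1
    rw [← e1, ← e2, e]
  refine ⟨⟨{x | (x, i) ∈ Y} ∩ X₁, hslice.inter hX₁m, ?_, f, hfm, ?_, ?_, ?_, ?_⟩⟩
  · intro h0
    apply hi
    rw [measure_eq_zero_iff_ae_notMem] at h0 ⊢
    filter_upwards [h0, hX₁ae] with x h1 h2 h3 using h1 ⟨h3, h2⟩
  · rintro x ⟨hxY, hx⟩ y ⟨hyY, hy⟩ e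
    rw [hfY x hxY, hfY y hyY] at e
    exact congrArg (fun y : Y => y.1.1) (hinj _ _ hx hy e)
  · rintro x ⟨hxY, hx⟩ l e
    rw [hfY x hxY] at e
    exact (hX₁ x hx i hxY).2.2 l e
  · rintro x ⟨hxY, hx⟩ y ⟨hyY, hy⟩
    rw [hfY x hxY, hfY y hyY]
    have hb := (hX₁ x hx i hxY).2.1
    constructor
    · rintro ⟨l, hl⟩
      have h1 : θ ⟨(y, i), hyY⟩ ∈ {z | MulAction.orbitRel Λ Z (θ ⟨(x, i), hxY⟩) z} := by
        refine MulAction.orbitRel_apply.2 ⟨l⁻¹, ?_⟩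
        change l⁻¹ • θ ⟨(y, i), hyY⟩ = _
        rw [← hl, inv_smul_smul]
      obtain ⟨y', hy', e⟩ := hb.surjOn h1
      obtain ⟨γ, hγ⟩ : ∃ γ : Γ, γ • y'.1.1 = x := MulAction.orbitRel_apply.1 hy'
      have hy'X : y'.1.1 ∈ X₁ := (hX₁inv γ _).1 (by rw [hγ]; exact hx)
      have e2 := hinj _ _ hy'X hy e
      rw [e2] at hγ
      exact ⟨γ⁻¹, by rw [← hγ, inv_smul_smul]⟩
    · rintro ⟨γ, hγ⟩
      have h1 : (⟨(y, i), hyY⟩ : Y) ∈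
          {y' | amplifiedRel (MulAction.orbitRel Γ X) Y ⟨(x, i), hxY⟩ y'} := by
        refine MulAction.orbitRel_apply.2 ⟨γ⁻¹, ?_⟩
        change γ⁻¹ • y = x
        rw [← hγ, inv_smul_smul]
      obtain ⟨l, hl⟩ : ∃ l : Λ, l • θ ⟨(y, i), hyY⟩ = θ ⟨(x, i), hxY⟩ :=
        MulAction.orbitRel_apply.1 (hb.mapsTo h1)
      exact ⟨l⁻¹, by rw [← hl, inv_smul_smul]⟩
  · intro A hA hAm
    set A' : Set Y := {y | y.1.2 = i ∧ y.1.1 ∈ A} with hA'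
    have hA'm : MeasurableSet A' :=
      ((measurable_snd.comp measurable_subtype_coe) (measurableSet_singleton i)).inter
        ((measurable_fst.comp measurable_subtype_coe) hAm)
    have hA'inj : Set.InjOn θ A' := fun y hy y' hy' e =>
      hinj y y' (hA hy.2).2 (hA hy'.2).2 e
    have himg : f '' A = θ '' A' := by
      ext z
      constructor
      · rintro ⟨x, hx, rfl⟩
        exact ⟨⟨(x, i), (hA hx).1⟩, ⟨rfl, hx⟩, (hfY x (hA hx).1).symm⟩
      · rintro ⟨⟨⟨x, k⟩, hy⟩, ⟨hk, hx⟩, rfl⟩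
        have hk' : k = i := hk
        subst hk'
        exact ⟨x, hx, hfY x hy⟩
    have himgm : MeasurableSet (θ '' A') := hA'm.image_of_measurable_injOn hθ.measurable hA'inj
    have hval : Subtype.val '' A' = A ×ˢ ({i} : Set ℕ) := by
      refine Set.Subset.antisymm ?_ ?_
      · rintro _ ⟨y, ⟨h1, h2⟩, rfl⟩
        exact ⟨h2, h1⟩
      · rintro ⟨x, k⟩ ⟨h1, h2⟩
        have h2' : k = i := h2
        subst h2'
        exact ⟨⟨(x, k), (hA h1).1⟩, ⟨rfl, h1⟩, rfl⟩
    have hpre : amplifiedMeasure μ t Y (θ ⁻¹' (θ '' A')) = amplifiedMeasure μ t Y A' := by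
      apply measure_congr
      filter_upwards [hηθ] with y hy
      refine propext ⟨?_, fun h => ⟨y, h, rfl⟩⟩
      rintro ⟨y', hy', e⟩
      have e1 : η (θ y') = y' := (hX₁ _ (hA hy'.2).2 y'.1.2 y'.2).1
      rw [e, hy] at e1
      rwa [← e1] at hy'
    rw [himg, ← hθ.measure_preimage himgm.nullMeasurableSet, hpre, amplifiedMeasure_apply hY, hval,
      Measure.prod_prod, Measure.count_singleton, mul_one, ← mul_assoc,
      ENNReal.mul_inv_cancel (ENNReal.ofReal_pos.2 ht).ne' ENNReal.ofReal_ne_top, one_mul]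

end Amplification

/-! ### Amplifications of fibres -/

section Shrink

open scoped ENNReal
open Filter

/-- The orbit equivalence relation of a free ergodic action is induced by an action of the kind that
`IsInducedByFreeErgodicAction` asks for, whatever the universes of the group and of the space. -/
theorem isInducedByFreeErgodicAction_orbitRel {G : Type*} [Group G] [Countable G]
    {Y : Type*} [MeasurableSpace Y] [StandardBorelSpace Y] (ν : Measure Y)
    [IsProbabilityMeasure ν] [MulAction G Y] [MeasurableConstSMul G Y] (herg : ErgodicSMul G Y ν)
    (hfree : IsEssentiallyFree G ν) : IsInducedByFreeErgodicAction ν (MulAction.orbitRel G Y) := by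
  obtain ⟨Z, hZ, ⟨ε⟩⟩ : ∃ Z : Set ℝ, MeasurableSet Z ∧ Nonempty (Y ≃ᵐ Z) :=
    have ⟨_, he⟩ := exists_measurableEmbedding_real Y
    ⟨_, he.measurableSet_range, ⟨he.equivRange⟩⟩
  have hst : StandardBorelSpace Z := hZ.standardBorel
  obtain ⟨sh⟩ : Nonempty (Shrink.{0} G ≃* G) := ⟨Shrink.mulEquiv⟩
  let act : MulAction (Shrink.{0} G) Z :=
    { smul := fun l z => ε (sh l • ε.symm z)
      one_smul := fun z => by
        change ε (sh 1 • ε.symm z) = z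
        simp
      mul_smul := fun l k z => by
        change ε (sh (l * k) • ε.symm z) = ε (sh l • ε.symm (ε (sh k • ε.symm z)))
        simp [mul_smul] }
  have hsmul : ∀ (l : Shrink.{0} G) (z : Z), l • z = ε (sh l • ε.symm z) :=
    fun _ _ => rfl
  have hmp : MeasurePreserving ε ν (ν.map ε) := ε.measurable.measurePreserving ν
  have hmp' : MeasurePreserving ε.symm (ν.map ε) ν := hmp.symm ε
  have hprob : IsProbabilityMeasure (ν.map ε) :=
    Measure.isProbabilityMeasure_map ε.measurable.aemeasurable
  have hmeas : MeasurableConstSMul (Shrink.{0} G) Z :=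
    ⟨fun l => ε.measurable.comp ((measurable_const_smul (sh l)).comp ε.symm.measurable)⟩
  have hcount : Countable (Shrink.{0} G) := sh.injective.countable
  have horb : ∀ z z', MulAction.orbitRel (Shrink.{0} G) Z z z' ↔
      ∃ l : Shrink.{0} G, ε (sh l • ε.symm z') = z := fun _ _ => Iff.rfl
  have horb' : ∀ y y', MulAction.orbitRel G Y y y' ↔ ∃ g : G, g • y' = y := fun _ _ => Iff.rfl
  refine ⟨Shrink.{0} G, inferInstance, hcount, Z, inferInstance, hst, ν.map ε,
    hprob, act, hmeas, ?_, ?_, ε, ⟨hmp, ε.symm, hmp', ?_, ?_⟩, ?_⟩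
  · refine { measure_preimage_smul := fun l s hs => ?_
             aeconst_of_forall_preimage_smul_ae_eq := fun {s} hs hinv => ?_ }
    · rw [ε.map_apply, ε.map_apply]
      have : ε ⁻¹' ((l • ·) ⁻¹' s) = (sh l • ·) ⁻¹' (ε ⁻¹' s) := by
        ext y
        change ε (sh l • ε.symm (ε y)) ∈ s ↔ ε (sh l • y) ∈ s
        rw [ε.symm_apply_apply]
      rw [this]
      exact herg.measure_preimage_smul _ (ε.measurable hs)
    · have h := herg.aeconst_of_forall_preimage_smul_ae_eq (ε.measurable hs) (fun g => by
        filter_upwards [hmp.quasiMeasurePreserving.ae (hinv (sh.symm g))] with y hy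
        have h1 : (sh.symm g • ε y ∈ s) = (ε y ∈ s) := hy
        rw [hsmul, ε.symm_apply_apply, MulEquiv.apply_symm_apply] at h1
        exact h1)
      rw [eventuallyConst_set] at h ⊢
      refine h.imp (fun h => ?_) (fun h => ?_)
      · filter_upwards [hmp'.quasiMeasurePreserving.ae h] with z hz
        have h1 : ε (ε.symm z) ∈ s := hz
        rwa [ε.apply_symm_apply] at h1
      · filter_upwards [hmp'.quasiMeasurePreserving.ae h] with z hz
        have h1 : ε (ε.symm z) ∉ s := hz
        rwa [ε.apply_symm_apply] at h1
  · intro l hl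
    have hl' : sh l ≠ 1 := fun h => hl (sh.map_eq_one_iff.1 h)
    rw [ε.map_apply, ← hfree (sh l) hl']
    congr 1
    ext y
    change ε (sh l • ε.symm (ε y)) = ε y ↔ sh l • y = y
    rw [ε.symm_apply_apply, ε.injective.eq_iff]
  · exact Eventually.of_forall ε.symm_apply_apply
  · exact Eventually.of_forall ε.apply_symm_apply
  · refine Eventually.of_forall fun y => ⟨?_, ε.injective.injOn, ?_⟩
    · intro y' h
      obtain ⟨g, hg⟩ := (horb' y y').1 h
      refine (horb (ε y) (ε y')).2 ⟨sh.symm g, ?_⟩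
      rw [ε.symm_apply_apply, MulEquiv.apply_symm_apply, hg]
    · intro z h
      obtain ⟨l, hl⟩ := (horb (ε y) z).1 h
      exact ⟨ε.symm z, (horb' y (ε.symm z)).2 ⟨sh l, ε.injective hl⟩, ε.apply_symm_apply z⟩

end Shrink

/-! ### Amplifications of an invariant set -/

section CyclicAmplification

open scoped ENNReal ProbabilityTheory
open Filter

variable {Γ : Type u} [Group Γ] {X : Type v} [MulAction Γ X] {S : Subgroup Γ} {F : Set X} {m : ℕ}
  [NeZero m]

/-- If the subgroup `S` leaves `F` invariant, then `S × ℤ/m` acts on `F × {0, …, m - 1}` by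
`(g, c) • (x, i) = (g • x, c + i)`. -/
@[reducible]
def cyclicAmplification (m : ℕ) [NeZero m] (hF : ∀ g ∈ S, ∀ x, g • x ∈ F ↔ x ∈ F) :
    MulAction (S × Multiplicative (ZMod m)) ↥(F ×ˢ Set.Iio m) where
  smul p y := ⟨((p.1 : Γ) • y.1.1, (p.2.toAdd + (y.1.2 : ZMod m)).val),
    (hF p.1 p.1.2 _).2 y.2.1, ZMod.val_lt _⟩
  one_smul y := Subtype.ext (Prod.ext (one_smul Γ _) (by
    change ((0 : ZMod m) + (y.1.2 : ZMod m)).val = y.1.2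
    rw [zero_add, ZMod.val_natCast_of_lt y.2.2]))
  mul_smul p p' y := Subtype.ext (Prod.ext (mul_smul (p.1 : Γ) p'.1 _) (by
    change ((p.2.toAdd + p'.2.toAdd) + (y.1.2 : ZMod m)).val
      = (p.2.toAdd + (((p'.2.toAdd + (y.1.2 : ZMod m)).val : ℕ) : ZMod m)).val
    rw [ZMod.natCast_zmod_val, add_assoc]))

variable [MeasurableSpace X] {μ : Measure X}

theorem ae_amplifiedMeasure_of_ae [SFinite μ] {t : ℝ} {Y : Set (X × ℕ)} (hY : MeasurableSet Y)
    {p : X → Prop} (hp : ∀ᵐ x ∂μ, p x) : ∀ᵐ y ∂amplifiedMeasure μ t Y, p y.1.1 := by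
  rw [ae_iff, amplifiedMeasure_apply hY]
  refine mul_eq_zero_of_right _ (measure_mono_null (t := {x | ¬ p x} ×ˢ Set.univ) ?_ ?_)
  · rintro _ ⟨y, hy, rfl⟩
    exact ⟨hy, trivial⟩
  · rw [Measure.prod_prod, ae_iff.1 hp, zero_mul]

/-- The measure of a subset of `F × {0, …, m - 1}` is the sum of the measures of its slices, which
are indexed here by `ℤ/m`. -/
theorem amplifiedMeasure_eq_tsum [SFinite μ] {t : ℝ} (hF : MeasurableSet F)
    {E : Set ↥(F ×ˢ Set.Iio m)} (hE : MeasurableSet E) :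
    amplifiedMeasure μ t (F ×ˢ Set.Iio m) E = (ENNReal.ofReal t)⁻¹ *
      ∑' k : ZMod m, μ {x | ∃ h : x ∈ F, (⟨(x, k.val), h, k.val_lt⟩ : ↥(F ×ˢ Set.Iio m)) ∈ E} := by
  have hY : MeasurableSet (F ×ˢ Set.Iio m : Set (X × ℕ)) := hF.prod (.of_discrete)
  rw [amplifiedMeasure_apply hY,
    Measure.prod_apply_symm (hY.subtype_image hE), lintegral_count,
    ← (ZMod.val_injective m).tsum_eq]
  · congr 2
    ext k
    congr 1
    ext x
    constructor
    · rintro ⟨y, hy, e⟩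
      have e' : y.1 = (x, k.val) := e
      have hy' : y = ⟨(x, k.val), e' ▸ y.2⟩ := Subtype.ext e
      exact ⟨(e' ▸ y.2 : (x, k.val) ∈ F ×ˢ Set.Iio m).1, hy' ▸ hy⟩
    · rintro ⟨h, hx⟩
      exact ⟨_, hx, rfl⟩
  · intro i hi
    by_contra hcon
    refine hi (measure_mono_null (t := ∅) ?_ measure_empty)
    rintro x ⟨y, hy, e⟩
    have e2 : y.1.2 = i := congrArg Prod.snd e
    exact hcon ⟨(i : ZMod m), ZMod.val_natCast_of_lt (e2 ▸ y.2.2)⟩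

/-- Let the restriction of the orbit equivalence relation of `Γ` to `F` be the orbit equivalence
relation of a free ergodic action of a subgroup `S`. Then the amplification of the relation to
`F × {0, …, m - 1}` is induced by the free ergodic action of `S × ℤ/m`. -/
theorem isInducedByFreeErgodicAction_prod [Countable Γ] [StandardBorelSpace X]
    [MeasurableConstSMul Γ X] [IsFiniteMeasure μ] [SMulInvariantMeasure Γ X μ]
    (hF : MeasurableSet F) (hF0 : μ F ≠ 0) (hSF : ∀ g ∈ S, ∀ x, g • x ∈ F ↔ x ∈ F)
    (hS : ∀ (γ : Γ), ∀ x ∈ F, γ • x ∈ F → γ ∈ S) (hfree : ∀ x ∈ F, ∀ γ : Γ, γ • x = x → γ = 1)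
    (herg : ErgodicSMul S X (μ[|F])) {t : ℝ} (ht : ENNReal.ofReal t = m * μ F) :
    IsInducedByFreeErgodicAction (amplifiedMeasure μ t (F ×ˢ Set.Iio m))
      (amplifiedRel (MulAction.orbitRel Γ X) (F ×ˢ Set.Iio m)) := by
  have hY : MeasurableSet (F ×ˢ Set.Iio m : Set (X × ℕ)) := hF.prod (.of_discrete)
  have hstd : StandardBorelSpace ↥(F ×ˢ Set.Iio m : Set (X × ℕ)) := hY.standardBorel
  have hm0 : (m : ℝ≥0∞) ≠ 0 := Nat.cast_ne_zero.2 (NeZero.ne m)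
  have hprob : IsProbabilityMeasure (amplifiedMeasure μ t (F ×ˢ Set.Iio m)) := by
    refine ⟨?_⟩
    rw [amplifiedMeasure_eq_tsum hF MeasurableSet.univ]
    simp only [Set.mem_univ, exists_prop, and_true, Set.ofPred_mem_eq]
    rw [tsum_fintype, Finset.sum_const, Finset.card_univ, ZMod.card, nsmul_eq_mul, ht]
    exact ENNReal.inv_mul_cancel (mul_ne_zero hm0 hF0)
      (ENNReal.mul_ne_top (ENNReal.natCast_ne_top m) (measure_ne_top μ F))
  let act := cyclicAmplification m hSF
  have hsmul : ∀ (p : S × Multiplicative (ZMod m)) (y : ↥(F ×ˢ Set.Iio m)),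
      (p • y).1 = ((p.1 : Γ) • y.1.1, (p.2.toAdd + (y.1.2 : ZMod m)).val) := fun _ _ => rfl
  have hmeas : MeasurableConstSMul (S × Multiplicative (ZMod m)) ↥(F ×ˢ Set.Iio m) := by
    refine ⟨fun p => Measurable.subtype_mk (Measurable.prodMk ?_ ?_)⟩
    · exact (measurable_const_smul (p.1 : Γ)).comp (measurable_fst.comp measurable_subtype_coe)
    · exact (measurable_from_nat (f := fun i : ℕ => (p.2.toAdd + (i : ZMod m)).val)).comp
        (measurable_snd.comp measurable_subtype_coe)
  have hrel : amplifiedRel (MulAction.orbitRel Γ X) (F ×ˢ Set.Iio m)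
      = MulAction.orbitRel (S × Multiplicative (ZMod m)) ↥(F ×ˢ Set.Iio m) := by
    refine Setoid.ext fun y y' => ⟨?_, ?_⟩
    · rintro ⟨γ, hγ⟩
      have hγ' : γ • y'.1.1 = y.1.1 := hγ
      refine ⟨(⟨γ, hS γ _ y'.2.1 (by rw [hγ']; exact y.2.1)⟩,
        Multiplicative.ofAdd ((y.1.2 : ZMod m) - (y'.1.2 : ZMod m))), ?_⟩
      refine Subtype.ext ((hsmul _ _).trans (Prod.ext hγ' ?_))
      change ((y.1.2 : ZMod m) - (y'.1.2 : ZMod m) + (y'.1.2 : ZMod m)).val = y.1.2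
      rw [sub_add_cancel, ZMod.val_natCast_of_lt y.2.2]
    · rintro ⟨p, hp⟩
      exact ⟨p.1, congrArg (fun y : ↥(F ×ˢ Set.Iio m) => y.1.1) hp⟩
  rw [hrel]
  refine isInducedByFreeErgodicAction_orbitRel _ ?_ ?_
  · refine { measure_preimage_smul := fun p E hE => ?_
             aeconst_of_forall_preimage_smul_ae_eq := fun {E} hE hinv => ?_ }
    · rw [amplifiedMeasure_eq_tsum hF hE,
        amplifiedMeasure_eq_tsum hF ((measurable_const_smul p) hE)]
      congr 1
      symm
      rw [← (Equiv.addLeft p.2.toAdd).tsum_eq]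
      congr 1
      ext k
      refine (measure_preimage_smul (μ := μ) (p.1 : Γ) _).symm.trans ?_
      congr 1
      ext x
      have key : ∀ (h : x ∈ F) (h' : (p.1 : Γ) • x ∈ F),
          p • (⟨(x, k.val), h, k.val_lt⟩ : ↥(F ×ˢ Set.Iio m))
            = ⟨((p.1 : Γ) • x, (p.2.toAdd + k).val), h', ZMod.val_lt _⟩ := by
        intro h h'
        refine Subtype.ext ((hsmul _ _).trans (Prod.ext rfl ?_))
        change (p.2.toAdd + ((k.val : ℕ) : ZMod m)).val = _
        rw [ZMod.natCast_zmod_val]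
      constructor
      · rintro ⟨h', hx⟩
        have h := (hSF p.1 p.1.2 x).1 h'
        refine ⟨h, ?_⟩
        change p • (⟨(x, k.val), h, k.val_lt⟩ : ↥(F ×ˢ Set.Iio m)) ∈ E
        rw [key h h']
        exact hx
      · rintro ⟨h, hx⟩
        have h' : (p.1 : Γ) • x ∈ F := (hSF p.1 p.1.2 x).2 h
        refine ⟨h', ?_⟩
        change p • (⟨(x, k.val), h, k.val_lt⟩ : ↥(F ×ˢ Set.Iio m)) ∈ E at hx
        rw [key h h'] at hx
        exact hx
    · have hinv' := ae_of_ae_amplifiedMeasure hY (ae_all_iff.2 hinv)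
      have h0 : (0 : ℕ) ∈ Set.Iio m := NeZero.pos m
      -- The slice over `0` is invariant under `S`, and `ℤ/m` carries every slice to it.
      set A : Set X := {x | ∃ h : x ∈ F, (⟨(x, 0), h, h0⟩ : ↥(F ×ˢ Set.Iio m)) ∈ E} with hA
      have hAm : MeasurableSet A := by
        have : A = (fun x => (x, 0)) ⁻¹' (Subtype.val '' E) := by
          ext x
          constructor
          · rintro ⟨h, hx⟩
            exact ⟨_, hx, rfl⟩
          · rintro ⟨y, hy, e⟩
            have e' : y.1 = (x, 0) := e
            have hy' : y = ⟨(x, 0), e' ▸ y.2⟩ := Subtype.ext e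
            exact ⟨(e' ▸ y.2 : (x, 0) ∈ F ×ˢ Set.Iio m).1, hy' ▸ hy⟩
        rw [this]
        exact (measurable_id.prodMk measurable_const) (hY.subtype_image hE)
      have hAinv : ∀ g : S, ((g • ·) ⁻¹' A : Set X) =ᵐ[μ[|F]] A := by
        intro g
        refine (ProfiniteSystem.ae_iff_cond hF).2 ?_
        filter_upwards [hinv'] with x hx hxF
        have h1 : ((g, (1 : Multiplicative (ZMod m))) •
            (⟨(x, 0), hxF, h0⟩ : ↥(F ×ˢ Set.Iio m)) ∈ E)
            = ((⟨(x, 0), hxF, h0⟩ : ↥(F ×ˢ Set.Iio m)) ∈ E) := hx 0 ⟨hxF, h0⟩ _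
        have hg : (g : Γ) • x ∈ F := (hSF g g.2 x).2 hxF
        have key : (g, (1 : Multiplicative (ZMod m))) •
            (⟨(x, 0), hxF, h0⟩ : ↥(F ×ˢ Set.Iio m)) = ⟨((g : Γ) • x, 0), hg, h0⟩ := by
          refine Subtype.ext ((hsmul _ _).trans (Prod.ext rfl ?_))
          simp
        rw [key] at h1
        exact propext ⟨fun ⟨_, h⟩ => ⟨hxF, h1 ▸ h⟩, fun ⟨_, h⟩ => ⟨hg, h1.symm ▸ h⟩⟩
      have hEA : ∀ᵐ x ∂μ, ∀ (i : ℕ) (h : (x, i) ∈ F ×ˢ Set.Iio m),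
          (⟨(x, i), h⟩ : ↥(F ×ˢ Set.Iio m)) ∈ E ↔ x ∈ A := by
        filter_upwards [hinv'] with x hx i h
        have h1 : (((1 : S), Multiplicative.ofAdd (-(i : ZMod m))) •
            (⟨(x, i), h⟩ : ↥(F ×ˢ Set.Iio m)) ∈ E)
            = ((⟨(x, i), h⟩ : ↥(F ×ˢ Set.Iio m)) ∈ E) := hx i h _
        have key : ((1 : S), Multiplicative.ofAdd (-(i : ZMod m))) •
            (⟨(x, i), h⟩ : ↥(F ×ˢ Set.Iio m)) = ⟨(x, 0), h.1, h0⟩ := by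
          refine Subtype.ext ((hsmul _ _).trans (Prod.ext (one_smul Γ x) ?_))
          simp
        rw [key] at h1
        rw [← h1]
        exact ⟨fun hE => ⟨h.1, hE⟩, fun ⟨_, hE⟩ => hE⟩
      rw [eventuallyConst_set]
      have h2 := eventuallyConst_set.1 (herg.aeconst_of_forall_preimage_smul_ae_eq hAm hAinv)
      rw [ProfiniteSystem.ae_iff_cond hF, ProfiniteSystem.ae_iff_cond hF] at h2
      refine h2.imp (fun h2 => ?_) (fun h2 => ?_)
      · filter_upwards [ae_amplifiedMeasure_of_ae (t := t) hY (h2.and hEA)] with y hy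
        exact (hy.2 y.1.2 y.2).2 (hy.1 y.2.1)
      · filter_upwards [ae_amplifiedMeasure_of_ae (t := t) hY (h2.and hEA)] with y hy
        exact fun h => hy.1 y.2.1 ((hy.2 y.1.2 y.2).1 h)
  · intro p hp
    refine measure_mono_null (t := ∅) ?_ measure_empty
    intro y hy
    apply hp
    have hy' : p • y = y := hy
    have e := (hsmul p y).symm.trans (congrArg Subtype.val hy')
    have e1 : (p.1 : Γ) = 1 := hfree _ y.2.1 _ (congrArg Prod.fst e)
    have e2 : (p.2.toAdd + (y.1.2 : ZMod m)).val = y.1.2 := congrArg Prod.snd e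
    have e3 : p.2.toAdd + (y.1.2 : ZMod m) = (y.1.2 : ZMod m) := by
      rw [← ZMod.natCast_zmod_val (p.2.toAdd + (y.1.2 : ZMod m)), e2]
    exact Prod.ext (Subtype.ext e1) (add_eq_right.1 e3)

end CyclicAmplification

/-! ### The amplifications induced by free actions -/

section Final

open scoped ENNReal ProbabilityTheory

/-- An ergodic action of a subgroup of `S` makes a measure preserving action of `S` ergodic. -/
theorem ErgodicSMul.of_le {Γ X : Type*} [Group Γ] [MulAction Γ X] [MeasurableSpace X]
    {μ : Measure X} {Δ S : Subgroup Γ} (h : ErgodicSMul Δ X μ) (hΔ : Δ ≤ S)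
    (hS : SMulInvariantMeasure S X μ) : ErgodicSMul S X μ where
  toSMulInvariantMeasure := hS
  aeconst_of_forall_preimage_smul_ae_eq hA hinv :=
    h.aeconst_of_forall_preimage_smul_ae_eq hA fun g => hinv ⟨g, hΔ g.2⟩

theorem corollary5p7 {Γ : Type u} [Group Γ] [Countable Γ]
    (Γ₀ : Subgroup Γ) [Γ₀.Normal] [Infinite Γ₀]
    (hT : HasRelativePropertyT.{u, v} Γ₀) (hfg : Group.FG (Γ ⧸ Γ₀))
    {X : Type v} [MeasurableSpace X] [StandardBorelSpace X]
    (μ : Measure X) [IsProbabilityMeasure μ]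
    [MulAction Γ X] [MeasurableConstSMul Γ X]
    (hfree : IsEssentiallyFree Γ μ) (herg : ErgodicSMul Γ X μ) (herg₀ : ErgodicSMul Γ₀ X μ)
    (T : FiniteActionTower.{u, w} Γ) (hlim : T.HasLimit μ) :
    amplificationSet μ (MulAction.orbitRel Γ X) =
        {t : ℝ | ∃ m n : ℕ, 1 ≤ m ∧ t = (m : ℝ) / (Nat.card (T.Level n) : ℝ)} ∧
      amplificationSet μ (MulAction.orbitRel Γ X) ⊆ {t : ℝ | ∃ p : ℚ, 0 < p ∧ t = (p : ℝ)} := by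
  have hinv : SMulInvariantMeasure Γ X μ := herg.toSMulInvariantMeasure
  obtain ⟨P, X₀, -, hX₀inv, hX₀ae, hX₀free, hsep, hex, hfib⟩ :=
    hlim.exists_system Γ₀ herg₀ hfree.ae_forall
  have hcard : ∀ n, 0 < Nat.card (T.Level n) := fun n =>
    have : Nonempty (T.Level n) := nonempty_of_isProbabilityMeasure (T.measure n)
    Nat.card_pos
  have hdiv : ∀ m n : ℕ, ENNReal.ofReal ((m : ℝ) / (Nat.card (T.Level n) : ℝ))
      = m * (Nat.card (T.Level n) : ℝ≥0∞)⁻¹ := by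
    intro m n
    rw [ENNReal.ofReal_div_of_pos (Nat.cast_pos.2 (hcard n)), ENNReal.ofReal_natCast,
      ENNReal.ofReal_natCast, div_eq_mul_inv]
  have heq : amplificationSet μ (MulAction.orbitRel Γ X) =
      {t : ℝ | ∃ m n : ℕ, 1 ≤ m ∧ t = (m : ℝ) / (Nat.card (T.Level n) : ℝ)} := by
    refine Set.Subset.antisymm ?_ ?_
    · rintro t ⟨ht, Y, hY, hYt, Λ, _, _, Z, _, _, ρ, _, _, _, hergZ, hfreeZ, hOE⟩
      let _ : MeasurableSpace Λ := ⊤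
      have : DiscreteMeasurableSpace Λ := ⟨fun _ => trivial⟩
      obtain ⟨K⟩ := exists_partialOrbitEquivalence ht hY hYt hfreeZ hOE
      obtain ⟨n, a, m, ha, hm, hc⟩ := K.exists_scale_eq hergZ P hT hfg herg₀ hX₀ae hX₀inv
        hX₀free hsep
      refine ⟨m, n, hm, ?_⟩
      rw [(hfib n a ha).2, ← hdiv] at hc
      exact (ENNReal.ofReal_eq_ofReal_iff ht.le (by positivity)).1 hc
    · rintro t ⟨m, n, hm, rfl⟩
      have : NeZero m := ⟨by omega⟩
      obtain ⟨a, ha⟩ := hex n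
      obtain ⟨haX₀, hav⟩ := hfib n a ha
      have hav' : ENNReal.ofReal ((m : ℝ) / (Nat.card (T.Level n) : ℝ)) = m * μ (P.fib a) := by
        rw [hdiv, hav]
      refine ⟨div_pos (Nat.cast_pos.2 hm) (Nat.cast_pos.2 (hcard n)), P.fib a ×ˢ Set.Iio m,
        (P.measurableSet_fib a).prod .of_discrete, ?_, ?_⟩
      · rw [Measure.prod_prod, ← Finset.coe_Iio, Measure.count_apply_finset, Nat.card_Iio, hav',
          mul_comm]
      · refine isInducedByFreeErgodicAction_prod (S := MulAction.stabilizer Γ a)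
          (P.measurableSet_fib a) ha (fun g hg x => P.smul_mem_fib hg) (fun γ x hx hγ => ?_)
          (fun x hx => hX₀free x (haX₀ hx)) ?_ hav'
        · rw [P.mem_fib, P.proj_smul, P.mem_fib.1 hx] at hγ
          exact hγ
        · exact (P.ergodicSMul_cond Γ₀ herg₀ a rfl).of_le inf_le_right
            (P.smulInvariantMeasure_cond a le_rfl)
  refine ⟨heq, heq ▸ ?_⟩
  rintro t ⟨m, n, hm, rfl⟩
  have := hcard n
  exact ⟨(m : ℚ) / (Nat.card (T.Level n) : ℚ), by positivity, by push_cast; rfl⟩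

end Final
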